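/- Let $n>3$. Let $\mathrm{Gal}(n)$ be the group of real $(n+2)\times(n+2)$ matrices $\left(\begin{smallmatrix}\rho & v & x\\ 0&1&x_0\\ 0&0&1\end{smallmatrix}\right)$ with $\rho\in O(n)$, $v,x\in\mathbb R^n$, $x_0\in\mathbb R$, and let $\mathfrak{gal}(n)$ be its Lie algebra of matrices $\left(\begin{smallmatrix}K & v & x\\ 0&0&x_0\\ 0&0&0\end{smallmatrix}\right)$ with $K^T=-K$. Identify $A^*\in\mathfrak{gal}(n)^*$ with a matrix $A$ of the same form with entries $K^*,v^*,x^*,x_0^*$ through $A^*(B)=\operatorname{tr}(A^TB)$, and regard elements of the symmetric algebra $S(\mathfrak{gal}(n))$ as polynomials on $\mathfrak{gal}(n)^*$, with coordinates $K_{ij},V_i,X_i$ taking the values $K^*_{ij},v^*_i,x^*_i$. Put $$Q_1=\sum_i X_i^2,\qquad Q_2=\Big(\sum_i X_i^2\Big)\Big(\sum_i V_i^2\Big)-\Big(\sum_i X_iV_i\Big)^2,$$ and for $k\ge 2$ with $2k\le n+2$ let $M_{2k}$ be the sum of the principal $2k\times 2k$ minors that contain the last two rows and columns of the skew-symmetric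 $(n+2)\times(n+2)$ matrix $$\begin{pmatrix}K & V & X\\ -V^T&0&0\\ -X^T&0&0\end{pmatrix}.$$ Put $Q_k=M_{2k}$ for $3\le k\le \lfloor n/2\rfloor+1$. Then: 1. The algebra of invariants $S(\mathfrak{gal}(n))^{\mathrm{Gal}(n)}$ of the adjoint action is generated by $Q_1,Q_2,Q_3,\dots,Q_{\lfloor n/2\rfloor+1}$, and these polynomials are algebraically independent over $\mathbb R$. 2. For all $K^*,v^*,x^*,x_0^*$ and all $k\ge2$ with $2k\le n+2$, the value of $M_{2k}$ is $Q_2$ times the coefficient of $\lambda^{\,n+4-2k}$ in $\det(\lambda I-PK^*P)$, where $P$ is the orthogonal projection of $\mathbb R^n$ onto $\operatorname{span}\{x^*,v^*\}^\perp$. In particular $M_4=Q_2$. 3. Let $\lambda:S(\mathfrak{gal}(n))\to U(\mathfrak{gal}(n))$ be the symmetrization map $a_1\cdots a_m\mapsto\frac1{m!}\sum_{\sigma}a_{\sigma(1)}\cdots a_{\sigma(m)}$. The elements $\lambda(Q_1),\dots,\lambda(Q_{\lfloor n/2\rfloor+1})$ lie in the center of $U(\mathfrak{gal}(n))$, are algebraically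 independent over $\mathbb R$, and generate the algebra $U(\mathfrak{gal}(n))^{\mathrm{Gal}(n)}$ of all $\mathrm{Ad}(\mathrm{Gal}(n))$-invariant elements of $U(\mathfrak{gal}(n))$. If $n$ is odd, they generate the whole center of $U(\mathfrak{gal}(n))$. -/

import Mathlib

noncomputable section

namespace Galilei

open Matrix

attribute [local instance 100] LieRing.ofAssociativeRing

/-- Real square matrices of size `n + 2`; the rows and columns `inl 0, …, inl (n-1)` are the first
`n` ones, and `inr 0`, `inr 1` are the last two. -/
abbrev Mat (n : ℕ) : Type := Matrix (Fin n ⊕ Fin 2) (Fin n ⊕ Fin 2) ℝ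

/-- The block matrix `[[K, C], [0, [[0, t], [0, 0]]]]`. The columns `0` and `1` of `C` are the
boost part `v` and the translation part `x`, and `t` is the time entry `x₀`. -/
def algMat {n : ℕ} (K : Matrix (Fin n) (Fin n) ℝ) (C : Matrix (Fin n) (Fin 2) ℝ) (t : ℝ) : Mat n :=
  fromBlocks K C 0 !![0, t; 0, 0]

/-- The block matrix `[[ρ, C], [0, [[1, t], [0, 1]]]]`. -/
def grpMat {n : ℕ} (ρ : Matrix (Fin n) (Fin n) ℝ) (C : Matrix (Fin n) (Fin 2) ℝ) (t : ℝ) : Mat n :=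
  fromBlocks ρ C 0 !![1, t; 0, 1]

/-- The Galilean Lie algebra `gal(n)`, with the commutator of matrices as bracket. -/
def gal (n : ℕ) : LieSubalgebra ℝ (Mat n) where
  carrier := {B | ∃ K C t, Kᵀ = -K ∧ B = algMat K C t}
  zero_mem' := ⟨0, 0, 0, by simp, by
    ext i j; rcases i with i | i <;> rcases j with j | j <;> simp [algMat]
    fin_cases i <;> fin_cases j <;> simp⟩
  add_mem' := by
    rintro _ _ ⟨K, C, t, hK, rfl⟩ ⟨K', C', t', hK', rfl⟩
    refine ⟨K + K', C + C', t + t', by rw [transpose_add, hK, hK']; abel, ?_⟩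
    simp [algMat, fromBlocks_add]
  smul_mem' := by
    rintro c _ ⟨K, C, t, hK, rfl⟩
    refine ⟨c • K, c • C, c * t, by rw [transpose_smul, hK, smul_neg], ?_⟩
    simp [algMat, fromBlocks_smul]
  lie_mem' := by
    rintro _ _ ⟨K, C, t, hK, rfl⟩ ⟨K', C', t', hK', rfl⟩
    refine ⟨K * K' - K' * K, (K * C' + C * !![0, t'; 0, 0]) - (K' * C + C' * !![0, t; 0, 0]), 0,
      ?_, ?_⟩
    · rw [transpose_sub, transpose_mul, transpose_mul, hK, hK']; simp
    · rw [Ring.lie_def]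
      simp only [algMat, fromBlocks_multiply]
      ext i j
      rcases i with i | i <;> rcases j with j | j <;> simp
      fin_cases i <;> fin_cases j <;> simp

/-- The Galilean group `Gal(n)`. -/
def Gal (n : ℕ) : Subgroup (Mat n)ˣ where
  carrier := {g | ∃ ρ ∈ orthogonalGroup (Fin n) ℝ, ∃ C t, (g : Mat n) = grpMat ρ C t}
  one_mem' := ⟨1, one_mem _, 0, 0, by simp [grpMat, ← one_fin_two]⟩
  mul_mem' := by
    rintro a b ⟨ρ, hρ, C, t, ha⟩ ⟨ρ', hρ', C', t', hb⟩
    refine ⟨ρ * ρ', mul_mem hρ hρ', ρ * C' + C * !![1, t'; 0, 1], t' + t, ?_⟩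
    rw [Units.val_mul, ha, hb]
    simp [grpMat, fromBlocks_multiply]
  inv_mem' := by
    rintro a ⟨ρ, hρ, C, t, ha⟩
    refine ⟨ρᵀ, ?_, -(ρᵀ * C * !![1, -t; 0, 1]), -t, ?_⟩
    · simpa [star_eq_conjTranspose] using Unitary.star_mem hρ
    · rw [Units.inv_eq_of_mul_eq_one_right]
      rw [ha]
      have h : ρ * ρᵀ = 1 := by
        simpa [star_eq_conjTranspose] using (mem_orthogonalGroup_iff (Fin n) ℝ).1 hρ
      simp [grpMat, fromBlocks_multiply, ← Matrix.mul_assoc, h, ← one_fin_two]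

theorem conj_mem (n : ℕ) (g : Gal n) (B : gal n) :
    ((g : (Mat n)ˣ) : Mat n) * (B : Mat n) * (((g : (Mat n)ˣ)⁻¹ : (Mat n)ˣ) : Mat n) ∈ gal n := by
  obtain ⟨g, ρ, hρ, C, t, hg⟩ := g
  obtain ⟨B, K, D, s, hK, rfl⟩ := B
  have h : ρ * ρᵀ = 1 := by
    simpa [star_eq_conjTranspose] using (mem_orthogonalGroup_iff (Fin n) ℝ).1 hρ
  have hinv : ((g⁻¹ : (Mat n)ˣ) : Mat n) = grpMat ρᵀ (-(ρᵀ * C * !![1, -t; 0, 1])) (-t) := by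
    rw [Units.inv_eq_of_mul_eq_one_right]
    rw [hg]
    simp [grpMat, fromBlocks_multiply, ← Matrix.mul_assoc, h, ← one_fin_two]
  refine ⟨ρ * K * ρᵀ, ρ * K * (-(ρᵀ * C * !![1, -t; 0, 1])) +
    (ρ * D + C * !![0, s; 0, 0]) * !![1, -t; 0, 1], s, ?_, ?_⟩
  · simp [transpose_mul, hK, Matrix.mul_assoc]
  · simp only [hinv, hg]
    simp only [grpMat, algMat, fromBlocks_multiply]
    ext i j
    rcases i with i | i <;> rcases j with j | j <;> simp
    fin_cases i <;> fin_cases j <;> simp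

/-- The adjoint action `Ad(g) B = g B g⁻¹` of `Gal(n)` on `gal(n)`. -/
def Ad (n : ℕ) (g : Gal n) : gal n →ₗ⁅ℝ⁆ gal n where
  toFun B := ⟨_, conj_mem n g B⟩
  map_add' A B := by ext1; simp [mul_add, add_mul]
  map_smul' c B := by ext1; simp
  map_lie' := by
    intro A B
    ext1
    simp only [LieSubalgebra.coe_bracket, Ring.lie_def, mul_sub, sub_mul]
    simp [mul_assoc]

/-- The symmetric algebra `S(gal(n))`. -/
abbrev S (n : ℕ) : Type := SymmetricAlgebra ℝ (gal n)

/-- The universal enveloping algebra `U(gal(n))`. -/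
abbrev U (n : ℕ) : Type := UniversalEnvelopingAlgebra ℝ (gal n)

/-- `Ad(g)` extended to an algebra endomorphism of `S(gal(n))`. -/
def AdS (n : ℕ) (g : Gal n) : S n →ₐ[ℝ] S n :=
  SymmetricAlgebra.lift (SymmetricAlgebra.ι ℝ (gal n) ∘ₗ (Ad n g : gal n →ₗ[ℝ] gal n))

/-- `Ad(g)` extended to an algebra endomorphism of `U(gal(n))`. -/
def AdU (n : ℕ) (g : Gal n) : U n →ₐ[ℝ] U n :=
  UniversalEnvelopingAlgebra.lift ℝ ((UniversalEnvelopingAlgebra.ι ℝ).comp (Ad n g))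

/-- The algebra of invariants `S(gal(n))^{Gal(n)}`. -/
def invariantsS (n : ℕ) : Subalgebra ℝ (S n) :=
  ⨅ g : Gal n, AlgHom.equalizer (AdS n g) (AlgHom.id ℝ (S n))

/-- The algebra of invariants `U(gal(n))^{Gal(n)}`. -/
def invariantsU (n : ℕ) : Subalgebra ℝ (U n) :=
  ⨅ g : Gal n, AlgHom.equalizer (AdU n g) (AlgHom.id ℝ (U n))

/-- The linear functional `A^*(B) = tr(Aᵀ B)` on `gal(n)` represented by the matrix `A`. -/
def dualOf {n : ℕ} (A : Mat n) : gal n →ₗ[ℝ] ℝ where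
  toFun B := (Aᵀ * (B : Mat n)).trace
  map_add' B B' := by simp [mul_add]
  map_smul' c B := by simp

/-- The value at `A^* ∈ gal(n)^*` of an element of `S(gal(n))`, viewed as a polynomial on
`gal(n)^*`. -/
def evalAt {n : ℕ} (A : Mat n) : S n →ₐ[ℝ] ℝ := SymmetricAlgebra.lift (dualOf A)

/-- The element of `gal(n)` whose value at `A^*` is the entry `K^*_{ij}`, for `A` with a
skew-symmetric upper left block. -/
def eltK {n : ℕ} (i j : Fin n) : gal n :=
  ⟨algMat ((1 / 2 : ℝ) • (single i j 1 - single j i 1)) 0 0, _, _, _, by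
    rw [transpose_smul, ← smul_neg]; simp, rfl⟩

/-- The element of `gal(n)` whose value at `A^*` is the entry in row `i` and column `a` of the upper
right block, that is `v^*_i` for `a = 0` and `x^*_i` for `a = 1`. -/
def eltC {n : ℕ} (i : Fin n) (a : Fin 2) : gal n :=
  ⟨algMat 0 (single i a 1) 0, _, _, _, by simp, rfl⟩

/-- The coordinate polynomial `K_{ij}`. -/
def K {n : ℕ} (i j : Fin n) : S n := SymmetricAlgebra.ι ℝ (gal n) (eltK i j)

/-- The coordinate polynomial `V_i`. -/
def V {n : ℕ} (i : Fin n) : S n := SymmetricAlgebra.ι ℝ (gal n) (eltC i 0)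

/-- The coordinate polynomial `X_i`. -/
def X {n : ℕ} (i : Fin n) : S n := SymmetricAlgebra.ι ℝ (gal n) (eltC i 1)

/-- `Q₁ = ∑ X_i²`. -/
def Q1 (n : ℕ) : S n := ∑ i, X i ^ 2

/-- `Q₂ = (∑ X_i²) (∑ V_i²) - (∑ X_i V_i)²`. -/
def Q2 (n : ℕ) : S n := (∑ i, X i ^ 2) * (∑ i, V i ^ 2) - (∑ i, X i * V i) ^ 2

/-- The skew-symmetric `(n+2) × (n+2)` matrix `[[K, v, x], [-vᵀ, 0, 0], [-xᵀ, 0, 0]]` of coordinate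
polynomials. -/
def skewMat (n : ℕ) : Matrix (Fin n ⊕ Fin 2) (Fin n ⊕ Fin 2) (S n) :=
  fromBlocks (of fun i j => K i j) (of fun i => ![V i, X i])
    (-(of fun i => ![V i, X i])ᵀ) 0

/-- The sum of the principal `m × m` minors of `skewMat n` that contain the last two rows and
columns. -/
def minorSum (n m : ℕ) : S n :=
  ∑ s ∈ (Finset.univ : Finset (Fin n ⊕ Fin 2)).powersetCard m with
    Sum.inr 0 ∈ s ∧ Sum.inr 1 ∈ s,
    ((skewMat n).submatrix ((↑) : s → Fin n ⊕ Fin 2) (↑)).det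

/-- The `⌊n/2⌋ + 1` generators: `Q₁`, `Q₂` and the minor sums of sizes `6, 8, …, 2(⌊n/2⌋ + 1)`. -/
def gen (n : ℕ) (i : Fin (n / 2 + 1)) : S n :=
  if (i : ℕ) = 0 then Q1 n else if (i : ℕ) = 1 then Q2 n else minorSum n (2 * (i + 1))

/-- The average over all orderings of the product in the enveloping algebra,
`(1/m!) ∑_σ a_{σ(1)} ⋯ a_{σ(m)}`. -/
def symProd {L : Type*} [LieRing L] [LieAlgebra ℝ L] {m : ℕ} (a : Fin m → L) :
    UniversalEnvelopingAlgebra ℝ L :=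
  ((m.factorial : ℝ)⁻¹) • ∑ σ : Equiv.Perm (Fin m),
    (List.ofFn fun i => UniversalEnvelopingAlgebra.ι ℝ (a (σ i))).prod

/-- The symmetrization map `λ : S(L) → U(L)`: the linear map that sends each monomial
`a₁ ⋯ a_m` in the elements of a basis of `L` to `symProd a`. (By multilinearity `λ` sends
`a₁ ⋯ a_m` to `symProd a` for all `a₁, …, a_m` in `L`, so the choice of basis is immaterial.) -/
def symmetrization (L : Type*) [LieRing L] [LieAlgebra ℝ L] :
    SymmetricAlgebra ℝ L →ₗ[ℝ] UniversalEnvelopingAlgebra ℝ L :=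
  let b := Module.Free.chooseBasis ℝ L
  b.symmetricAlgebra.constr ℝ fun s =>
    symProd fun i : Fin (Finsupp.toMultiset s).toList.length =>
      b ((Finsupp.toMultiset s).toList.get i)

/-- The endomorphism `P K P` of Euclidean `n`-space, where `P` is the orthogonal projection onto
`span {x, v}ᗮ`. -/
def compress {n : ℕ} (K : Matrix (Fin n) (Fin n) ℝ) (v x : EuclideanSpace ℝ (Fin n)) :
    EuclideanSpace ℝ (Fin n) →ₗ[ℝ] EuclideanSpace ℝ (Fin n) :=
  let P : EuclideanSpace ℝ (Fin n) →ₗ[ℝ] EuclideanSpace ℝ (Fin n) :=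
    ((Submodule.span ℝ {x, v})ᗮ.starProjection).toLinearMap
  P ∘ₗ Matrix.toEuclideanLin K ∘ₗ P

end Galilei

end

/-! An invariant is a polynomial in (K, v, x, x₀) that is constant on coadjoint orbits. The sums
M_{2k} are coefficients of the bordered determinant `bordPoly`, det [[λ + K, W], [-Wᵀ, 0]] with W =
(v, x). Rotations, time shifts, and boosts with space translations multiply this matrix on both
sides by factors whose determinants have product 1, so the coefficients are invariant
(`gen_mem_invariantsS`). Rotating x and v into the first two coordinates factors the determinant as
Q₂ times a characteristic polynomial on the complement (`evalAt_minorSum`).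

Generation rests on a slice: x = a e₀, v = b e₁, K a sum of plane blocks with parameters θ on the
complement, x₀ = 0. Every orbit with Q₂ ≠ 0 meets it, so an invariant is determined by its
restriction to the slice (`eq_zero_of_slice`). Sign changes and permutations in O(n) force this
restriction to be a polynomial in a², b² and the elementary symmetric functions e_j(θ²), while the
generators restrict to a² and a²b² e_j(θ²), j ≥ 0. Hence (Q₁Q₂)^k f is a polynomial in the
generators for some k. The factors Q₁ and Q₂ cancel one at a time (`mem_adjoin_of_mul_mem`), because
there are complex points where Q₁, respectively Q₂, vanishes while the other generators stay
algebraically independent (`exists_point_Q1`, `exists_point_Q2`). The second point uses four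
coordinates; this is where n > 3 enters (`adjoin_gen`).

In the enveloping algebra, symmetrization is equivariant, multiplicative up to lower order,
surjective, and injective on symbols (`eq_zero_of_symmetrization_mem_filtU`). Injectivity is the
needed part of Poincaré–Birkhoff–Witt; it is proved by letting U act on polynomials through
left-invariant vector fields. Independence and generation then lift by induction on order
(`algebraicIndependent_of_symbols`, `adjoin_map_eq_invariantsU`).

The center corresponds to the elements killed by every ad(B) (`symmetrization_mem_center`).
Differentiating one-parameter subgroups shows that group invariants are such elements. Conversely,
ad-invariance integrates to boosts, translations and plane rotations, so all reflections act on f in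
the same way. For odd n the slice has a coordinate on which K, v and x vanish; reflecting it fixes
the slice pointwise, hence fixes f (`mem_invariantsS_of_adS_eq_zero`). -/

noncomputable section

namespace Galilei

open Matrix

attribute [local instance 100] LieRing.ofAssociativeRing

/-! ### Bordered determinants and skew-symmetric block matrices. -/

section LinearAlgebra

variable {R : Type*} [CommRing R] {ι κ : Type*} [Fintype ι] [DecidableEq ι]
  [Fintype κ] [DecidableEq κ]

/-- The expansion of `det (diagonal d + N)` in principal minors of `N`. -/
theorem det_diagonal_add (d : ι → R) (N : Matrix ι ι R) :
    (diagonal d + N).det = ∑ s : Finset ι, (∏ i ∈ sᶜ, d i) *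
      (N.submatrix ((↑) : s → ι) (↑)).det := by
  have h : (diagonal d + N).det = (detRowAlternating : (ι → R) [⋀^ι]→ₗ[R] R)
      ((fun i => N i) + fun i => d i • (1 : Matrix ι ι R) i) := by
    rw [add_comm]
    change det _ = det _
    congr 1
    ext i j
    simp [diagonal_apply, one_apply]
  rw [h]
  refine ((detRowAlternating : (ι → R) [⋀^ι]→ₗ[R] R).toMultilinearMap.map_add_univ _ _).trans ?_
  refine Finset.sum_congr rfl fun s _ => ?_
  have h2 : s.piecewise (fun i => N i) (fun i => d i • (1 : Matrix ι ι R) i) =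
      fun i => (if i ∈ s then 1 else d i) •
        s.piecewise (fun i => N i) (fun i => (1 : Matrix ι ι R) i) i := by
    funext i
    by_cases hi : i ∈ s <;> simp [hi]
  rw [h2]
  refine ((detRowAlternating : (ι → R) [⋀^ι]→ₗ[R] R).toMultilinearMap.map_smul_univ _ _).trans ?_
  rw [smul_eq_mul]
  congr 1
  · rw [← Finset.prod_mul_prod_compl s, Finset.prod_congr rfl (fun i hi => if_pos hi),
      Finset.prod_const_one, one_mul]
    exact Finset.prod_congr rfl fun i hi => if_neg (Finset.mem_compl.1 hi)
  · exact det_piecewise_one_eq_submatrix_det N s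

/-- The polynomial `det [[X + K, W], [-Wᵀ, 0]]`. -/
def bordPoly (K : Matrix ι ι R) (W : Matrix ι (Fin 2) R) : Polynomial R :=
  (fromBlocks ((Polynomial.X : Polynomial R) • (1 : Matrix ι ι (Polynomial R)) +
    K.map Polynomial.C) (W.map Polynomial.C) (-(W.map Polynomial.C)ᵀ) 0).det

/-- The diagonal carries the variable on `ι` and 0 on the last two places, so a principal minor
survives the expansion exactly when its index set contains both of them. -/
theorem coeff_bordPoly (K : Matrix ι ι R) (W : Matrix ι (Fin 2) R) {m : ℕ}
    (hm : m ≤ Fintype.card ι + 2) :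
    (bordPoly K W).coeff (Fintype.card ι + 2 - m) =
      ∑ s ∈ (Finset.univ : Finset (ι ⊕ Fin 2)).powersetCard m with
        Sum.inr 0 ∈ s ∧ Sum.inr 1 ∈ s,
        ((fromBlocks K W (-Wᵀ) 0).submatrix ((↑) : s → ι ⊕ Fin 2) (↑)).det := by
  have h1 : fromBlocks ((Polynomial.X : Polynomial R) • (1 : Matrix ι ι (Polynomial R)) +
      K.map Polynomial.C) (W.map Polynomial.C) (-(W.map Polynomial.C)ᵀ) 0 =
      diagonal (Sum.elim (fun _ => (Polynomial.X : Polynomial R)) 0) +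
        (fromBlocks K W (-Wᵀ) 0).map Polynomial.C := by
    ext i j
    rcases i with i | i <;> rcases j with j | j <;>
      simp [diagonal_apply, one_apply]
  have h2 : ∀ s : Finset (ι ⊕ Fin 2),
      (∏ i ∈ sᶜ, (Sum.elim (fun _ => (Polynomial.X : Polynomial R)) 0 : _ → Polynomial R) i) *
      (((fromBlocks K W (-Wᵀ) 0).map Polynomial.C).submatrix ((↑) : s → ι ⊕ Fin 2) (↑)).det =
      if Sum.inr 0 ∈ s ∧ Sum.inr 1 ∈ s then
        Polynomial.monomial (Fintype.card ι + 2 - s.card)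
          ((fromBlocks K W (-Wᵀ) 0).submatrix ((↑) : s → ι ⊕ Fin 2) (↑)).det
      else 0 := by
    intro s
    have hdet : (((fromBlocks K W (-Wᵀ) 0).map Polynomial.C).submatrix
        ((↑) : s → ι ⊕ Fin 2) (↑)).det = Polynomial.C
          ((fromBlocks K W (-Wᵀ) 0).submatrix ((↑) : s → ι ⊕ Fin 2) (↑)).det := by
      exact (RingHom.map_det Polynomial.C _).symm
    split_ifs with hs
    · rw [hdet, Finset.prod_congr rfl (g := fun _ => (Polynomial.X : Polynomial R)),
        Finset.prod_const, Finset.card_compl, ← Polynomial.C_mul_X_pow_eq_monomial, mul_comm]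
      · simp
      · rintro (i | i) hi
        · rfl
        · exfalso
          rw [Finset.mem_compl] at hi
          fin_cases i
          exacts [hi hs.1, hi hs.2]
    · obtain ⟨i, hi⟩ : ∃ i : Fin 2, Sum.inr i ∉ s := by
        by_contra! h
        exact hs ⟨h 0, h 1⟩
      rw [Finset.prod_eq_zero (i := Sum.inr i) (by simpa using hi) (by simp), zero_mul]
  have h3 : bordPoly K W = ∑ s : Finset (ι ⊕ Fin 2), _ :=
    (congrArg det h1).trans (det_diagonal_add _ _)
  rw [h3, Finset.sum_congr rfl fun s _ => h2 s, ← Finset.sum_filter, Polynomial.finsetSum_coeff]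
  simp_rw [Polynomial.coeff_monomial]
  rw [← Finset.sum_filter]
  refine Finset.sum_congr ?_ fun _ _ => rfl
  ext s
  have hs : s.card ≤ Fintype.card ι + 2 := by
    simpa using Finset.card_le_univ s
  simp only [Finset.mem_filter, Finset.mem_univ, true_and, Finset.mem_powersetCard,
    Finset.subset_univ]
  constructor
  · rintro ⟨h, h'⟩; exact ⟨by omega, h⟩
  · rintro ⟨h, h'⟩; exact ⟨h', by omega⟩

theorem bordPoly_submatrix (e : κ ≃ ι) (K : Matrix ι ι R) (W : Matrix ι (Fin 2) R) :
    bordPoly (K.submatrix e e) (W.submatrix e id) = bordPoly K W := by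
  rw [bordPoly, bordPoly, ← det_submatrix_equiv_self (Equiv.sumCongr e (Equiv.refl (Fin 2)))]
  congr 1
  ext i j
  rcases i with i | i <;> rcases j with j | j <;> simp [one_apply]

theorem bordPoly_conj {ρ : Matrix ι ι R} (hρ : ρᵀ * ρ = 1) (K : Matrix ι ι R)
    (W : Matrix ι (Fin 2) R) : bordPoly (ρᵀ * K * ρ) (ρᵀ * W) = bordPoly K W := by
  have h1 : (ρ.map Polynomial.C)ᵀ * ρ.map Polynomial.C = 1 := by
    rw [← transpose_map, ← Matrix.map_mul, hρ]
    simp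
  have h : fromBlocks ((Polynomial.X : Polynomial R) • (1 : Matrix ι ι (Polynomial R)) +
      (ρᵀ * K * ρ).map Polynomial.C) ((ρᵀ * W).map Polynomial.C)
      (-((ρᵀ * W).map Polynomial.C)ᵀ) (0 : Matrix (Fin 2) (Fin 2) (Polynomial R)) =
      fromBlocks (ρ.map Polynomial.C)ᵀ 0 0 1 *
      fromBlocks ((Polynomial.X : Polynomial R) • (1 : Matrix ι ι (Polynomial R)) +
      K.map Polynomial.C) (W.map Polynomial.C) (-(W.map Polynomial.C)ᵀ) 0 *
      fromBlocks (ρ.map Polynomial.C) 0 0 1 := by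
    simp [fromBlocks_multiply, Matrix.map_mul, Matrix.mul_add, Matrix.add_mul, h1, transpose_map]
  have h2 : (fromBlocks (ρ.map Polynomial.C)ᵀ 0 0 (1 : Matrix (Fin 2) (Fin 2) (Polynomial R))).det
      * (fromBlocks (ρ.map Polynomial.C) 0 0 (1 : Matrix (Fin 2) (Fin 2) (Polynomial R))).det
      = 1 := by
    rw [← det_mul]
    simp [fromBlocks_multiply, h1]
  rw [bordPoly, h, det_mul, det_mul, mul_right_comm, h2, one_mul, bordPoly]

/-- This is the invariance behind time shifts, which add a multiple of x to v. -/
theorem bordPoly_mul_right {T : Matrix (Fin 2) (Fin 2) R} (hT : T.det = 1) (K : Matrix ι ι R)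
    (W : Matrix ι (Fin 2) R) : bordPoly K (W * T) = bordPoly K W := by
  have h : fromBlocks ((Polynomial.X : Polynomial R) • (1 : Matrix ι ι (Polynomial R)) +
      K.map Polynomial.C) ((W * T).map Polynomial.C)
      (-((W * T).map Polynomial.C)ᵀ) (0 : Matrix (Fin 2) (Fin 2) (Polynomial R)) =
      fromBlocks 1 0 0 (T.map Polynomial.C)ᵀ *
      fromBlocks ((Polynomial.X : Polynomial R) • (1 : Matrix ι ι (Polynomial R)) +
      K.map Polynomial.C) (W.map Polynomial.C) (-(W.map Polynomial.C)ᵀ) 0 *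
      fromBlocks 1 0 0 (T.map Polynomial.C) := by
    simp [fromBlocks_multiply, Matrix.map_mul]
  have h2 : (T.map (Polynomial.C : R → Polynomial R)).det = 1 := by
    rw [← RingHom.mapMatrix_apply, ← RingHom.map_det, hT, map_one]
  rw [bordPoly, h, det_mul, det_mul]
  simp [h2, bordPoly]

/-- Adding combinations of the border rows and columns to the others changes K in this way; it is
the coadjoint action of boosts and space translations. -/
theorem bordPoly_add (K : Matrix ι ι R) (W D : Matrix ι (Fin 2) R) :
    bordPoly (K + (W * Dᵀ - D * Wᵀ)) W = bordPoly K W := by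
  have h : fromBlocks ((Polynomial.X : Polynomial R) • (1 : Matrix ι ι (Polynomial R)) +
      (K + (W * Dᵀ - D * Wᵀ)).map Polynomial.C) (W.map Polynomial.C)
      (-(W.map Polynomial.C)ᵀ) (0 : Matrix (Fin 2) (Fin 2) (Polynomial R)) =
      fromBlocks 1 (D.map Polynomial.C) 0 1 *
      fromBlocks ((Polynomial.X : Polynomial R) • (1 : Matrix ι ι (Polynomial R)) +
      K.map Polynomial.C) (W.map Polynomial.C) (-(W.map Polynomial.C)ᵀ) 0 *
      fromBlocks 1 0 (D.map Polynomial.C)ᵀ 1 := by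
    simp only [fromBlocks_multiply, Matrix.one_mul, Matrix.zero_mul, Matrix.mul_one,
      Matrix.mul_zero, add_zero, zero_add]
    congr 1
    have e1 : (K + (W * Dᵀ - D * Wᵀ)).map (Polynomial.C : R → Polynomial R) =
        K.map Polynomial.C + (W.map Polynomial.C * (D.map Polynomial.C)ᵀ -
          D.map Polynomial.C * (W.map Polynomial.C)ᵀ) := by
      rw [Matrix.map_add _ (map_add _), Matrix.map_sub _ (map_sub _), Matrix.map_mul,
        Matrix.map_mul, transpose_map, transpose_map]
    rw [e1, Matrix.mul_neg]
    abel
  rw [bordPoly, h, det_mul, det_mul]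
  simp [bordPoly]

theorem bordPoly_fromBlocks_diag (K : Matrix ι ι R) (W : Matrix ι (Fin 2) R) (L : Matrix κ κ R) :
    bordPoly (fromBlocks K 0 0 L) (fromRows W 0) = bordPoly K W *
      ((Polynomial.X : Polynomial R) • (1 : Matrix κ κ (Polynomial R)) + L.map Polynomial.C).det := by
  rw [bordPoly, bordPoly, ← det_fromBlocks_zero₂₁ _ 0, ← det_submatrix_equiv_self
    ((Equiv.sumAssoc _ _ _).trans (((Equiv.refl ι).sumCongr (Equiv.sumComm _ _)).trans
      (Equiv.sumAssoc _ _ _).symm) : (ι ⊕ Fin 2) ⊕ κ ≃ (ι ⊕ κ) ⊕ Fin 2)]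
  congr 1
  ext i j
  rcases i with (i | i) | i <;> rcases j with (j | j) | j <;>
    simp [one_apply]

/-- When W lives in the first two rows, only the block of K on the remaining coordinates matters. -/
theorem bordPoly_fromRows (K₁ : Matrix (Fin 2) (Fin 2) R) (K₂ : Matrix (Fin 2) κ R)
    (K₃ : Matrix κ (Fin 2) R) (L : Matrix κ κ R) (W : Matrix (Fin 2) (Fin 2) R) :
    bordPoly (fromBlocks K₁ K₂ K₃ L) (fromRows W 0) = Polynomial.C (W.det ^ 2) *
      ((Polynomial.X : Polynomial R) • (1 : Matrix κ κ (Polynomial R)) + L.map Polynomial.C).det := by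
  -- Exchanging the first two columns with the two border columns is an even permutation and makes
  -- the matrix block triangular, with diagonal blocks `W`, `X + L` and `-Wᵀ`.
  set σ : Equiv.Perm ((Fin 2 ⊕ κ) ⊕ Fin 2) :=
    Equiv.swap (Sum.inl (Sum.inl 0)) (Sum.inr 0) * Equiv.swap (Sum.inl (Sum.inl 1)) (Sum.inr 1)
    with hσ
  have hsign : Equiv.Perm.sign σ = 1 := by
    rw [hσ, Equiv.Perm.sign_mul, Equiv.Perm.sign_swap (by simp), Equiv.Perm.sign_swap (by simp)]
    rfl
  have h1 : ∀ a : Fin 2, σ (Sum.inl (Sum.inl a)) = Sum.inr a := by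
    intro a
    fin_cases a <;> simp [hσ, Equiv.swap_apply_def]
  have h2 : ∀ a : Fin 2, σ (Sum.inr a) = Sum.inl (Sum.inl a) := by
    intro a
    fin_cases a <;> simp [hσ, Equiv.swap_apply_def]
  have h3 : ∀ a : κ, σ (Sum.inl (Sum.inr a)) = Sum.inl (Sum.inr a) := by
    intro a
    simp [hσ, Equiv.swap_apply_def]
  have hdet : (W.map (Polynomial.C : R → Polynomial R)).det = Polynomial.C W.det := by
    rw [← RingHom.mapMatrix_apply, ← RingHom.map_det]
  have hp := det_permute' σ (fromBlocks ((Polynomial.X : Polynomial R) •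
    (1 : Matrix (Fin 2 ⊕ κ) (Fin 2 ⊕ κ) (Polynomial R)) +
    (fromBlocks K₁ K₂ K₃ L).map Polynomial.C) ((fromRows W (0 : Matrix κ (Fin 2) R)).map
      Polynomial.C) (-((fromRows W (0 : Matrix κ (Fin 2) R)).map Polynomial.C)ᵀ)
      (0 : Matrix (Fin 2) (Fin 2) (Polynomial R)))
  rw [hsign] at hp
  simp only [Units.val_one, Int.cast_one, one_mul] at hp
  have hm : (fromBlocks ((Polynomial.X : Polynomial R) •
    (1 : Matrix (Fin 2 ⊕ κ) (Fin 2 ⊕ κ) (Polynomial R)) +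
    (fromBlocks K₁ K₂ K₃ L).map Polynomial.C) ((fromRows W (0 : Matrix κ (Fin 2) R)).map
      Polynomial.C) (-((fromRows W (0 : Matrix κ (Fin 2) R)).map Polynomial.C)ᵀ)
      (0 : Matrix (Fin 2) (Fin 2) (Polynomial R))).submatrix id σ =
      fromBlocks (fromBlocks (W.map Polynomial.C) (K₂.map Polynomial.C) 0
        ((Polynomial.X : Polynomial R) • (1 : Matrix κ κ (Polynomial R)) + L.map Polynomial.C))
        (fromRows ((Polynomial.X : Polynomial R) • 1 + K₁.map Polynomial.C)
          (K₃.map Polynomial.C)) 0 (-(W.map Polynomial.C)ᵀ) := by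
    ext i j
    rcases i with (i | i) | i <;> rcases j with (j | j) | j <;>
      simp [h1, h2, h3, one_apply]
  rw [bordPoly, ← hp, hm, det_fromBlocks_zero₂₁, det_fromBlocks_zero₂₁, det_neg, det_transpose,
    hdet, map_pow]
  simp
  ring

/-- The skew-symmetric block matrix with `2 × 2` blocks `[[0, θ i], [-θ i, 0]]` and a zero block of
size `ε`. -/
def torus {m : ℕ} (ε : ℕ) (θ : Fin m → R) :
    Matrix ((Fin 2 × Fin m) ⊕ Fin ε) ((Fin 2 × Fin m) ⊕ Fin ε) R :=
  fromBlocks (blockDiagonal fun i => !![0, θ i; -θ i, 0]) 0 0 0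

theorem torus_transpose {m : ℕ} (ε : ℕ) (θ : Fin m → R) : (torus ε θ)ᵀ = -torus ε θ := by
  ext i j
  rcases i with ⟨i, k⟩ | i <;> rcases j with ⟨j, l⟩ | j <;> simp [torus, blockDiagonal_apply]
  by_cases h : k = l
  · subst h
    fin_cases i <;> fin_cases j <;> simp
  · simp [h, Ne.symm h]

/-- The elementary symmetric sums. -/
def esum {m : ℕ} (c : Fin m → R) (j : ℕ) : R :=
  ∑ s ∈ (Finset.univ : Finset (Fin m)).powersetCard j, ∏ i ∈ s, c i

theorem det_torus {m : ℕ} (ε : ℕ) (θ : Fin m → R) :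
    ((Polynomial.X : Polynomial R) • (1 : Matrix _ _ (Polynomial R)) +
      (torus ε θ).map Polynomial.C).det =
      Polynomial.expand R 2 (∏ i, (Polynomial.X + Polynomial.C (θ i ^ 2))) * Polynomial.X ^ ε := by
  have h : (Polynomial.X : Polynomial R) • (1 : Matrix _ _ (Polynomial R)) +
      (torus ε θ).map Polynomial.C = fromBlocks
        (blockDiagonal fun i => !![Polynomial.X, Polynomial.C (θ i);
          -Polynomial.C (θ i), Polynomial.X]) 0 0 ((Polynomial.X : Polynomial R) • 1) := by
    ext i j
    rcases i with ⟨i, k⟩ | i <;> rcases j with ⟨j, l⟩ | j <;>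
      simp [torus, blockDiagonal_apply, one_apply]
    by_cases h : k = l
    · subst h
      fin_cases i <;> fin_cases j <;> simp
    · simp [h]
  rw [h, det_fromBlocks_zero₂₁, det_blockDiagonal, det_smul, det_one, mul_one, Fintype.card_fin,
    map_prod]
  congr 1
  refine Finset.prod_congr rfl fun i _ => ?_
  simp [det_fin_two]
  ring

theorem coeff_det_torus {m : ℕ} (ε : ℕ) (θ : Fin m → R) {j : ℕ} (hj : j ≤ m) :
    ((Polynomial.X : Polynomial R) • (1 : Matrix _ _ (Polynomial R)) +
      (torus ε θ).map Polynomial.C).det.coeff (2 * (m - j) + ε) = esum (fun i => θ i ^ 2) j := by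
  rw [det_torus, Polynomial.coeff_mul_X_pow, mul_comm 2, Polynomial.coeff_expand_mul two_pos,
    Finset.prod_X_add_C_coeff _ _ (by simp)]
  rw [esum, Finset.card_univ, Fintype.card_fin, Nat.sub_sub_self hj]

theorem esum_zero {m : ℕ} (c : Fin m → R) : esum c 0 = 1 := by simp [esum]

end LinearAlgebra

/-! ### Orthonormal normal forms of skew-symmetric maps. -/

section NormalForm

open Module

theorem exists_orthonormalBasis_coe_eq {E ι : Type*} [NormedAddCommGroup E]
    [InnerProductSpace ℝ E] [FiniteDimensional ℝ E] [Fintype ι] {v : ι → E}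
    (hv : Orthonormal ℝ v) (h : finrank ℝ E = Fintype.card ι) :
    ∃ b : OrthonormalBasis ι ℝ E, ∀ i, b i = v i := by
  obtain ⟨b, hb⟩ := Orthonormal.exists_orthonormalBasis_extension_of_card_eq (𝕜 := ℝ) h
    (v := v) (s := Set.univ) (hv.comp _ Subtype.val_injective)
  exact ⟨b, fun i => hb i (Set.mem_univ i)⟩

/-- A nonzero skew-symmetric endomorphism rotates some plane. -/
theorem exists_plane_of_skew {E : Type*} [NormedAddCommGroup E]
    [InnerProductSpace ℝ E] [FiniteDimensional ℝ E] (T : E →ₗ[ℝ] E)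
    (hT : ∀ x y, inner ℝ (T x) y = -inner ℝ x (T y)) (h0 : T ≠ 0) :
    ∃ (u w : E) (r : ℝ), ‖u‖ = 1 ∧ ‖w‖ = 1 ∧ inner ℝ u w = 0 ∧ T u = r • w ∧ T w = -r • u := by
  have hsymm : (T ∘ₗ T).IsSymmetric := by
    intro x y
    simp [hT]
  -- T² is symmetric, hence diagonalizable. If all its eigenvalues vanished, then ‖T x‖² = -⟨x, T²
  -- x⟩ = 0 for every x.
  have hne : ∃ i, hsymm.eigenvalues rfl i ≠ 0 := by
    by_contra! h
    apply h0
    have h1 : T ∘ₗ T = 0 := by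
      refine (hsymm.eigenvectorBasis rfl).toBasis.ext fun i => ?_
      have := hsymm.apply_eigenvectorBasis rfl i
      rw [h i] at this
      simpa using this
    ext x
    have h2 : inner ℝ (T x) (T x) = 0 := by
      rw [hT, ← LinearMap.comp_apply, h1]
      simp
    simpa using h2
  obtain ⟨i, hi⟩ := hne
  set u := hsymm.eigenvectorBasis rfl i with hu
  set l := hsymm.eigenvalues rfl i
  have hTT : T (T u) = l • u := by
    exact hsymm.apply_eigenvectorBasis rfl i
  have hu1 : ‖u‖ = 1 := (hsymm.eigenvectorBasis rfl).orthonormal.1 i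
  have hr : ‖T u‖ * ‖T u‖ = -l := by
    rw [← real_inner_self_eq_norm_mul_norm, hT, hTT, inner_smul_right,
      real_inner_self_eq_norm_mul_norm, hu1]
    ring
  have hr0 : ‖T u‖ ≠ 0 := by
    intro h
    apply hi
    rw [h] at hr
    linarith
  refine ⟨u, ‖T u‖⁻¹ • T u, ‖T u‖, hu1, ?_, ?_, ?_, ?_⟩
  · rw [norm_smul, norm_inv, norm_norm, inv_mul_cancel₀ hr0]
  · have h1 := hT u u
    rw [real_inner_comm] at h1
    rw [inner_smul_right]
    have : inner ℝ u (T u) = 0 := by linarith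
    rw [this, mul_zero]
  · rw [smul_smul, mul_inv_cancel₀ hr0, one_smul]
  · rw [map_smul, hTT, smul_smul]
    congr 1
    have : l = -(‖T u‖ * ‖T u‖) := by linarith
    rw [this]
    field_simp

theorem torus_zero {m : ℕ} (ε : ℕ) : torus ε (0 : Fin m → ℝ) = 0 := by
  ext i j
  rcases i with ⟨i, k⟩ | i <;> rcases j with ⟨j, l⟩ | j <;> simp [torus, blockDiagonal_apply]
  fin_cases i <;> fin_cases j <;> simp

/-- The normal form of skew-symmetric endomorphisms of Euclidean spaces. -/
theorem skew_normal_form {ε : ℕ} (hε : ε ≤ 1) (m : ℕ) : ∀ {E : Type} [NormedAddCommGroup E]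
    [InnerProductSpace ℝ E] [FiniteDimensional ℝ E] (T : E →ₗ[ℝ] E)
    (_ : ∀ x y, inner ℝ (T x) y = -inner ℝ x (T y)) (_ : finrank ℝ E = 2 * m + ε),
    ∃ (b : OrthonormalBasis ((Fin 2 × Fin m) ⊕ Fin ε) ℝ E) (θ : Fin m → ℝ),
      ∀ i j, inner ℝ (b i) (T (b j)) = torus ε θ i j := by
  induction m with
  | zero =>
    intro E _ _ _ T hT hd
    let b := (stdOrthonormalBasis ℝ E).reindex (Fintype.equivOfCardEq
      (by simpa using hd) : Fin (finrank ℝ E) ≃ (Fin 2 × Fin 0) ⊕ Fin ε)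
    refine ⟨b, 0, ?_⟩
    rintro (⟨_, i⟩ | i) (⟨_, j⟩ | j)
    · exact i.elim0
    · exact i.elim0
    · exact j.elim0
    · have hij : i = j := by apply Fin.ext; omega
      subst hij
      rw [torus_zero]
      have := hT (b (Sum.inr i)) (b (Sum.inr i))
      rw [real_inner_comm] at this
      rw [Matrix.zero_apply]
      linarith
  | succ m ih =>
    intro E _ _ _ T hT hd
    by_cases h0 : T = 0
    · refine ⟨(stdOrthonormalBasis ℝ E).reindex (Fintype.equivOfCardEq (by simp [hd])), 0, ?_⟩
      intro i j
      rw [torus_zero, h0]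
      simp
    obtain ⟨u, w, r, hu, hw, huw, hTu, hTw⟩ := exists_plane_of_skew T hT h0
    have hon : Orthonormal ℝ ![u, w] := by
      rw [orthonormal_iff_ite]
      intro i j
      fin_cases i <;> fin_cases j <;> simp [huw, hu, hw, real_inner_comm]
    set P := Submodule.span ℝ (Set.range ![u, w]) with hP
    have hPd : finrank ℝ P = 2 := by
      rw [hP, finrank_span_eq_card hon.linearIndependent, Fintype.card_fin]
    have hFd : finrank ℝ Pᗮ = 2 * m + ε := by
      have := P.finrank_add_finrank_orthogonal
      omega
    have huP : u ∈ P := Submodule.subset_span ⟨0, rfl⟩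
    have hwP : w ∈ P := Submodule.subset_span ⟨1, rfl⟩
    have hmem : ∀ y, y ∈ Pᗮ ↔ inner ℝ u y = 0 ∧ inner ℝ w y = 0 := by
      intro y
      refine ⟨fun h => ⟨h u huP, h w hwP⟩, fun h => ?_⟩
      have h1 : P ≤ (Submodule.span ℝ {y})ᗮ := by
        rw [hP, Submodule.span_le]
        rintro _ ⟨i, rfl⟩
        rw [SetLike.mem_coe, Submodule.mem_orthogonal_singleton_iff_inner_left]
        fin_cases i
        exacts [h.1, h.2]
      intro z hz
      exact (Submodule.mem_orthogonal_singleton_iff_inner_left).1 (h1 hz)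
    have hinv : ∀ y ∈ Pᗮ, T y ∈ Pᗮ := by
      intro y hy
      rw [hmem] at hy ⊢
      have h1 := hT u y
      have h2 := hT w y
      rw [hTu, inner_smul_left, hy.2] at h1
      rw [hTw, inner_smul_left, hy.1] at h2
      simp only [mul_zero] at h1 h2
      constructor <;> linarith
    obtain ⟨c, θ, hc⟩ := ih (T.restrict hinv) (fun x y => hT x y) hFd
    have hc' : ∀ i j, inner ℝ (c i : E) (T (c j)) = torus ε θ i j := hc
    have hcu : ∀ i, inner ℝ u (c i : E) = 0 := fun i => ((hmem _).1 (c i).2).1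
    have hcw : ∀ i, inner ℝ w (c i : E) = 0 := fun i => ((hmem _).1 (c i).2).2
    have hcu' : ∀ i, inner ℝ (c i : E) u = 0 := fun i => by rw [real_inner_comm, hcu]
    have hcw' : ∀ i, inner ℝ (c i : E) w = 0 := fun i => by rw [real_inner_comm, hcw]
    have hTcu : ∀ i, inner ℝ u (T (c i : E)) = 0 := fun i =>
      ((hmem _).1 (hinv _ (c i).2)).1
    have hTcw : ∀ i, inner ℝ w (T (c i : E)) = 0 := fun i =>
      ((hmem _).1 (hinv _ (c i).2)).2
    have hcc : ∀ i j, inner ℝ (c i : E) (c j : E) = if i = j then 1 else 0 :=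
      fun i j => orthonormal_iff_ite.1 c.orthonormal i j
    let f : (Fin 2 × Fin (m + 1)) ⊕ Fin ε → E := Sum.elim
      (fun p => (Fin.cons (![u, w] p.1) (fun i => (c (Sum.inl (p.1, i)) : E)) : Fin (m + 1) → E) p.2)
      (fun k => c (Sum.inr k))
    have hf0 : ∀ a, f (Sum.inl (a, 0)) = ![u, w] a := fun a => rfl
    have hf1 : ∀ a i, f (Sum.inl (a, Fin.succ i)) = c (Sum.inl (a, i)) := fun a i => rfl
    have hf2 : ∀ k, f (Sum.inr k) = c (Sum.inr k) := fun k => rfl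
    have hf : Orthonormal ℝ f := by
      rw [orthonormal_iff_ite]
      rintro (⟨a, i⟩ | i) (⟨a', j⟩ | j)
      · refine Fin.cases ?_ (fun i => ?_) i <;> refine Fin.cases ?_ (fun j => ?_) j
        · rw [hf0, hf0]
          fin_cases a <;> fin_cases a' <;> simp [huw, hu, hw, real_inner_comm]
        · rw [hf0, hf1, if_neg (by simp [(Fin.succ_ne_zero _).symm])]
          fin_cases a <;> simp [hcu, hcw]
        · rw [hf0, hf1, if_neg (by simp)]
          fin_cases a' <;> simp [hcu', hcw']
        · rw [hf1, hf1, hcc]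
          simp
      · refine Fin.cases ?_ (fun i => ?_) i
        · rw [hf0, hf2]
          fin_cases a <;> simp [hcu, hcw]
        · rw [hf1, hf2, hcc]
          simp
      · refine Fin.cases ?_ (fun j => ?_) j
        · rw [hf0, hf2]
          fin_cases a' <;> simp [hcu', hcw']
        · rw [hf1, hf2, hcc]
          simp
      · rw [hf2, hf2, hcc]
        simp
    obtain ⟨b, hb⟩ := exists_orthonormalBasis_coe_eq hf (by simp [hd])
    -- The sign comes from ⟨u, T w⟩ = -r, which is the upper right entry of the new block.
    refine ⟨b, Fin.cons (-r) θ, ?_⟩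
    simp only [hb]
    rintro (⟨a, i⟩ | i) (⟨a', j⟩ | j)
    · refine Fin.cases ?_ (fun i => ?_) i <;> refine Fin.cases ?_ (fun j => ?_) j
      · rw [hf0, hf0]
        fin_cases a <;> fin_cases a' <;>
          simp [torus, blockDiagonal_apply, hTu, hTw, inner_smul_right, huw, hu, hw,
            real_inner_comm]
      · rw [hf0, hf1]
        fin_cases a <;>
          simp [torus, blockDiagonal_apply, hTcu, hTcw, (Fin.succ_ne_zero _).symm]
      · rw [hf0, hf1]
        fin_cases a' <;>
          simp [torus, blockDiagonal_apply, hTu, hTw, inner_smul_right, hcu', hcw']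
      · rw [hf1, hf1, hc']
        simp [torus, blockDiagonal_apply]
    · refine Fin.cases ?_ (fun i => ?_) i
      · rw [hf0, hf2]
        fin_cases a <;> simp [torus, hTcu, hTcw]
      · rw [hf1, hf2, hc']
        simp [torus]
    · refine Fin.cases ?_ (fun j => ?_) j
      · rw [hf0, hf2]
        fin_cases a' <;> simp [torus, hTu, hTw, inner_smul_right, hcu', hcw']
      · rw [hf1, hf2, hc']
        simp [torus]
    · rw [hf2, hf2, hc']
      simp [torus]

/-- An orthonormal basis adapted to a skew-symmetric matrix and a pair of vectors. -/
theorem exists_adapted_basis {n m ε : ℕ} (hε : ε ≤ 1) (hn : n = 2 + (2 * m + ε))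
    {K : Matrix (Fin n) (Fin n) ℝ} (hK : Kᵀ = -K) {v x : EuclideanSpace ℝ (Fin n)}
    (hvx : LinearIndependent ℝ ![x, v]) :
    ∃ (b : OrthonormalBasis (Fin 2 ⊕ ((Fin 2 × Fin m) ⊕ Fin ε)) ℝ (EuclideanSpace ℝ (Fin n)))
      (α β γ : ℝ) (θ : Fin m → ℝ), α ≠ 0 ∧ β ≠ 0 ∧ x = α • b (Sum.inl 0) ∧
      v = γ • b (Sum.inl 0) + β • b (Sum.inl 1) ∧
      (∀ a, b (Sum.inl a) ∈ Submodule.span ℝ {x, v}) ∧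
      (∀ i, b (Sum.inr i) ∈ (Submodule.span ℝ {x, v})ᗮ) ∧
      ∀ i j, inner ℝ (b (Sum.inr i)) (toEuclideanLin K (b (Sum.inr j))) = torus ε θ i j := by
  set P := Submodule.span ℝ {x, v} with hP
  have hskew : ∀ y z, inner ℝ (toEuclideanLin K y) z = -inner ℝ y (toEuclideanLin K z) := by
    intro y z
    have h1 : toEuclideanLin Kᴴ = LinearMap.adjoint (toEuclideanLin K) :=
      toEuclideanLin_conjTranspose_eq_adjoint K
    have h2 : Kᴴ = -K := by rw [conjTranspose_eq_transpose_of_trivial, hK]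
    rw [← LinearMap.adjoint_inner_right, ← h1, h2]
    simp
  have hPd : finrank ℝ P = 2 := by
    have : P = Submodule.span ℝ (Set.range ![x, v]) := by simp [hP, Set.pair_comm]
    rw [this, finrank_span_eq_card hvx, Fintype.card_fin]
  have hFd : finrank ℝ Pᗮ = 2 * m + ε := by
    have h1 := P.finrank_add_finrank_orthogonal
    rw [finrank_euclideanSpace_fin] at h1
    omega
  -- The complement of the plane need not be stable under K, so the compression of K to it is
  -- normalized instead.
  let T : Pᗮ →ₗ[ℝ] Pᗮ := (Pᗮ.orthogonalProjectionOnto : _ →ₗ[ℝ] Pᗮ) ∘ₗ toEuclideanLin K ∘ₗ Pᗮ.subtype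
  have hTi : ∀ y z : Pᗮ, inner ℝ y (T z) = inner ℝ (y : EuclideanSpace ℝ (Fin n))
      (toEuclideanLin K z) := by
    intro y z
    simp [T]
  obtain ⟨c, θ, hc⟩ := skew_normal_form hε m T (fun y z => by
    rw [real_inner_comm, hTi, hTi, ← hskew, real_inner_comm]) hFd
  have hx0 : x ≠ 0 := hvx.ne_zero 0
  set b0 := ‖x‖⁻¹ • x with hb0
  have hx0' : ‖x‖ ≠ 0 := norm_ne_zero_iff.2 hx0
  have hb0n : ‖b0‖ = 1 := by rw [hb0, norm_smul, norm_inv, norm_norm, inv_mul_cancel₀ hx0']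
  have hxb : x = ‖x‖ • b0 := by rw [hb0, smul_smul, mul_inv_cancel₀ hx0', one_smul]
  set γ := inner ℝ b0 v
  set v' := v - γ • b0 with hv'
  have hv0 : v' ≠ 0 := by
    intro h
    rw [LinearIndependent.pair_iff] at hvx
    have := hvx (-(γ * ‖x‖⁻¹)) 1 (by
      rw [← h, hv', hb0, smul_smul, neg_smul, one_smul]; abel)
    exact one_ne_zero this.2
  have hv0' : ‖v'‖ ≠ 0 := norm_ne_zero_iff.2 hv0
  set b1 := ‖v'‖⁻¹ • v' with hb1
  have hb1n : ‖b1‖ = 1 := by rw [hb1, norm_smul, norm_inv, norm_norm, inv_mul_cancel₀ hv0']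
  have hb01 : inner ℝ b0 b1 = 0 := by
    rw [hb1, inner_smul_right, hv', inner_sub_right, inner_smul_right,
      real_inner_self_eq_norm_mul_norm, hb0n]
    simp [γ]
  have hvb : v = γ • b0 + ‖v'‖ • b1 := by
    rw [hb1, smul_smul ‖v'‖, mul_inv_cancel₀ hv0', one_smul, hv']
    abel
  have hxP : x ∈ P := Submodule.subset_span (by simp)
  have hvP : v ∈ P := Submodule.subset_span (by simp)
  have hb0P : b0 ∈ P := P.smul_mem _ hxP
  have hb1P : b1 ∈ P := P.smul_mem _ (P.sub_mem hvP (P.smul_mem _ hb0P))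
  have h0c : ∀ i, inner ℝ b0 (c i : EuclideanSpace ℝ (Fin n)) = 0 := fun i => (c i).2 _ hb0P
  have h1c : ∀ i, inner ℝ b1 (c i : EuclideanSpace ℝ (Fin n)) = 0 := fun i => (c i).2 _ hb1P
  have hc0 : ∀ i, inner ℝ (c i : EuclideanSpace ℝ (Fin n)) b0 = 0 := fun i => by
    rw [real_inner_comm, h0c]
  have hc1 : ∀ i, inner ℝ (c i : EuclideanSpace ℝ (Fin n)) b1 = 0 := fun i => by
    rw [real_inner_comm, h1c]
  have hf : Orthonormal ℝ (Sum.elim ![b0, b1] fun i => (c i : EuclideanSpace ℝ (Fin n))) := by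
    rw [orthonormal_iff_ite]
    rintro (a | i) (a' | j)
    · fin_cases a <;> fin_cases a' <;> simp [hb01, hb0n, hb1n, real_inner_comm]
    · fin_cases a <;> simp [h0c, h1c]
    · fin_cases a' <;> simp [hc0, hc1]
    · simpa using orthonormal_iff_ite.1 c.orthonormal i j
  obtain ⟨b, hb⟩ := exists_orthonormalBasis_coe_eq hf (by simp [hn])
  refine ⟨b, ‖x‖, ‖v'‖, γ, θ, hx0', hv0', ?_, ?_, ?_, ?_, ?_⟩
  · simpa [hb] using hxb
  · simpa [hb] using hvb
  · intro a
    fin_cases a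
    · simpa [hb] using hb0P
    · simpa [hb] using hb1P
  · intro i
    simp [hb]
  · intro i j
    rw [hb, hb, ← hc, hTi]
    rfl

/-- In the adapted basis P K P is 0 ⊕ L; the plane contributes X², and transposing turns det (X - L)
into det (X + L). -/
theorem charpoly_compress {n : ℕ} {κ : Type*} [Fintype κ] [DecidableEq κ]
    {K : Matrix (Fin n) (Fin n) ℝ} {v x : EuclideanSpace ℝ (Fin n)}
    (b : OrthonormalBasis (Fin 2 ⊕ κ) ℝ (EuclideanSpace ℝ (Fin n)))
    (hb0 : ∀ a, b (Sum.inl a) ∈ Submodule.span ℝ {x, v})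
    (hb1 : ∀ i, b (Sum.inr i) ∈ (Submodule.span ℝ {x, v})ᗮ) {L : Matrix κ κ ℝ} (hL : Lᵀ = -L)
    (h : ∀ i j, inner ℝ (b (Sum.inr i)) (toEuclideanLin K (b (Sum.inr j))) = L i j) :
    (compress K v x).charpoly = Polynomial.X ^ 2 *
      ((Polynomial.X : Polynomial ℝ) • (1 : Matrix κ κ (Polynomial ℝ)) +
        L.map Polynomial.C).det := by
  have hP0 : ∀ a, (Submodule.span ℝ {x, v})ᗮ.starProjection (b (Sum.inl a)) = 0 := fun a =>
    Submodule.starProjection_orthogonal_apply_eq_zero (hb0 a)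
  have hP1 : ∀ i, (Submodule.span ℝ {x, v})ᗮ.starProjection (b (Sum.inr i)) = b (Sum.inr i) :=
    fun i => Submodule.starProjection_eq_self_iff.2 (hb1 i)
  have hM : LinearMap.toMatrix b.toBasis b.toBasis (compress K v x) = fromBlocks 0 0 0 L := by
    ext i j
    rw [LinearMap.toMatrix_apply, OrthonormalBasis.coe_toBasis_repr_apply,
      OrthonormalBasis.repr_apply_apply, OrthonormalBasis.coe_toBasis]
    have h1 : inner ℝ (b i) (compress K v x (b j)) =
        inner ℝ ((Submodule.span ℝ {x, v})ᗮ.starProjection (b i)) (toEuclideanLin K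
          ((Submodule.span ℝ {x, v})ᗮ.starProjection (b j))) := by
      rw [Submodule.inner_starProjection_left_eq_right]
      rfl
    rw [h1]
    rcases i with i | i <;> rcases j with j | j <;> simp only [hP0, hP1]
    · simp
    · simp
    · simp
    · simpa using h i j
  rw [← LinearMap.charpoly_toMatrix _ b.toBasis, hM, charpoly_fromBlocks_zero₁₂]
  congr 1
  · simp [charpoly, charmatrix]
  · rw [← charpoly_transpose, hL, charpoly, charmatrix]
    congr 1
    ext i j
    simp [one_apply, scalar_apply, diagonal_apply]

end NormalForm

/-! ### Points of the dual with coordinates in an arbitrary commutative algebra. -/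

section Evaluation

variable {R : Type*} [CommRing R] [Algebra ℝ R] {n : ℕ}

/-- The linear functional on `gal n` with coordinates `K`, `W`, `t` in a commutative algebra. -/
def dualR (K : Matrix (Fin n) (Fin n) R) (W : Matrix (Fin n) (Fin 2) R) (t : R) :
    gal n →ₗ[ℝ] R where
  toFun B := ∑ i, ∑ j, (B : Mat n) (Sum.inl i) (Sum.inl j) • K i j +
    ∑ i, ∑ a, (B : Mat n) (Sum.inl i) (Sum.inr a) • W i a +
    (B : Mat n) (Sum.inr 0) (Sum.inr 1) • t
  map_add' B B' := by
    have h : ((B + B' : gal n) : Mat n) = (B : Mat n) + (B' : Mat n) := rfl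
    simp only [h, Matrix.add_apply, add_smul, Finset.sum_add_distrib]
    abel
  map_smul' c B := by
    simp [mul_smul, Finset.smul_sum, smul_add]

/-- The value of an element of `S(gal(n))` at the functional `dualR K W t`. -/
def evalR (K : Matrix (Fin n) (Fin n) R) (W : Matrix (Fin n) (Fin 2) R) (t : R) : S n →ₐ[ℝ] R :=
  SymmetricAlgebra.lift (dualR K W t)

theorem evalR_ι (K : Matrix (Fin n) (Fin n) R) (W : Matrix (Fin n) (Fin 2) R) (t : R)
    (B : gal n) : evalR K W t (SymmetricAlgebra.ι ℝ (gal n) B) = dualR K W t B :=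
  SymmetricAlgebra.lift_ι_apply _ _

/-- The trace pairing with `gal n` sees only the skew part of the upper left block and ignores the
places where `gal n` has zeros. Coadjoint translates leave the normal form `algMat`, and this
formula brings them back. -/
theorem dualOf_eq_dualR (N : Mat n) :
    dualOf N = dualR ((1 / 2 : ℝ) • (N.toBlocks₁₁ - N.toBlocks₁₁ᵀ)) N.toBlocks₁₂
      (N (Sum.inr 0) (Sum.inr 1)) := by
  ext ⟨B, K, W, t, hK, rfl⟩
  have hK' : ∀ i j, K j i = -K i j := fun i j => congrFun (congrFun hK i) j
  have h1 : ∑ i, ∑ j, K i j * ((1 / 2 : ℝ) * (N (Sum.inl i) (Sum.inl j) -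
      N (Sum.inl j) (Sum.inl i))) = ∑ i, ∑ j, K i j * N (Sum.inl i) (Sum.inl j) := by
    have h2 : ∑ i, ∑ j, K i j * N (Sum.inl j) (Sum.inl i) =
        -∑ i, ∑ j, K i j * N (Sum.inl i) (Sum.inl j) := by
      rw [Finset.sum_comm, ← Finset.sum_neg_distrib]
      refine Finset.sum_congr rfl fun i _ => ?_
      rw [← Finset.sum_neg_distrib]
      refine Finset.sum_congr rfl fun j _ => ?_
      rw [hK' i j]
      ring
    have h3 : ∀ i j, K i j * ((1 / 2 : ℝ) * (N (Sum.inl i) (Sum.inl j) -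
        N (Sum.inl j) (Sum.inl i))) = (1 / 2 : ℝ) * (K i j * N (Sum.inl i) (Sum.inl j)) -
        (1 / 2 : ℝ) * (K i j * N (Sum.inl j) (Sum.inl i)) := fun i j => by ring
    simp_rw [h3, Finset.sum_sub_distrib, ← Finset.mul_sum]
    rw [h2]
    ring
  simp only [dualOf, dualR, LinearMap.coe_mk, AddHom.coe_mk, trace, diag_apply, mul_apply,
    Fintype.sum_sum_type, algMat, fromBlocks_apply₁₁, fromBlocks_apply₁₂, fromBlocks_apply₂₁,
    fromBlocks_apply₂₂, transpose_apply, Matrix.smul_apply, Matrix.sub_apply, toBlocks₁₁,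
    toBlocks₁₂, of_apply, smul_eq_mul, h1]
  simp only [Fin.sum_univ_two, Finset.sum_add_distrib]
  simp
  rw [Finset.sum_comm]
  simp_rw [mul_comm]
  ring

theorem dualOf_algMat {K : Matrix (Fin n) (Fin n) ℝ} (hK : Kᵀ = -K) (W : Matrix (Fin n) (Fin 2) ℝ)
    (t : ℝ) : dualOf (algMat K W t) = dualR K W t := by
  rw [dualOf_eq_dualR]
  congr 1
  · ext i j
    have := congrFun (congrFun hK i) j
    simp [algMat] at this ⊢
    rw [this]
    ring

theorem evalAt_algMat {K : Matrix (Fin n) (Fin n) ℝ} (hK : Kᵀ = -K)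
    (W : Matrix (Fin n) (Fin 2) ℝ) (t : ℝ) : evalAt (algMat K W t) = evalR K W t := by
  rw [evalAt, evalR, dualOf_algMat hK]

/-- The pairing is nondegenerate since tr(AᵀA) = 0 forces A = 0; dimension count gives surjectivity.
-/
theorem exists_dualR_eq (φ : gal n →ₗ[ℝ] ℝ) :
    ∃ (K : Matrix (Fin n) (Fin n) ℝ) (W : Matrix (Fin n) (Fin 2) ℝ) (t : ℝ),
      Kᵀ = -K ∧ φ = dualR K W t := by
  let F : gal n →ₗ[ℝ] Module.Dual ℝ (gal n) :=
    { toFun := fun A => dualOf (A : Mat n)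
      map_add' := fun A A' => by ext; simp [dualOf, add_mul]
      map_smul' := fun c A => by ext; simp [dualOf] }
  have hF : Function.Injective F := by
    rw [← LinearMap.ker_eq_bot, LinearMap.ker_eq_bot']
    intro A hA
    have h1 : ((A : Mat n)ᵀ * (A : Mat n)).trace = 0 := LinearMap.congr_fun hA A
    have h2 : (A : Mat n) = 0 := by
      rw [← conjTranspose_eq_transpose_of_trivial] at h1
      exact trace_conjTranspose_mul_self_eq_zero_iff.1 h1
    exact Subtype.ext h2
  have hs : Function.Surjective F :=
    (LinearMap.injective_iff_surjective_of_finrank_eq_finrank Subspace.dual_finrank_eq.symm).1 hF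
  obtain ⟨⟨A, K, W, t, hK, rfl⟩, hA⟩ := hs φ
  exact ⟨K, W, t, hK, by rw [← hA, ← dualOf_algMat hK]; rfl⟩

/-- In a basis `S n` is a polynomial ring over an infinite field, so identities in it can be checked
at real points. -/
theorem eq_zero_of_evalR_eq_zero {f : S n}
    (h : ∀ (K : Matrix (Fin n) (Fin n) ℝ) (W : Matrix (Fin n) (Fin 2) ℝ) (t : ℝ),
      Kᵀ = -K → evalR K W t f = 0) : f = 0 := by
  let b := Module.finBasis ℝ (gal n)
  rw [← (SymmetricAlgebra.equivMvPolynomial b).map_eq_zero_iff]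
  refine MvPolynomial.funext fun x => ?_
  rw [map_zero]
  obtain ⟨K, W, t, hK, hφ⟩ := exists_dualR_eq (b.constr ℝ x)
  rw [← h K W t hK]
  have : (MvPolynomial.aeval x).comp (SymmetricAlgebra.equivMvPolynomial b : S n →ₐ[ℝ] _) =
      evalR K W t := by
    rw [evalR, ← hφ]
    refine SymmetricAlgebra.algHom_ext (b.ext fun i => ?_)
    simp
  rw [← this]
  simp [MvPolynomial.aeval_eq_eval]

theorem evalR_K {K' : Matrix (Fin n) (Fin n) R} (hK : K'ᵀ = -K') (W : Matrix (Fin n) (Fin 2) R)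
    (t : R) (i j : Fin n) : evalR K' W t (K i j) = K' i j := by
  have hji : K' j i = -K' i j := congrFun (congrFun hK i) j
  have h : ∀ k l : Fin n, ∑ p, ∑ q, ((single k l (1 : ℝ) : Matrix (Fin n) (Fin n) ℝ) p q) • K' p q
      = K' k l := by
    intro k l
    rw [Finset.sum_eq_single k, Finset.sum_eq_single l]
    · simp
    · intro q _ hq; simp [Ne.symm hq]
    · simp
    · intro p _ hp; simp [Ne.symm hp]
    · simp
  rw [K, evalR_ι]
  simp only [dualR, eltK, LinearMap.coe_mk, AddHom.coe_mk, algMat, fromBlocks_apply₁₁,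
    fromBlocks_apply₁₂, fromBlocks_apply₂₂, Matrix.smul_apply, Matrix.sub_apply, smul_assoc,
    sub_smul, Finset.sum_sub_distrib, ← Finset.smul_sum, h, hji]
  simp only [Matrix.zero_apply, zero_smul, Finset.sum_const_zero, add_zero, sub_neg_eq_add,
    ← two_smul ℝ (K' i j), smul_smul]
  simp

theorem evalR_eltC (K' : Matrix (Fin n) (Fin n) R) (W : Matrix (Fin n) (Fin 2) R)
    (t : R) (i : Fin n) (a : Fin 2) :
    evalR K' W t (SymmetricAlgebra.ι ℝ (gal n) (eltC i a)) = W i a := by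
  rw [evalR_ι]
  simp only [dualR, eltC, LinearMap.coe_mk, AddHom.coe_mk, algMat, fromBlocks_apply₁₁,
    fromBlocks_apply₁₂, fromBlocks_apply₂₂]
  rw [Finset.sum_eq_single (a := i) (f := fun i' => ∑ a', single i a (1 : ℝ) i' a' • W i' a'),
    Finset.sum_eq_single a]
  · simp
  · intro q _ hq; simp [Ne.symm hq]
  · simp
  · intro p _ hp; simp [Ne.symm hp]
  · simp

theorem evalR_V (K' : Matrix (Fin n) (Fin n) R) (W : Matrix (Fin n) (Fin 2) R)
    (t : R) (i : Fin n) : evalR K' W t (V i) = W i 0 := evalR_eltC _ _ _ _ _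

theorem evalR_X (K' : Matrix (Fin n) (Fin n) R) (W : Matrix (Fin n) (Fin 2) R)
    (t : R) (i : Fin n) : evalR K' W t (X i) = W i 1 := evalR_eltC _ _ _ _ _

theorem evalR_Q1 (K' : Matrix (Fin n) (Fin n) R) (W : Matrix (Fin n) (Fin 2) R)
    (t : R) : evalR K' W t (Q1 n) = (Wᵀ * W) 1 1 := by
  simp [Q1, evalR_X, mul_apply, sq]

theorem evalR_Q2 (K' : Matrix (Fin n) (Fin n) R) (W : Matrix (Fin n) (Fin 2) R)
    (t : R) : evalR K' W t (Q2 n) = (Wᵀ * W).det := by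
  simp only [Q2, map_sub, map_mul, map_pow, map_sum, evalR_X, evalR_V, det_fin_two, mul_apply,
    transpose_apply]
  have : ∑ i, W i 0 * W i 1 = ∑ i, W i 1 * W i 0 := by simp_rw [mul_comm]
  rw [this]
  simp_rw [sq]
  ring

theorem evalR_minorSum {K' : Matrix (Fin n) (Fin n) R} (hK : K'ᵀ = -K')
    (W : Matrix (Fin n) (Fin 2) R) (t : R) {m : ℕ} (hm : m ≤ n + 2) :
    evalR K' W t (minorSum n m) = (bordPoly K' W).coeff (n + 2 - m) := by
  have h := coeff_bordPoly K' W (m := m) (by simpa using hm)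
  rw [Fintype.card_fin] at h
  rw [h, minorSum, map_sum]
  refine Finset.sum_congr rfl fun s _ => ?_
  rw [AlgHom.map_det]
  congr 1
  ext i j
  rw [AlgHom.mapMatrix_apply, map_apply, submatrix_apply, submatrix_apply, skewMat]
  rcases (i : Fin n ⊕ Fin 2) with i | i <;> rcases (j : Fin n ⊕ Fin 2) with j | j
  · simp [evalR_K hK]
  · fin_cases j <;> simp [evalR_V, evalR_X]
  · fin_cases i <;> simp [evalR_V, evalR_X]
  · simp

theorem evalR_gen {K' : Matrix (Fin n) (Fin n) R} (hK : K'ᵀ = -K')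
    (W : Matrix (Fin n) (Fin 2) R) (t : R) (i : Fin (n / 2 + 1)) :
    evalR K' W t (gen n i) = if (i : ℕ) = 0 then (Wᵀ * W) 1 1 else if (i : ℕ) = 1 then
      (Wᵀ * W).det else (bordPoly K' W).coeff (n - 2 * i) := by
  rw [gen]
  split_ifs
  · exact evalR_Q1 _ _ _
  · exact evalR_Q2 _ _ _
  · have := i.2
    rw [evalR_minorSum hK _ _ (by omega)]
    congr 1
    omega

end Evaluation

/-! ### The coadjoint action of rotations, boosts with translations, and time shifts. -/

section Group

variable {n : ℕ}

theorem mem_invariantsS {f : S n} : f ∈ invariantsS n ↔ ∀ g, AdS n g f = f := by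
  simp [invariantsS, Algebra.mem_iInf, AlgHom.mem_equalizer]

theorem mem_invariantsU {u : U n} : u ∈ invariantsU n ↔ ∀ g, AdU n g u = u := by
  simp [invariantsU, Algebra.mem_iInf, AlgHom.mem_equalizer]

theorem AdS_ι (g : Gal n) (B : gal n) : AdS n g (SymmetricAlgebra.ι ℝ (gal n) B) =
    SymmetricAlgebra.ι ℝ (gal n) (Ad n g B) :=
  SymmetricAlgebra.lift_ι_apply _ _

theorem AdS_mul (g h : Gal n) : AdS n (g * h) = (AdS n g).comp (AdS n h) := by
  refine SymmetricAlgebra.algHom_ext (LinearMap.ext fun B => ?_)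
  change AdS n (g * h) (SymmetricAlgebra.ι ℝ (gal n) B) =
    AdS n g (AdS n h (SymmetricAlgebra.ι ℝ (gal n) B))
  rw [AdS_ι, AdS_ι, AdS_ι]
  congr 1
  ext1
  simp [Ad, Matrix.mul_assoc]

/-- The rotations in the Galilean group. -/
def rotation (ρ : Matrix (Fin n) (Fin n) ℝ) (hρ : ρᵀ * ρ = 1) : Gal n :=
  ⟨⟨grpMat ρ 0 0, grpMat ρᵀ 0 0,
    by simp [grpMat, fromBlocks_multiply, mul_eq_one_comm.1 hρ, ← one_fin_two],
    by simp [grpMat, fromBlocks_multiply, hρ, ← one_fin_two]⟩, ρ,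
    (mem_orthogonalGroup_iff' (Fin n) ℝ).2 hρ, 0, 0, rfl⟩

/-- The boosts and translations in space. -/
def boost (D : Matrix (Fin n) (Fin 2) ℝ) : Gal n :=
  ⟨⟨grpMat 1 D 0, grpMat 1 (-D) 0,
    by simp [grpMat, fromBlocks_multiply, ← one_fin_two],
    by simp [grpMat, fromBlocks_multiply, ← one_fin_two]⟩, 1, one_mem _, D, 0, rfl⟩

/-- The translations in time. -/
def timeShift (n : ℕ) (s : ℝ) : Gal n :=
  ⟨⟨grpMat 1 0 s, grpMat 1 0 (-s),
    by simp [grpMat, fromBlocks_multiply, ← one_fin_two],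
    by simp [grpMat, fromBlocks_multiply, ← one_fin_two]⟩, 1, one_mem _, 0, s, rfl⟩

theorem exists_eq_mul (g : Gal n) : ∃ D s ρ hρ, g = boost D * timeShift n s * rotation ρ hρ := by
  obtain ⟨g, ρ, hρ, W, t, hg⟩ := g
  have h : ρᵀ * ρ = 1 := by
    simpa [star_eq_conjTranspose] using (mem_orthogonalGroup_iff' (Fin n) ℝ).1 hρ
  refine ⟨W * !![1, -t; 0, 1], t, ρ, h, ?_⟩
  ext1
  ext1
  simp only [hg, boost, timeShift, rotation]
  simp [grpMat, fromBlocks_multiply, Matrix.mul_assoc, ← one_fin_two]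

theorem mem_invariantsS_iff {f : S n} : f ∈ invariantsS n ↔ (∀ D, AdS n (boost D) f = f) ∧
    (∀ s, AdS n (timeShift n s) f = f) ∧ ∀ ρ hρ, AdS n (rotation ρ hρ) f = f := by
  rw [mem_invariantsS]
  refine ⟨fun h => ⟨fun _ => h _, fun _ => h _, fun _ _ => h _⟩, fun ⟨h1, h2, h3⟩ g => ?_⟩
  obtain ⟨D, s, ρ, hρ, rfl⟩ := exists_eq_mul g
  simp only [AdS_mul, AlgHom.comp_apply, h1, h2, h3]

theorem dualOf_Ad (A : Mat n) (g : Gal n) :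
    dualOf A ∘ₗ (Ad n g : gal n →ₗ[ℝ] gal n) =
      dualOf (((g : (Mat n)ˣ) : Mat n)ᵀ * A * (((g : (Mat n)ˣ)⁻¹ : (Mat n)ˣ) : Mat n)ᵀ) := by
  ext B
  simp only [dualOf, Ad, LinearMap.comp_apply, LinearMap.coe_mk, AddHom.coe_mk,
    transpose_mul, transpose_transpose]
  rw [← Matrix.mul_assoc, trace_mul_comm]
  simp only [Matrix.mul_assoc]

theorem evalR_AdS {K' K'' : Matrix (Fin n) (Fin n) ℝ} {W' W'' : Matrix (Fin n) (Fin 2) ℝ}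
    {t' t'' : ℝ} {g : Gal n} (h : dualR K' W' t' ∘ₗ (Ad n g : gal n →ₗ[ℝ] gal n) =
      dualR K'' W'' t'') (f : S n) : evalR K' W' t' (AdS n g f) = evalR K'' W'' t'' f := by
  rw [← AlgHom.comp_apply]
  congr 1
  refine SymmetricAlgebra.algHom_ext ?_
  refine LinearMap.ext fun B => ?_
  change evalR K' W' t' (AdS n g (SymmetricAlgebra.ι ℝ (gal n) B)) =
    evalR K'' W'' t'' (SymmetricAlgebra.ι ℝ (gal n) B)
  rw [AdS_ι, evalR_ι, evalR_ι, ← h]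
  rfl

theorem evalR_rotation {K' : Matrix (Fin n) (Fin n) ℝ} (hK : K'ᵀ = -K')
    (W : Matrix (Fin n) (Fin 2) ℝ) (t : ℝ) {ρ : Matrix (Fin n) (Fin n) ℝ} (hρ : ρᵀ * ρ = 1)
    (f : S n) : evalR K' W t (AdS n (rotation ρ hρ) f) = evalR (ρᵀ * K' * ρ) (ρᵀ * W) t f := by
  refine evalR_AdS ?_ f
  have h2 : (ρᵀ * K' * ρ)ᵀ = -(ρᵀ * K' * ρ) := by
    simp [transpose_mul, hK, Matrix.mul_assoc]
  rw [← dualOf_algMat hK, dualOf_Ad, ← dualOf_algMat h2]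
  congr 1
  simp [rotation, grpMat, algMat, fromBlocks_transpose, fromBlocks_multiply, ← one_fin_two]

theorem evalR_timeShift {K' : Matrix (Fin n) (Fin n) ℝ} (hK : K'ᵀ = -K')
    (W : Matrix (Fin n) (Fin 2) ℝ) (t s : ℝ) (f : S n) :
    evalR K' W t (AdS n (timeShift n s) f) = evalR K' (W * !![1, 0; -s, 1]) t f := by
  refine evalR_AdS ?_ f
  rw [← dualOf_algMat hK, dualOf_Ad, dualOf_eq_dualR, ← dualOf_algMat hK, dualOf_eq_dualR]
  congr 1
  · simp [timeShift, grpMat, algMat, fromBlocks_transpose, fromBlocks_multiply]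
  · simp only [timeShift, grpMat, algMat, fromBlocks_transpose, fromBlocks_multiply,
      Units.inv_mk, toBlocks_fromBlocks₁₂]
    ext i j
    fin_cases j <;> simp [mul_apply]
  · simp [timeShift, grpMat, algMat, fromBlocks_transpose, fromBlocks_multiply, mul_apply]

/-- The factor 1/2 is the skew-symmetrization of the upper left block. The action moves K by skew
products with W, and x₀ by a pairing with x, so it can clear those parts of a point. -/
theorem evalR_boost {K' : Matrix (Fin n) (Fin n) ℝ} (hK : K'ᵀ = -K')
    (W D : Matrix (Fin n) (Fin 2) ℝ) (t : ℝ) (f : S n) :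
    evalR K' W t (AdS n (boost D) f) =
      evalR (K' - (1 / 2 : ℝ) • (W * Dᵀ - D * Wᵀ)) W (t + ∑ i, D i 0 * W i 1) f := by
  refine evalR_AdS ?_ f
  rw [← dualOf_algMat hK, dualOf_Ad, dualOf_eq_dualR]
  congr 1
  · simp only [boost, grpMat, algMat, fromBlocks_transpose, fromBlocks_multiply,
      Units.inv_mk, toBlocks_fromBlocks₁₁]
    simp [transpose_mul, hK]
    rw [← sub_eq_zero]
    module
  · simp [boost, grpMat, algMat, fromBlocks_transpose, fromBlocks_multiply, ← one_fin_two]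
  · simp [boost, grpMat, algMat, fromBlocks_transpose, fromBlocks_multiply, ← one_fin_two,
      mul_apply]
    ring

theorem gen_mem_invariantsS (i : Fin (n / 2 + 1)) : gen n i ∈ invariantsS n := by
  rw [mem_invariantsS_iff]
  refine ⟨fun D => ?_, fun s => ?_, fun ρ hρ => ?_⟩ <;> rw [← sub_eq_zero] <;>
    refine eq_zero_of_evalR_eq_zero fun K' W t hK => ?_ <;> rw [map_sub, sub_eq_zero]
  · rw [evalR_boost hK, evalR_gen hK, evalR_gen]
    · have h : K' - (1 / 2 : ℝ) • (W * Dᵀ - D * Wᵀ) =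
          K' + (W * (-(1 / 2 : ℝ) • D)ᵀ - (-(1 / 2 : ℝ) • D) * Wᵀ) := by
        simp [smul_sub]
        abel
      rw [h, bordPoly_add]
    · simp only [transpose_sub, transpose_smul, transpose_mul, transpose_transpose, hK]
      module
  · have hT : (!![1, 0; -s, 1] : Matrix (Fin 2) (Fin 2) ℝ).det = 1 := by simp [det_fin_two]
    rw [evalR_timeShift hK, evalR_gen hK, evalR_gen hK, bordPoly_mul_right hT]
    have h : (W * !![1, 0; -s, 1])ᵀ * (W * !![1, 0; -s, 1]) =
        !![1, 0; -s, 1]ᵀ * (Wᵀ * W) * !![1, 0; -s, 1] := by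
      simp only [transpose_mul, Matrix.mul_assoc]
    rw [h]
    congr 1
    · simp [mul_apply]
    · rw [det_mul, det_mul, det_transpose, hT]
      simp
  · have h : (ρᵀ * W)ᵀ * (ρᵀ * W) = Wᵀ * W := by
      rw [transpose_mul, transpose_transpose, Matrix.mul_assoc, ← Matrix.mul_assoc ρ,
        mul_eq_one_comm.1 hρ, Matrix.one_mul]
    rw [evalR_rotation hK, evalR_gen hK, evalR_gen, bordPoly_conj hρ, h]
    simp [transpose_mul, hK, Matrix.mul_assoc]

end Group

/-! ### The slice and the reduction of generic points to it. -/

section Slice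

set_option linter.unusedSectionVars false

variable {R : Type*} [CommRing R] [Algebra ℝ R] {n : ℕ} {ι : Type*} [Fintype ι] [DecidableEq ι]

theorem submatrix_transpose_eq_neg (e : Fin n ≃ ι) {K' : Matrix ι ι R} (hK : K'ᵀ = -K') :
    (K'.submatrix e e)ᵀ = -K'.submatrix e e := by
  rw [transpose_submatrix, hK]
  rfl

theorem map_evalR {R' : Type*} [CommRing R'] [Algebra ℝ R'] (φ : R →ₐ[ℝ] R')
    (K' : Matrix (Fin n) (Fin n) R) (W : Matrix (Fin n) (Fin 2) R) (t : R) (f : S n) :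
    φ (evalR K' W t f) = evalR (K'.map φ) (W.map φ) (φ t) f := by
  rw [← AlgHom.comp_apply]
  congr 1
  refine SymmetricAlgebra.algHom_ext (LinearMap.ext fun B => ?_)
  change φ (evalR K' W t (SymmetricAlgebra.ι ℝ (gal n) B)) =
    evalR _ _ _ (SymmetricAlgebra.ι ℝ (gal n) B)
  rw [evalR_ι, evalR_ι]
  simp [dualR]

theorem evalR_submatrix_rotation {f : S n} (hf : f ∈ invariantsS n) (e : Fin n ≃ ι)
    {K' : Matrix ι ι ℝ} (hK : K'ᵀ = -K') (W : Matrix ι (Fin 2) ℝ) (t : ℝ)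
    {ρ : Matrix ι ι ℝ} (hρ : ρᵀ * ρ = 1) :
    evalR ((ρᵀ * K' * ρ).submatrix e e) ((ρᵀ * W).submatrix e id) t f =
      evalR (K'.submatrix e e) (W.submatrix e id) t f := by
  have h1 : (ρ.submatrix e e)ᵀ * ρ.submatrix e e = 1 := by
    rw [transpose_submatrix, submatrix_mul_equiv, hρ, submatrix_one_equiv]
  have h2 := evalR_rotation (submatrix_transpose_eq_neg e hK) (W.submatrix e id) t h1 f
  rw [mem_invariantsS.1 hf, transpose_submatrix, submatrix_mul_equiv, submatrix_mul_equiv,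
    submatrix_mul_equiv] at h2
  exact h2.symm

variable {m ε : ℕ}

/-- The skew-symmetric part of a point of the slice. -/
def sliceK (ε : ℕ) (θ : Fin m → R) : Matrix (Fin 2 ⊕ ((Fin 2 × Fin m) ⊕ Fin ε))
    (Fin 2 ⊕ ((Fin 2 × Fin m) ⊕ Fin ε)) R :=
  fromBlocks 0 0 0 (torus ε θ)

theorem sliceK_transpose (ε : ℕ) (θ : Fin m → R) : (sliceK ε θ)ᵀ = -sliceK ε θ := by
  simp [sliceK, fromBlocks_transpose, torus_transpose, fromBlocks_neg]

/-- The values of the generators on the slice. -/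
def sliceValue (a b : R) (θ : Fin m → R) (i : ℕ) : R :=
  if i = 0 then a ^ 2 else (a * b) ^ 2 * esum (fun j => θ j ^ 2) (i - 1)

theorem coeff_X_sq_mul (hn : n = 2 + (2 * m + ε)) {i : ℕ} (hi0 : 1 ≤ i) (hi : i ≤ n / 2)
    (hε : ε ≤ 1) (c : R) (θ : Fin m → R) :
    (Polynomial.C c * ((Polynomial.X : Polynomial R) • (1 : Matrix _ _ (Polynomial R)) +
      (torus ε θ).map Polynomial.C).det).coeff (n - 2 * i) =
      c * esum (fun j => θ j ^ 2) (i - 1) := by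
  rw [Polynomial.coeff_C_mul, ← coeff_det_torus ε θ (j := i - 1) (by omega)]
  congr 2
  omega

/-- The blocks `L₁`, `L₂`, `L₃` do not enter the values, and a general `A` is allowed so that the
complex point with Q₁ = 0 is covered as well. -/
theorem evalR_gen_fromBlocks (hn : n = 2 + (2 * m + ε)) (hε : ε ≤ 1)
    (e : Fin n ≃ Fin 2 ⊕ ((Fin 2 × Fin m) ⊕ Fin ε))
    (L₁ : Matrix (Fin 2) (Fin 2) R) (L₂ : Matrix (Fin 2) _ R) (L₃ : Matrix _ (Fin 2) R)
    (A : Matrix (Fin 2) (Fin 2) R) (θ : Fin m → R) (t : R)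
    (hL : (fromBlocks L₁ L₂ L₃ (torus ε θ))ᵀ = -fromBlocks L₁ L₂ L₃ (torus ε θ))
    (i : Fin (n / 2 + 1)) :
    evalR ((fromBlocks L₁ L₂ L₃ (torus ε θ)).submatrix e e) ((fromRows A 0).submatrix e id) t
      (gen n i) = if (i : ℕ) = 0 then (Aᵀ * A) 1 1 else
        A.det ^ 2 * esum (fun j => θ j ^ 2) (i - 1) := by
  have h : ((fromRows A (0 : Matrix ((Fin 2 × Fin m) ⊕ Fin ε) (Fin 2) R)).submatrix e id)ᵀ *
      (fromRows A (0 : Matrix ((Fin 2 × Fin m) ⊕ Fin ε) (Fin 2) R)).submatrix e id = Aᵀ * A := by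
    rw [transpose_submatrix, submatrix_mul_equiv, transpose_fromRows, fromCols_mul_fromRows]
    simp
  rw [evalR_gen (submatrix_transpose_eq_neg e hL), h, bordPoly_submatrix, bordPoly_fromRows]
  have hi := i.2
  split_ifs with h0 h1
  · rfl
  · rw [h1, det_mul, det_transpose, esum_zero, sq, mul_one]
  · exact coeff_X_sq_mul hn (by omega) (by omega) hε _ _

theorem evalR_gen_slice (hn : n = 2 + (2 * m + ε)) (hε : ε ≤ 1)
    (e : Fin n ≃ Fin 2 ⊕ ((Fin 2 × Fin m) ⊕ Fin ε)) (a b : R) (θ : Fin m → R) (t : R)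
    (i : Fin (n / 2 + 1)) :
    evalR ((sliceK ε θ).submatrix e e) ((fromRows !![0, a; b, 0] 0).submatrix e id) t
      (gen n i) = sliceValue a b θ i := by
  rw [sliceK, evalR_gen_fromBlocks hn hε e _ _ _ _ _ _ (sliceK_transpose ε θ), sliceValue]
  congr 1
  · simp [sq, mul_apply]
  · rw [det_fin_two]
    simp

/-- The simultaneous normal form of a skew-symmetric matrix and two independent vectors. -/
theorem exists_rotation_normal_form (hε : ε ≤ 1) (hn : n = 2 + (2 * m + ε))
    (e : Fin n ≃ Fin 2 ⊕ ((Fin 2 × Fin m) ⊕ Fin ε))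
    {K' : Matrix (Fin n) (Fin n) ℝ} (hK : K'ᵀ = -K') {v x : EuclideanSpace ℝ (Fin n)}
    (hvx : LinearIndependent ℝ ![x, v]) :
    ∃ (ρ : Matrix (Fin n) (Fin n) ℝ) (α β γ : ℝ) (θ : Fin m → ℝ)
      (L₁ : Matrix (Fin 2) (Fin 2) ℝ) (L₂ : Matrix (Fin 2) _ ℝ) (L₃ : Matrix _ (Fin 2) ℝ),
      ρᵀ * ρ = 1 ∧ α ≠ 0 ∧ β ≠ 0 ∧
      ρᵀ * K' * ρ = (fromBlocks L₁ L₂ L₃ (torus ε θ)).submatrix e e ∧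
      ρᵀ * (of fun i => ![v i, x i]) = (fromRows !![γ, α; β, 0] 0).submatrix e id ∧
      (compress K' v x).charpoly = Polynomial.X ^ 2 *
        ((Polynomial.X : Polynomial ℝ) • (1 : Matrix _ _ (Polynomial ℝ)) +
          (torus ε θ).map Polynomial.C).det := by
  obtain ⟨b, α, β, γ, θ, hα, hβ, hx, hv, hb0, hb1, hT⟩ := exists_adapted_basis hε hn hK hvx
  have hbb : ∀ i j, inner ℝ (b i) (b j) = if i = j then 1 else 0 :=
    fun i j => orthonormal_iff_ite.1 b.orthonormal i j
  have hin : ∀ y z : EuclideanSpace ℝ (Fin n), inner ℝ y z = ∑ i, y i * z i := by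
    intro y z
    simp [PiLp.inner_apply, mul_comm]
  let L : Matrix (Fin 2 ⊕ ((Fin 2 × Fin m) ⊕ Fin ε)) (Fin 2 ⊕ ((Fin 2 × Fin m) ⊕ Fin ε)) ℝ :=
    of fun i j => inner ℝ (b i) (toEuclideanLin K' (b j))
  have hL22 : L.toBlocks₂₂ = torus ε θ := by
    ext i j
    exact hT i j
  refine ⟨of fun i j => b (e j) i, α, β, γ, θ, L.toBlocks₁₁, L.toBlocks₁₂, L.toBlocks₂₁,
    ?_, hα, hβ, ?_, ?_, charpoly_compress b hb0 hb1 (torus_transpose ε θ) hT⟩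
  · ext i j
    simp only [mul_apply, transpose_apply, of_apply, ← hin, hbb, one_apply]
    simp
  · rw [← hL22, fromBlocks_toBlocks]
    ext i j
    rw [submatrix_apply]
    simp only [L, of_apply, hin]
    rw [Matrix.mul_assoc]
    rfl
  · ext i a
    have h1 : ∀ y : EuclideanSpace ℝ (Fin n), ((of fun i j => b (e j) i : Matrix (Fin n) (Fin n) ℝ)ᵀ
        *ᵥ y.ofLp) i = inner ℝ (b (e i)) y := fun y => (hin _ _).symm
    have h2 : ((of fun i j => b (e j) i : Matrix (Fin n) (Fin n) ℝ)ᵀ *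
        (of fun i => ![v i, x i])) i a = inner ℝ (b (e i)) (![v, x] a) := by
      rw [← h1]
      fin_cases a <;> rfl
    rw [h2, submatrix_apply]
    generalize e i = j
    rcases j with j | j
    · fin_cases a <;> fin_cases j <;> simp [hx, hv, inner_add_right, inner_smul_right, hbb]
    · fin_cases a <;> simp [hx, hv, inner_add_right, inner_smul_right, hbb]

theorem linearIndependent_of_det_ne_zero {v x : EuclideanSpace ℝ (Fin n)}
    (h : ((of fun i => ![v i, x i] : Matrix (Fin n) (Fin 2) ℝ)ᵀ * of fun i => ![v i, x i]).det ≠ 0) :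
    LinearIndependent ℝ ![x, v] := by
  rw [LinearIndependent.pair_iff]
  intro a b hab
  have h1 : (of fun i => ![v i, x i] : Matrix (Fin n) (Fin 2) ℝ) *ᵥ ![b, a] = 0 := by
    ext i
    have := congrArg (fun y : EuclideanSpace ℝ (Fin n) => y i) hab
    simp at this
    simp [mulVec, dotProduct]
    linarith
  have h2 := eq_zero_of_mulVec_eq_zero h (v := ![b, a]) (by
    rw [← mulVec_mulVec, h1, mulVec_zero])
  exact ⟨congrFun h2 1, congrFun h2 0⟩

theorem bordPoly_eq_zero_of_dependent (K' : Matrix (Fin n) (Fin n) ℝ)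
    {v x : EuclideanSpace ℝ (Fin n)} (h : ¬LinearIndependent ℝ ![x, v]) :
    bordPoly K' (of fun i => ![v i, x i]) = 0 := by
  rw [LinearIndependent.pair_iff] at h
  push Not at h
  obtain ⟨a, b, hab, hne⟩ := h
  rw [bordPoly, ← exists_mulVec_eq_zero_iff]
  -- The relation a x + b v = 0 is a kernel vector supported on the border; the coefficients appear
  -- reversed because the columns are ordered v, x.
  refine ⟨Sum.elim 0 ![Polynomial.C b, Polynomial.C a], fun h0 => ?_, ?_⟩
  · have h1 := congrFun h0 (Sum.inr 0)
    have h2 := congrFun h0 (Sum.inr 1)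
    simp at h1 h2
    exact hne h2 h1
  · ext1 i
    rw [fromBlocks_mulVec]
    rcases i with i | i
    · have := congrArg (fun y : EuclideanSpace ℝ (Fin n) => y i) hab
      simp at this
      have h3 : v i * b + x i * a = 0 := by linarith
      simp only [mulVec, dotProduct, Sum.elim_comp_inl, Sum.elim_comp_inr, Pi.zero_apply,
        mul_zero, Finset.sum_const_zero, zero_add, Fin.sum_univ_two, Matrix.map_apply, of_apply,
        Sum.elim_inl, Pi.add_apply, cons_val_zero, cons_val_one]
      rw [← map_mul, ← map_mul, ← map_add, h3, map_zero]
    · simp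

/-- For independent x and v both sides are read off in the adapted basis; for dependent ones the
bordered determinant and the Gram determinant both vanish. -/
theorem evalAt_minorSum (hε : ε ≤ 1) (hn : n = 2 + (2 * m + ε))
    {K' : Matrix (Fin n) (Fin n) ℝ} (hK : K'ᵀ = -K') (v x : EuclideanSpace ℝ (Fin n)) (t : ℝ)
    {k : ℕ} (hkn : 2 * k ≤ n + 2) :
    evalAt (algMat K' (of fun i => ![v i, x i]) t) (minorSum n (2 * k)) =
      evalAt (algMat K' (of fun i => ![v i, x i]) t) (Q2 n) *
        (compress K' v x).charpoly.coeff (n + 4 - 2 * k) := by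
  rw [evalAt_algMat hK, evalR_minorSum hK _ _ hkn, evalR_Q2]
  by_cases hvx : LinearIndependent ℝ ![x, v]
  · let e : Fin n ≃ Fin 2 ⊕ ((Fin 2 × Fin m) ⊕ Fin ε) := Fintype.equivOfCardEq (by simp [hn])
    obtain ⟨ρ, α, β, γ, θ, L₁, L₂, L₃, hρ, -, -, h1, h2, h3⟩ :=
      exists_rotation_normal_form hε hn e hK hvx
    have h4 : (of fun i => ![v i, x i] : Matrix (Fin n) (Fin 2) ℝ)ᵀ * (of fun i => ![v i, x i]) =
        (!![γ, α; β, 0] : Matrix (Fin 2) (Fin 2) ℝ)ᵀ * !![γ, α; β, 0] := by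
      have h5 : (of fun i => ![v i, x i] : Matrix (Fin n) (Fin 2) ℝ)ᵀ *
          (of fun i => ![v i, x i]) = (ρᵀ * of fun i => ![v i, x i])ᵀ *
            (ρᵀ * of fun i => ![v i, x i]) := by
        rw [transpose_mul, transpose_transpose, Matrix.mul_assoc, ← Matrix.mul_assoc ρ,
          mul_eq_one_comm.1 hρ, Matrix.one_mul]
      rw [h5, h2, transpose_submatrix, submatrix_mul_equiv, transpose_fromRows,
        fromCols_mul_fromRows]
      simp
    rw [h4, h3, ← bordPoly_conj hρ, h1, h2, bordPoly_submatrix, bordPoly_fromRows, det_mul,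
      det_transpose, ← sq, Polynomial.coeff_C_mul]
    congr 1
    -- The shift by 2 is the factor X² contributed by the plane of x and v, on which P K P is zero.
    have : n + 4 - 2 * k = (n + 2 - 2 * k) + 2 := by omega
    rw [this, mul_comm (Polynomial.X ^ 2), Polynomial.coeff_mul_X_pow]
  · rw [bordPoly_eq_zero_of_dependent K' hvx]
    have h5 := mt linearIndependent_of_det_ne_zero hvx
    push Not at h5
    rw [h5]
    simp

/-- An element that is invariant under rotations, boosts and shifts up to a nonzero factor and
vanishes on the slice is zero. -/
theorem eq_zero_of_slice {f : S n} (hf : ∀ g, AdS n g f = f ∨ AdS n g f = -f) (hε : ε ≤ 1)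
    (hn : n = 2 + (2 * m + ε)) (e : Fin n ≃ Fin 2 ⊕ ((Fin 2 × Fin m) ⊕ Fin ε))
    (h0 : ∀ (α β : ℝ) (θ : Fin m → ℝ), evalR ((sliceK ε θ).submatrix e e)
      ((fromRows !![0, α; β, 0] 0).submatrix e id) 0 f = 0) : f = 0 := by
  have hev : ∀ {K' W t g}, evalR K' W t (AdS n g f) = (0 : ℝ) → evalR K' W t f = 0 := by
    intro K' W t g h
    rcases hf g with h1 | h1 <;> rw [h1] at h
    · exact h
    · simpa using h
  -- Multiplying by Q₂ disposes of the points with dependent x and v, which the normal form does not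
  -- reach; Q₂ is cancelled at the end since `S n` is a domain.
  have hQ : Q2 n * f = 0 := by
    refine eq_zero_of_evalR_eq_zero fun K' W t hK => ?_
    rw [map_mul, evalR_Q2]
    by_cases hW : (Wᵀ * W).det = 0
    · rw [hW, zero_mul]
    suffices evalR K' W t f = 0 by rw [this, mul_zero]
    have hWe : W = of fun i => ![(WithLp.toLp 2 fun i => W i 0 : EuclideanSpace ℝ (Fin n)) i,
        (WithLp.toLp 2 fun i => W i 1 : EuclideanSpace ℝ (Fin n)) i] := by
      ext i a
      fin_cases a <;> rfl
    rw [hWe] at hW ⊢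
    obtain ⟨ρ, α, β, γ, θ, L₁, L₂, L₃, hρ, hα, hβ, h1, h2, -⟩ :=
      exists_rotation_normal_form hε hn e hK (linearIndependent_of_det_ne_zero hW)
    apply hev (g := rotation ρ hρ)
    have hK2 : (ρᵀ * K' * ρ)ᵀ = -(ρᵀ * K' * ρ) := by
      simp [transpose_mul, hK, Matrix.mul_assoc]
    rw [evalR_rotation hK, h2]
    rw [h1] at hK2 ⊢
    -- This shift subtracts γ/α times x from v and makes v orthogonal to x.
    apply hev (g := timeShift n (γ / α))
    rw [evalR_timeShift hK2]
    have hW2 : ((fromRows !![γ, α; β, 0] 0 : Matrix (Fin 2 ⊕ ((Fin 2 × Fin m) ⊕ Fin ε)) _ ℝ).submatrix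
        e id) * !![1, 0; -(γ / α), 1] = (fromRows !![0, α; β, 0] 0).submatrix e id := by
      ext i a
      rw [mul_apply]
      simp only [submatrix_apply]
      generalize e i = j
      rcases j with j | j
      · fin_cases a <;> fin_cases j <;> simp
        field_simp
        ring
      · fin_cases a <;> simp
    rw [hW2]
    -- The entry `a` solves t + aα = 0 and clears x₀. The other entries of `D` are solved from K = ½
    -- (W Dᵀ - D Wᵀ) in the two rows that meet W; both α and β must be nonzero for this.
    set a := -t / α
    let D : Matrix (Fin 2 ⊕ ((Fin 2 × Fin m) ⊕ Fin ε)) (Fin 2) ℝ :=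
      fromRows !![a, 0; 0, (2 * L₁ 0 1 + β * a) / α]
        (of fun k => ![2 * L₂ 1 k / β, 2 * L₂ 0 k / α])
    apply hev (g := boost (D.submatrix e id))
    rw [evalR_boost hK2]
    have hsk : ∀ i j, fromBlocks L₁ L₂ L₃ (torus ε θ) j i = -fromBlocks L₁ L₂ L₃ (torus ε θ) i j := by
      intro i j
      simpa using congrFun (congrFun hK2 (e.symm i)) (e.symm j)
    have e1 : (fromBlocks L₁ L₂ L₃ (torus ε θ)).submatrix e e - (1 / 2 : ℝ) •
        ((fromRows !![0, α; β, 0] 0).submatrix e id * (D.submatrix e id)ᵀ -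
          D.submatrix e id * ((fromRows !![0, α; β, 0] 0).submatrix e id)ᵀ) =
        (sliceK ε θ).submatrix e e := by
      ext i j
      simp only [Matrix.sub_apply, Matrix.smul_apply, mul_apply, transpose_apply, submatrix_apply,
        Fin.sum_univ_two]
      generalize e i = i'
      generalize e j = j'
      have hs := hsk i' j'
      rcases i' with i' | i' <;> rcases j' with j' | j'
      · fin_cases i' <;> fin_cases j' <;> simp [D, sliceK] at hs ⊢
        · linarith
        · field_simp
          ring
        · field_simp
          linarith
        · linarith
      · fin_cases i' <;> simp [D, sliceK]
        · field_simp
          ring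
        · field_simp
          ring
      · fin_cases j' <;> simp [D, sliceK] at hs ⊢
        · field_simp
          linarith
        · field_simp
          linarith
      · simp [D, sliceK]
    have e2 : t + ∑ i, (D.submatrix e id) i 0 * ((fromRows !![0, α; β, 0] 0 :
        Matrix (Fin 2 ⊕ ((Fin 2 × Fin m) ⊕ Fin ε)) _ ℝ).submatrix e id) i 1 = 0 := by
      simp only [submatrix_apply, id]
      rw [Equiv.sum_comp e (fun i => D i 0 * (fromRows !![0, α; β, 0] 0 :
        Matrix (Fin 2 ⊕ ((Fin 2 × Fin m) ⊕ Fin ε)) _ ℝ) i 1)]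
      simp [D, a]
      field_simp
      ring
    rw [e1, e2]
    exact h0 α β θ
  have hQ2 : Q2 n ≠ 0 := by
    intro h
    have h1 := evalR_Q2 (0 : Matrix (Fin n) (Fin n) ℝ) ((fromRows !![0, 1; 1, 0] 0 :
        Matrix (Fin 2 ⊕ ((Fin 2 × Fin m) ⊕ Fin ε)) _ ℝ).submatrix e id) 0
    rw [h, map_zero, transpose_submatrix, submatrix_mul_equiv, transpose_fromRows,
        fromCols_mul_fromRows] at h1
    simp at h1
  exact (mul_eq_zero.1 hQ).resolve_left hQ2

end Slice

/-! ### Symmetric polynomials, algebraic independence and division by a generator. -/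

section Polynomials

open MvPolynomial (aeval)

theorem map_esum {R R' F : Type*} [CommRing R] [CommRing R'] [FunLike F R R'] [RingHomClass F R R']
    (φ : F) {m : ℕ} (c : Fin m → R) (j : ℕ) : φ (esum c j) = esum (fun i => φ (c i)) j := by
  simp [esum]

theorem map_sliceValue {R R' F : Type*} [CommRing R] [CommRing R'] [FunLike F R R']
    [RingHomClass F R R'] (φ : F) {m : ℕ} (a b : R) (θ : Fin m → R) (i : ℕ) :
    φ (sliceValue a b θ i) = sliceValue (φ a) (φ b) (fun j => φ (θ j)) i := by
  rw [sliceValue, sliceValue]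
  split_ifs <;> simp [map_esum]

theorem exists_eq_prod_X_add_C {k : Type*} [Field k] [IsAlgClosed k] {p : Polynomial k}
    (hp : p.Monic) {m : ℕ} (hm : p.natDegree = m) :
    ∃ c : Fin m → k, p = ∏ i, (Polynomial.X + Polynomial.C (c i)) := by
  have h1 := (IsAlgClosed.splits p).eq_prod_roots_of_monic hp
  have h2 : p.roots.toList.length = m := by
    rw [Multiset.length_toList, ← hm]
    exact (IsAlgClosed.splits p).natDegree_eq_card_roots.symm
  subst h2
  refine ⟨fun i => -p.roots.toList.get i, ?_⟩
  conv_lhs => rw [h1, ← Multiset.coe_toList p.roots]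
  rw [Multiset.map_coe, Multiset.prod_coe, ← List.prod_ofFn]
  congr 1
  refine List.ext_get (by simp) fun i h h' => ?_
  simp [sub_eq_add_neg]

theorem exists_esum_eq {k : Type*} [Field k] [IsAlgClosed k] (m : ℕ) (s : ℕ → k) (hs : s 0 = 1) :
    ∃ c : Fin m → k, ∀ j ≤ m, esum c j = s j := by
  -- The sought values are the negated roots of the monic polynomial X^m + s₁ X^(m-1) + ⋯ + s_m.
  set q : Polynomial k := ∑ j ∈ Finset.range m, Polynomial.C (s (m - j)) * Polynomial.X ^ j with hq
  have hqd : q.degree < m := by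
    rw [← Polynomial.mem_degreeLT, hq]
    refine Submodule.sum_mem _ fun j hj => ?_
    rw [Polynomial.mem_degreeLT]
    refine (Polynomial.degree_C_mul_X_pow_le _ _).trans_lt ?_
    exact_mod_cast Finset.mem_range.1 hj
  have hmon : (Polynomial.X ^ m + q).Monic := Polynomial.monic_X_pow_add hqd
  have hdeg : (Polynomial.X ^ m + q).natDegree = m := by
    rw [Polynomial.natDegree_add_eq_left_of_degree_lt]
    · simp
    · simpa using hqd
  obtain ⟨c, hc⟩ := exists_eq_prod_X_add_C hmon hdeg
  refine ⟨c, fun j hj => ?_⟩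
  have h1 := Finset.prod_X_add_C_coeff (Finset.univ : Finset (Fin m)) c (k := m - j) (by simp)
  rw [Finset.card_univ, Fintype.card_fin, Nat.sub_sub_self hj, ← hc] at h1
  rw [esum, ← h1]
  rcases Nat.eq_zero_or_pos j with rfl | hj0
  · have : q.coeff m = 0 := Polynomial.coeff_eq_zero_of_degree_lt hqd
    simp [this, hs]
  · rw [Polynomial.coeff_add, Polynomial.coeff_X_pow, if_neg (by omega), zero_add, hq,
      Polynomial.finsetSum_coeff, Finset.sum_eq_single (m - j)]
    · simp [Nat.sub_sub_self hj]
    · intro i _ hi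
      rw [Polynomial.coeff_C_mul, Polynomial.coeff_X_pow, if_neg (Ne.symm hi), mul_zero]
    · intro h
      exact absurd (Finset.mem_range.2 (by omega)) h

/-- Over an algebraically closed field one takes square roots of y₀ and y₁/y₀, solves for the
elementary symmetric functions y_(j+1)/y₁, and takes square roots again. -/
theorem exists_sliceValue_eq {k : Type*} [Field k] [IsAlgClosed k] (m : ℕ) {y : ℕ → k}
    (h0 : y 0 ≠ 0) (h1 : y 1 ≠ 0) :
    ∃ (a b : k) (θ : Fin m → k), ∀ i ≤ m + 1, sliceValue a b θ i = y i := by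
  obtain ⟨a, ha⟩ := IsAlgClosed.exists_pow_nat_eq (y 0) two_pos
  obtain ⟨b, hb⟩ := IsAlgClosed.exists_pow_nat_eq (y 1 / y 0) two_pos
  obtain ⟨c, hc⟩ := exists_esum_eq m (fun j => y (j + 1) / y 1) (div_self h1)
  choose θ hθ using fun i => IsAlgClosed.exists_pow_nat_eq (c i) two_pos
  refine ⟨a, b, θ, fun i hi => ?_⟩
  rw [sliceValue]
  split_ifs with hi0
  · rw [ha, hi0]
  · simp only [hθ]
    rw [hc (i - 1) (by omega), mul_pow, ha, hb, Nat.sub_add_cancel (by omega)]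
    field_simp

/-- The values of the generators at the generic point of the slice. -/
def genericValue (m : ℕ) (i : ℕ) : MvPolynomial (Fin m ⊕ Fin 2) ℝ :=
  sliceValue (MvPolynomial.X (Sum.inr 0)) (MvPolynomial.X (Sum.inr 1))
    (fun j => MvPolynomial.X (Sum.inl j)) i

/-- A relation would vanish at all complex points whose first two coordinates are nonzero, because
`exists_sliceValue_eq` realizes each of them as values on the slice. -/
theorem algebraicIndependent_genericValue {m N : ℕ} (hN : N = m + 2) :
    AlgebraicIndependent ℝ (fun i : Fin N => genericValue m i) := by
  subst hN
  rw [algebraicIndependent_iff]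
  intro P hP
  have key : ∀ y : Fin (m + 2) → ℂ, y 0 ≠ 0 → y 1 ≠ 0 → aeval y P = 0 := by
    intro y h0 h1
    let y' : ℕ → ℂ := fun i => if h : i < m + 2 then y ⟨i, h⟩ else 0
    have hy' : ∀ i : Fin (m + 2), y' i = y i := fun i => by simp [y']
    obtain ⟨a, b, θ, h⟩ := exists_sliceValue_eq m (y := y') (by simpa [y'] using h0)
      (by simpa [y'] using h1)
    let φ : MvPolynomial (Fin m ⊕ Fin 2) ℝ →ₐ[ℝ] ℂ := aeval (Sum.elim θ ![a, b])
    have hφ : ∀ i : Fin (m + 2), φ (genericValue m i) = y i := by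
      intro i
      rw [genericValue, map_sliceValue, ← hy', ← h i (by omega)]
      simp [φ]
    have h2 := congrArg φ hP
    rw [map_zero, ← AlgHom.comp_apply, MvPolynomial.comp_aeval] at h2
    simpa only [hφ] using h2
  -- The two extra factors cover the points where one of the first two coordinates is zero.
  have h3 : MvPolynomial.map (algebraMap ℝ ℂ) P * (MvPolynomial.X 0 * MvPolynomial.X 1) = 0 := by
    refine MvPolynomial.funext fun y => ?_
    rw [map_mul, map_mul, MvPolynomial.eval_X, MvPolynomial.eval_X, map_zero,
      MvPolynomial.eval_map]
    by_cases h0 : y 0 = 0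
    · simp [h0]
    by_cases h1 : y 1 = 0
    · simp [h1]
    have := key y h0 h1
    rw [MvPolynomial.aeval_def] at this
    rw [this, zero_mul]
  have h4 : MvPolynomial.map (algebraMap ℝ ℂ) P = 0 :=
    (mul_eq_zero.1 h3).resolve_right (mul_ne_zero (MvPolynomial.X_ne_zero _)
      (MvPolynomial.X_ne_zero _))
  exact MvPolynomial.map_injective _ (algebraMap ℝ ℂ).injective (by rw [h4, map_zero])

theorem exists_expand_eq_of_even {σ : Type*} [DecidableEq σ] {F : MvPolynomial σ ℝ}
    (h : ∀ i, aeval (fun j => if j = i then -MvPolynomial.X j else MvPolynomial.X j) F = F) :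
    ∃ G : MvPolynomial σ ℝ, MvPolynomial.expand 2 G = F := by
  -- Negating one variable multiplies each coefficient by the sign of its exponent, so invariance
  -- kills all odd exponents.
  have hcoeff : ∀ (i : σ) (G : MvPolynomial σ ℝ) (s : σ →₀ ℕ),
      (aeval (fun j => if j = i then -MvPolynomial.X j else MvPolynomial.X j :
        σ → MvPolynomial σ ℝ) G).coeff s = (-1) ^ s i * G.coeff s := by
    intro i G s
    induction G using MvPolynomial.induction_on' with
    | monomial t c =>
      have h1 : aeval (fun j => if j = i then -MvPolynomial.X j else MvPolynomial.X j :
          σ → MvPolynomial σ ℝ) (MvPolynomial.monomial t c) =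
          MvPolynomial.monomial t ((-1) ^ t i * c) := by
        rw [MvPolynomial.aeval_monomial, MvPolynomial.algebraMap_eq, MvPolynomial.monomial_eq]
        have h2 : ∀ j, (if j = i then -MvPolynomial.X j else MvPolynomial.X j :
            MvPolynomial σ ℝ) ^ t j = (if j = i then MvPolynomial.C ((-1) ^ t i) else 1) *
              MvPolynomial.X j ^ t j := by
          intro j
          split_ifs with hj
          · rw [hj, neg_pow]
            simp
          · rw [one_mul]
        simp only [Finsupp.prod, h2, Finset.prod_mul_distrib]
        rw [Finset.prod_ite_eq' t.support i]
        by_cases hi : i ∈ t.support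
        · rw [if_pos hi, map_mul]
          ring
        · rw [if_neg hi, Finsupp.notMem_support_iff.1 hi]
          simp
      rw [h1, MvPolynomial.coeff_monomial, MvPolynomial.coeff_monomial]
      split_ifs with hts
      · rw [hts]
      · simp
    | add p q hp hq => rw [map_add, MvPolynomial.coeff_add, hp, hq, MvPolynomial.coeff_add, mul_add]
  have heven : ∀ s ∈ F.support, ∀ i, Even (s i) := by
    intro s hs i
    by_contra hodd
    have h1 := hcoeff i F s
    rw [h i, (Nat.not_even_iff_odd.1 hodd).neg_one_pow] at h1
    exact MvPolynomial.mem_support_iff.1 hs (by linarith)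
  refine ⟨∑ s ∈ F.support, MvPolynomial.monomial (s.mapRange (· / 2) rfl) (F.coeff s), ?_⟩
  rw [map_sum]
  conv_rhs => rw [F.as_sum]
  refine Finset.sum_congr rfl fun s hs => ?_
  have h2 : 2 • s.mapRange (· / 2) rfl = s := by
    ext i
    simpa using Nat.two_mul_div_two_of_even (heven s hs i)
  rw [MvPolynomial.expand_monomial, h2]

/-- Evenness writes F as a polynomial in squares; the fundamental theorem on symmetric polynomials,
with coefficients in the two unpermuted variables, does the rest. -/
theorem mem_adjoin_of_even_symmetric {m : ℕ} {F : MvPolynomial (Fin m ⊕ Fin 2) ℝ}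
    (h : ∀ i, aeval (fun j => if j = i then -MvPolynomial.X j else MvPolynomial.X j) F = F)
    (hs : ∀ σ : Equiv.Perm (Fin m), MvPolynomial.rename (Sum.map σ id) F = F) :
    F ∈ Algebra.adjoin ℝ ((Set.range fun a : Fin 2 =>
        (MvPolynomial.X (Sum.inr a) ^ 2 : MvPolynomial (Fin m ⊕ Fin 2) ℝ)) ∪
      Set.range fun j : Fin m =>
        esum (fun i => (MvPolynomial.X (Sum.inl i) ^ 2 : MvPolynomial (Fin m ⊕ Fin 2) ℝ)) (j + 1)) := by
  obtain ⟨G, rfl⟩ := exists_expand_eq_of_even h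
  have hG : ∀ σ : Equiv.Perm (Fin m), MvPolynomial.rename (Sum.map σ id) G = G := by
    intro σ
    apply MvPolynomial.expand_injective two_pos
    rw [← MvPolynomial.rename_expand, hs]
  let ψ := MvPolynomial.sumAlgEquiv ℝ (Fin m) (Fin 2)
  have hψ : (ψ G).IsSymmetric := by
    intro σ
    have h1 : ((MvPolynomial.rename σ : MvPolynomial (Fin m) (MvPolynomial (Fin 2) ℝ) →ₐ[_] _).restrictScalars
        ℝ).comp ψ.toAlgHom = ψ.toAlgHom.comp (MvPolynomial.rename (Sum.map σ id)) := by
      refine MvPolynomial.algHom_ext fun i => ?_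
      rcases i with i | i <;> simp [ψ]
    have h2 := AlgHom.congr_fun h1 G
    simp only [AlgHom.comp_apply, hG] at h2
    exact h2
  obtain ⟨H, hH⟩ := MvPolynomial.esymmAlgHom_surjective (R := MvPolynomial (Fin 2) ℝ)
    (σ := Fin m) (n := m) (by simp) ⟨ψ G, hψ⟩
  have hH' : aeval (fun i : Fin m => MvPolynomial.esymm (Fin m) (MvPolynomial (Fin 2) ℝ) (i + 1)) H
      = ψ G := by
    rw [← MvPolynomial.esymmAlgHom_apply, hH]
  have hG2 : G = ψ.symm (aeval (fun i : Fin m =>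
      MvPolynomial.esymm (Fin m) (MvPolynomial (Fin 2) ℝ) (i + 1)) H) := by
    rw [hH', AlgEquiv.symm_apply_apply]
  rw [hG2]
  clear hG2 hH hH' hψ hG hs h
  induction H using MvPolynomial.induction_on with
  | C p =>
    rw [MvPolynomial.algHom_C, MvPolynomial.algebraMap_eq]
    induction p using MvPolynomial.induction_on with
    | C r =>
      have : MvPolynomial.expand 2 (ψ.symm (MvPolynomial.C (MvPolynomial.C r))) =
          algebraMap ℝ _ r := by
        rw [MvPolynomial.sumAlgEquiv_symm_C_C, MvPolynomial.expand_C]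
        rfl
      rw [this]
      exact Subalgebra.algebraMap_mem _ _
    | add p q hp hq =>
      simp only [map_add]
      exact add_mem hp hq
    | mul_X p i hp =>
      simp only [map_mul]
      refine mul_mem hp ?_
      rw [MvPolynomial.sumAlgEquiv_symm_C_X, MvPolynomial.expand_X]
      exact Algebra.subset_adjoin (Or.inl ⟨i, rfl⟩)
  | add p q hp hq =>
    simp only [map_add]
    exact add_mem hp hq
  | mul_X p i hp =>
    simp only [map_mul]
    refine mul_mem hp ?_
    rw [MvPolynomial.aeval_X]
    refine Algebra.subset_adjoin (Or.inr ⟨i, ?_⟩)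
    simp [MvPolynomial.esymm, esum, ψ]

/-- A polynomial identity `c f = P(q)` with `c = q i` can be divided by `c`, if at a point where
`q i` vanishes the other `q j` are algebraically independent. -/
theorem mem_adjoin_of_mul_mem {A B ι : Type*} [CommRing A] [IsDomain A] [Algebra ℝ A]
    [CommRing B] [Algebra ℝ B] [DecidableEq ι] {q : ι → A} {i : ι} (φ : A →ₐ[ℝ] B) (hi : q i ≠ 0)
    (h0 : φ (q i) = 0)
    (hind : AlgebraicIndependent ℝ fun j : {j // j ≠ i} => φ (q j)) {f : A}
    (hf : q i * f ∈ Algebra.adjoin ℝ (Set.range q)) : f ∈ Algebra.adjoin ℝ (Set.range q) := by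
  rw [Algebra.adjoin_range_eq_range_aeval] at hf ⊢
  obtain ⟨P, hP⟩ := hf
  -- The map `e` sets the i-th variable to zero; P differs from its image by a multiple of that
  -- variable.
  let e : MvPolynomial ι ℝ →ₐ[ℝ] MvPolynomial {j // j ≠ i} ℝ :=
    aeval fun j => if h : j = i then 0 else MvPolynomial.X ⟨j, h⟩
  have hdvd : ∀ G : MvPolynomial ι ℝ, MvPolynomial.X i ∣
      G - MvPolynomial.rename Subtype.val (e G) := by
    intro G
    induction G using MvPolynomial.induction_on with
    | C r => simp [e]
    | add p q hp hq =>
      rw [map_add, map_add, add_sub_add_comm]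
      exact dvd_add hp hq
    | mul_X p j hp =>
      have h1 : p * MvPolynomial.X j - MvPolynomial.rename Subtype.val (e (p * MvPolynomial.X j)) =
          (p - MvPolynomial.rename Subtype.val (e p)) * MvPolynomial.X j +
          MvPolynomial.rename Subtype.val (e p) *
            (MvPolynomial.X j - MvPolynomial.rename Subtype.val (e (MvPolynomial.X j))) := by
        rw [map_mul, map_mul]
        ring
      rw [h1]
      refine dvd_add (hp.mul_right _) (Dvd.dvd.mul_left ?_ _)
      by_cases h : j = i
      · simp [e, h]
      · simp [e, h]
  -- Applying φ to c f = P(q) turns `e P` into a relation among the independent elements φ(q_j), j ≠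
  -- i.
  have he : e P = 0 := by
    apply hind.eq_zero_of_aeval_eq_zero
    have h1 : (aeval fun j : {j // j ≠ i} => φ (q j)).comp e = φ.comp (aeval q) := by
      refine MvPolynomial.algHom_ext fun j => ?_
      by_cases h : j = i
      · subst h
        simp [e, h0]
      · simp [e, h]
    have h2 := AlgHom.congr_fun h1 P
    simp only [AlgHom.comp_apply] at h2
    rw [h2]
    have h3 : aeval q P = q i * f := hP
    rw [h3, map_mul, h0, zero_mul]
  obtain ⟨G, hG⟩ := hdvd P
  rw [he, map_zero, sub_zero] at hG
  refine ⟨G, mul_left_cancel₀ hi ?_⟩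
  rw [← hP, hG]
  simp

end Polynomials

/-! ### Restriction to the slice and generation of the invariants. -/

section Generation

set_option linter.unusedSectionVars false

open MvPolynomial (aeval)

variable {R : Type*} [CommRing R] [Algebra ℝ R] {n m ε : ℕ}

/-- Evaluation at a point of the slice. -/
def sliceEval (e : Fin n ≃ Fin 2 ⊕ ((Fin 2 × Fin m) ⊕ Fin ε)) (a b : R) (θ : Fin m → R) :
    S n →ₐ[ℝ] R :=
  evalR ((sliceK ε θ).submatrix e e) ((fromRows !![0, a; b, 0] 0).submatrix e id) 0

theorem map_sliceEval {R' : Type*} [CommRing R'] [Algebra ℝ R']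
    (e : Fin n ≃ Fin 2 ⊕ ((Fin 2 × Fin m) ⊕ Fin ε)) (φ : R →ₐ[ℝ] R') (a b : R) (θ : Fin m → R)
    (f : S n) : φ (sliceEval e a b θ f) = sliceEval e (φ a) (φ b) (fun j => φ (θ j)) f := by
  rw [sliceEval, sliceEval, map_evalR, map_zero]
  congr 2
  · ext i j
    simp only [Matrix.map_apply, submatrix_apply]
    generalize e i = i
    generalize e j = j
    rcases i with i | ⟨i, k⟩ | i <;> rcases j with j | ⟨j, l⟩ | j <;>
      simp [sliceK, torus, blockDiagonal_apply]
    by_cases h : k = l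
    · subst h
      fin_cases i <;> fin_cases j <;> simp
    · simp [h]
  · ext i j
    simp only [Matrix.map_apply, submatrix_apply]
    generalize e i = i
    rcases i with i | i
    · fin_cases i <;> fin_cases j <;> simp
    · simp

theorem sliceEval_diagonal {f : S n} (hf : f ∈ invariantsS n)
    (e : Fin n ≃ Fin 2 ⊕ ((Fin 2 × Fin m) ⊕ Fin ε)) (a b : ℝ) (θ : Fin m → ℝ)
    (c : Fin 2 → ℝ) (d : Fin m → ℝ) (hc : ∀ i, c i * c i = 1) (hd : ∀ i, d i * d i = 1) :
    sliceEval e (c 0 * a) (c 1 * b) (fun j => d j * θ j) f = sliceEval e a b θ f := by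
  -- Only the first coordinate of each plane receives the sign: this changes the sign of θ_j, while
  -- flipping both coordinates would not.
  let D : Fin 2 ⊕ ((Fin 2 × Fin m) ⊕ Fin ε) → ℝ :=
    Sum.elim c (Sum.elim (fun p => if p.1 = 0 then d p.2 else 1) 1)
  have hD : (diagonal D)ᵀ * diagonal D = 1 := by
    rw [diagonal_transpose, diagonal_mul_diagonal, ← diagonal_one]
    congr 1
    funext i
    rcases i with i | ⟨i, k⟩ | i
    · exact hc i
    · by_cases h : i = 0 <;> simp [D, h, hd]
    · simp [D]
  rw [sliceEval, sliceEval, ← evalR_submatrix_rotation hf e (sliceK_transpose ε θ) _ 0 hD]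
  congr 2
  · congr 1
    ext i j
    rw [diagonal_transpose, mul_diagonal, diagonal_mul]
    rcases i with i | ⟨i, k⟩ | i <;> rcases j with j | ⟨j, l⟩ | j <;>
      simp [sliceK, torus, blockDiagonal_apply]
    by_cases h : k = l
    · subst h
      fin_cases i <;> fin_cases j <;> simp [D, mul_comm]
    · simp [h]
  · congr 1
    ext i j
    rw [diagonal_transpose, diagonal_mul]
    rcases i with i | i
    · fin_cases i <;> fin_cases j <;> simp [D]
    · simp

/-- Permuting the coordinate planes is an orthogonal transformation that preserves the slice. -/
theorem sliceEval_perm {f : S n} (hf : f ∈ invariantsS n)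
    (e : Fin n ≃ Fin 2 ⊕ ((Fin 2 × Fin m) ⊕ Fin ε)) (a b : ℝ) (θ : Fin m → ℝ)
    (σ : Equiv.Perm (Fin m)) :
    sliceEval e a b (fun j => θ (σ j)) f = sliceEval e a b θ f := by
  let π : Equiv.Perm (Fin 2 ⊕ ((Fin 2 × Fin m) ⊕ Fin ε)) :=
    (Equiv.refl _).sumCongr (((Equiv.refl _).prodCongr σ).sumCongr (Equiv.refl _))
  let ρ : Matrix (Fin 2 ⊕ ((Fin 2 × Fin m) ⊕ Fin ε)) (Fin 2 ⊕ ((Fin 2 × Fin m) ⊕ Fin ε)) ℝ :=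
    (1 : Matrix _ _ ℝ).submatrix id π
  have hl : ∀ {κ : Type} (A : Matrix (Fin 2 ⊕ ((Fin 2 × Fin m) ⊕ Fin ε)) κ ℝ),
      ρᵀ * A = A.submatrix π id := by
    intro κ A
    ext i j
    simp [ρ, mul_apply, one_apply]
  have hr : ∀ (A : Matrix (Fin 2 ⊕ ((Fin 2 × Fin m) ⊕ Fin ε))
      (Fin 2 ⊕ ((Fin 2 × Fin m) ⊕ Fin ε)) ℝ), A * ρ = A.submatrix id π := by
    intro A
    ext i j
    simp [ρ, mul_apply, one_apply]
  have hρ : ρᵀ * ρ = 1 := by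
    rw [hl]
    ext i j
    simp [ρ, one_apply]
  rw [sliceEval, sliceEval, ← evalR_submatrix_rotation hf e (sliceK_transpose ε θ) _ 0 hρ]
  rw [hl, hl, hr]
  congr 2
  · congr 1
    ext i j
    rcases i with i | ⟨i, k⟩ | i <;> rcases j with j | ⟨j, l⟩ | j <;>
      simp [sliceK, torus, blockDiagonal_apply, π]
  · congr 1
    ext i j
    rcases i with i | ⟨i, k⟩ | i
    · fin_cases i <;> fin_cases j <;> simp [π]
    · simp [π]
    · simp [π]

/-- Evaluation at the generic point of the slice. -/
def genericEval (e : Fin n ≃ Fin 2 ⊕ ((Fin 2 × Fin m) ⊕ Fin ε)) :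
    S n →ₐ[ℝ] MvPolynomial (Fin m ⊕ Fin 2) ℝ :=
  sliceEval e (MvPolynomial.X (Sum.inr 0)) (MvPolynomial.X (Sum.inr 1))
    fun j => MvPolynomial.X (Sum.inl j)

theorem genericEval_gen (hn : n = 2 + (2 * m + ε)) (hε : ε ≤ 1)
    (e : Fin n ≃ Fin 2 ⊕ ((Fin 2 × Fin m) ⊕ Fin ε)) (i : Fin (n / 2 + 1)) :
    genericEval e (gen n i) = genericValue m i :=
  evalR_gen_slice hn hε e _ _ _ _ i

theorem algebraicIndependent_gen (hn : n = 2 + (2 * m + ε)) (hε : ε ≤ 1) :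
    AlgebraicIndependent ℝ (gen n) := by
  let e : Fin n ≃ Fin 2 ⊕ ((Fin 2 × Fin m) ⊕ Fin ε) := Fintype.equivOfCardEq (by simp [hn])
  have h := algebraicIndependent_genericValue (m := m) (N := n / 2 + 1) (by omega)
  refine AlgebraicIndependent.of_comp (genericEval e) ?_
  convert! h using 1
  funext i
  exact genericEval_gen hn hε e i

theorem eval_genericEval (e : Fin n ≃ Fin 2 ⊕ ((Fin 2 × Fin m) ⊕ Fin ε)) (f : S n)
    (x : Fin m ⊕ Fin 2 → ℝ) : aeval x (genericEval e f) =
      sliceEval e (x (Sum.inr 0)) (x (Sum.inr 1)) (fun j => x (Sum.inl j)) f := by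
  rw [genericEval, map_sliceEval]
  simp

theorem genericEval_mem {f : S n} (hf : f ∈ invariantsS n)
    (e : Fin n ≃ Fin 2 ⊕ ((Fin 2 × Fin m) ⊕ Fin ε)) :
    genericEval e f ∈ Algebra.adjoin ℝ ((Set.range fun a : Fin 2 =>
        (MvPolynomial.X (Sum.inr a) ^ 2 : MvPolynomial (Fin m ⊕ Fin 2) ℝ)) ∪
      Set.range fun j : Fin m =>
        esum (fun i => (MvPolynomial.X (Sum.inl i) ^ 2 : MvPolynomial (Fin m ⊕ Fin 2) ℝ))
          (j + 1)) := by
  refine mem_adjoin_of_even_symmetric (fun i => ?_) (fun σ => ?_) <;>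
    refine MvPolynomial.funext fun x => ?_ <;> simp only [← MvPolynomial.aeval_eq_eval]
  · rw [← AlgHom.comp_apply, MvPolynomial.comp_aeval, eval_genericEval, eval_genericEval,
      ← sliceEval_diagonal hf e (x (Sum.inr 0)) (x (Sum.inr 1)) (fun j => x (Sum.inl j))
        (fun a => if Sum.inr a = i then -1 else 1) (fun j => if Sum.inl j = i then -1 else 1)]
    · congr 1
      · simp only [apply_ite (aeval x), map_neg, MvPolynomial.aeval_X]
        congr 1
        · split_ifs <;> simp
        · split_ifs <;> simp
        · funext j
          split_ifs <;> simp
    · intro a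
      split_ifs <;> simp
    · intro a
      split_ifs <;> simp
  · rw [MvPolynomial.aeval_rename, eval_genericEval, eval_genericEval]
    exact sliceEval_perm hf e _ _ (fun j => x (Sum.inl j)) σ

/-- With g₀ = a² and g₁ = a²b², the identities g₀g₁ b² = g₁² and g₀g₁ e_(j+1) = g₀ g_(j+2) clear
denominators. -/
theorem exists_mul_pow_mem {N : ℕ} (hN : N = m + 2) {F : MvPolynomial (Fin m ⊕ Fin 2) ℝ}
    (hF : F ∈ Algebra.adjoin ℝ ((Set.range fun a : Fin 2 =>
        (MvPolynomial.X (Sum.inr a) ^ 2 : MvPolynomial (Fin m ⊕ Fin 2) ℝ)) ∪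
      Set.range fun j : Fin m =>
        esum (fun i => (MvPolynomial.X (Sum.inl i) ^ 2 : MvPolynomial (Fin m ⊕ Fin 2) ℝ))
          (j + 1))) :
    ∃ k : ℕ, (genericValue m 0 * genericValue m 1) ^ k * F ∈
      Algebra.adjoin ℝ (Set.range fun i : Fin N => genericValue m i) := by
  have hg : ∀ i < N, genericValue m i ∈
      Algebra.adjoin ℝ (Set.range fun i : Fin N => genericValue m i) := fun i hi =>
    Algebra.subset_adjoin ⟨⟨i, hi⟩, rfl⟩
  have hc : genericValue m 0 * genericValue m 1 ∈
      Algebra.adjoin ℝ (Set.range fun i : Fin N => genericValue m i) :=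
    mul_mem (hg 0 (by omega)) (hg 1 (by omega))
  induction hF using Algebra.adjoin_induction with
  | mem F hF =>
    rcases hF with ⟨a, rfl⟩ | ⟨j, rfl⟩
    · fin_cases a
      · refine ⟨0, ?_⟩
        simpa [genericValue, sliceValue] using hg 0 (by omega)
      · refine ⟨1, ?_⟩
        convert mul_mem (hg 1 (by omega)) (hg 1 (by omega)) using 1
        simp [genericValue, sliceValue, esum_zero]
        ring
    · refine ⟨1, ?_⟩
      convert mul_mem (hg 0 (by omega)) (hg (j + 2) (by omega)) using 1
      simp [genericValue, sliceValue, esum_zero]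
      ring
  | algebraMap r => exact ⟨0, by rw [pow_zero, one_mul]; exact Subalgebra.algebraMap_mem _ r⟩
  | add F G _ _ hF hG =>
    obtain ⟨k, hk⟩ := hF
    obtain ⟨l, hl⟩ := hG
    refine ⟨k + l, ?_⟩
    convert add_mem (mul_mem (pow_mem hc l) hk) (mul_mem (pow_mem hc k) hl) using 1
    ring
  | mul F G _ _ hF hG =>
    obtain ⟨k, hk⟩ := hF
    obtain ⟨l, hl⟩ := hG
    refine ⟨k + l, ?_⟩
    convert mul_mem hk hl using 1
    ring

theorem algebraicIndependent_complexify {σ ι : Type*} {x : ι → MvPolynomial σ ℝ}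
    (h : AlgebraicIndependent ℝ x) : AlgebraicIndependent ℝ fun i =>
      (MvPolynomial.mapAlgHom (Algebra.ofId ℝ ℂ) (x i) : MvPolynomial σ ℂ) := by
  have := h.map' (f := MvPolynomial.mapAlgHom (σ := σ) (Algebra.ofId ℝ ℂ))
    (MvPolynomial.map_injective _ (algebraMap ℝ ℂ).injective)
  exact this

theorem complexify_genericValue (m i : ℕ) :
    (MvPolynomial.mapAlgHom (Algebra.ofId ℝ ℂ) (genericValue m i) :
      MvPolynomial (Fin m ⊕ Fin 2) ℂ) = sliceValue (MvPolynomial.X (Sum.inr 0))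
        (MvPolynomial.X (Sum.inr 1)) (fun j => MvPolynomial.X (Sum.inl j)) i := by
  rw [genericValue, map_sliceValue]
  simp

theorem C_I_mul_C_I {σ : Type*} :
    (MvPolynomial.C Complex.I * MvPolynomial.C Complex.I : MvPolynomial σ ℂ) = -1 := by
  rw [← map_mul, Complex.I_mul_I, map_neg, map_one]

/-- A complex point with `Q₁ = 0`. -/
theorem exists_point_Q1 (hn : n = 2 + (2 * m + ε)) (hε : ε ≤ 1) :
    ∃ φ : S n →ₐ[ℝ] MvPolynomial (Fin m ⊕ Fin 2) ℂ, φ (gen n 0) = 0 ∧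
      AlgebraicIndependent ℝ fun j : {j : Fin (n / 2 + 1) // j ≠ 0} => φ (gen n j) := by
  let e : Fin n ≃ Fin 2 ⊕ ((Fin 2 × Fin m) ⊕ Fin ε) := Fintype.equivOfCardEq (by simp [hn])
  let a : MvPolynomial (Fin m ⊕ Fin 2) ℂ := MvPolynomial.X (Sum.inr 0)
  let b : MvPolynomial (Fin m ⊕ Fin 2) ℂ := MvPolynomial.X (Sum.inr 1)
  let θ : Fin m → MvPolynomial (Fin m ⊕ Fin 2) ℂ := fun j => MvPolynomial.X (Sum.inl j)
  let I : MvPolynomial (Fin m ⊕ Fin 2) ℂ := MvPolynomial.C Complex.I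
  have hI : I * I = -1 := C_I_mul_C_I
  -- Here x = (1, i) is isotropic, and v is chosen so that the determinant is -ab; the generators
  -- other than Q₁ then keep their generic slice values.
  have hd : (!![I * a * b, 1; 0, I] : Matrix (Fin 2) (Fin 2) _).det = -(a * b) := by
    rw [det_fin_two_of]
    linear_combination (a * b) * hI
  have hval : ∀ j : Fin (n / 2 + 1), evalR ((sliceK ε θ).submatrix e e)
      ((fromRows !![I * a * b, 1; 0, I] 0).submatrix e id) 0 (gen n j) =
      if (j : ℕ) = 0 then 0 else sliceValue a b θ j := by
    intro j
    rw [sliceK, evalR_gen_fromBlocks hn hε e _ _ _ _ _ _ (sliceK_transpose ε θ), hd]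
    split_ifs with h0
    · simp [mul_apply, hI]
    · rw [sliceValue, if_neg h0, neg_sq]
  refine ⟨evalR ((sliceK ε θ).submatrix e e)
    ((fromRows !![I * a * b, 1; 0, I] 0).submatrix e id) 0, ?_, ?_⟩
  · rw [hval]
    simp
  · have h := (algebraicIndependent_complexify (algebraicIndependent_genericValue (m := m)
      (N := n / 2 + 1) (by omega))).comp (Subtype.val : {j : Fin (n / 2 + 1) // j ≠ 0} → _)
        Subtype.val_injective
    convert! h using 1
    funext ⟨j, hj⟩
    have hj0 : (j : ℕ) ≠ 0 := fun h => hj (Fin.ext h)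
    simp only [hval, Function.comp_apply, complexify_genericValue, if_neg hj0, a, b, θ]

/-- Here v = (i, 0, 1, 0) is isotropic and orthogonal to x = (0, ξ, 0, 0), so the Gram determinant
is zero. The entry τ of K couples the first coordinate to the fourth and keeps the bordered
determinant nonzero. -/
theorem bordPoly_special (R : Type*) [CommRing R] (ξ τ I : R) (hI : I * I = -1) :
    bordPoly (!![0, 0, 0, τ; 0, 0, 0, 0; 0, 0, 0, 0; -τ, 0, 0, 0] : Matrix (Fin 4) (Fin 4) R)
      !![I, 0; 0, ξ; 1, 0; 0, 0] = Polynomial.C ((ξ * τ) ^ 2) := by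
  have hI' : Polynomial.C I * Polynomial.C I = -1 := by
    rw [← map_mul, hI, map_neg, map_one]
  have hM : ∀ M : Matrix (Fin 4 ⊕ Fin 2) (Fin 4 ⊕ Fin 2) (Polynomial R), M =
      fromBlocks ((Polynomial.X : Polynomial R) • (1 : Matrix (Fin 4) (Fin 4) (Polynomial R)) +
    !![0, 0, 0, τ; 0, 0, 0, 0; 0, 0, 0, 0; -τ, 0, 0, 0].map Polynomial.C)
    (!![I, 0; 0, ξ; 1, 0; 0, 0].map Polynomial.C) (-(!![I, 0; 0, ξ; 1, 0; 0, 0].map Polynomial.C)ᵀ) 0 →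
    M.submatrix finSumFinEquiv.symm finSumFinEquiv.symm =
      !![Polynomial.X, 0, 0, Polynomial.C τ, Polynomial.C I, 0;
        0, Polynomial.X, 0, 0, 0, Polynomial.C ξ;
        0, 0, Polynomial.X, 0, 1, 0;
        -Polynomial.C τ, 0, 0, Polynomial.X, 0, 0;
        -Polynomial.C I, 0, -1, 0, 0, 0;
        0, -Polynomial.C ξ, 0, 0, 0, 0] := by
    rintro _ rfl
    ext1 i j
    obtain ⟨i, rfl⟩ := finSumFinEquiv.surjective i
    obtain ⟨j, rfl⟩ := finSumFinEquiv.surjective j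
    rw [submatrix_apply, Equiv.symm_apply_apply, Equiv.symm_apply_apply]
    rcases i with i | i <;> rcases j with j | j <;> fin_cases i <;> fin_cases j <;>
      simp [finSumFinEquiv]
  rw [bordPoly, ← det_submatrix_equiv_self finSumFinEquiv.symm, hM _ rfl]
  simp [det_succ_row_zero, Fin.sum_univ_succ, Fin.succAbove]
  linear_combination (Polynomial.C ξ ^ 2 * Polynomial.X ^ 2) * hI'

/-- A complex point with `Q₂ = 0`. -/
theorem exists_point_Q2 (hn : n = 4 + (2 * m + ε)) (hε : ε ≤ 1) (i₁ : Fin (n / 2 + 1))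
    (hi₁ : (i₁ : ℕ) = 1) :
    ∃ φ : S n →ₐ[ℝ] MvPolynomial (Fin m ⊕ Fin 2) ℂ, φ (gen n i₁) = 0 ∧
      AlgebraicIndependent ℝ fun j : {j : Fin (n / 2 + 1) // j ≠ i₁} => φ (gen n j) := by
  let e : Fin n ≃ Fin 4 ⊕ ((Fin 2 × Fin m) ⊕ Fin ε) := Fintype.equivOfCardEq (by simp [hn])
  let a : MvPolynomial (Fin m ⊕ Fin 2) ℂ := MvPolynomial.X (Sum.inr 0)
  let b : MvPolynomial (Fin m ⊕ Fin 2) ℂ := MvPolynomial.X (Sum.inr 1)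
  let θ : Fin m → MvPolynomial (Fin m ⊕ Fin 2) ℂ := fun j => MvPolynomial.X (Sum.inl j)
  let I : MvPolynomial (Fin m ⊕ Fin 2) ℂ := MvPolynomial.C Complex.I
  have hI : I * I = -1 := C_I_mul_C_I
  let K4 : Matrix (Fin 4) (Fin 4) (MvPolynomial (Fin m ⊕ Fin 2) ℂ) :=
    !![0, 0, 0, b; 0, 0, 0, 0; 0, 0, 0, 0; -b, 0, 0, 0]
  let W4 : Matrix (Fin 4) (Fin 2) (MvPolynomial (Fin m ⊕ Fin 2) ℂ) := !![I, 0; 0, a; 1, 0; 0, 0]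
  have hK4 : K4ᵀ = -K4 := by
    ext1 i j
    fin_cases i <;> fin_cases j <;> simp [K4]
  have hK : (fromBlocks K4 0 0 (torus ε θ))ᵀ = -fromBlocks K4 0 0 (torus ε θ) := by
    simp [fromBlocks_transpose, torus_transpose, fromBlocks_neg, hK4]
  have hWW : W4ᵀ * W4 = !![0, 0; 0, a ^ 2] := by
    ext1 i j
    fin_cases i <;> fin_cases j <;> simp [W4, mul_apply, Fin.sum_univ_four, hI, sq]
  have hW : ((fromRows W4 (0 : Matrix ((Fin 2 × Fin m) ⊕ Fin ε) (Fin 2) _)).submatrix e id)ᵀ *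
      (fromRows W4 (0 : Matrix ((Fin 2 × Fin m) ⊕ Fin ε) (Fin 2) _)).submatrix e id =
      !![0, 0; 0, a ^ 2] := by
    rw [transpose_submatrix, submatrix_mul_equiv, transpose_fromRows, fromCols_mul_fromRows]
    simp [hWW]
  have hval : ∀ j : Fin (n / 2 + 1), evalR ((fromBlocks K4 0 0 (torus ε θ)).submatrix e e)
      ((fromRows W4 0).submatrix e id) 0 (gen n j) = if (j : ℕ) = 0 then a ^ 2 else
        if (j : ℕ) = 1 then 0 else sliceValue a b θ (j - 1) := by
    intro j
    rw [evalR_gen (submatrix_transpose_eq_neg e hK), hW, bordPoly_submatrix,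
      bordPoly_fromBlocks_diag, bordPoly_special _ a b I hI]
    have hj := j.2
    split_ifs with h0 h1
    · simp
    · simp [det_fin_two]
    · rw [Polynomial.coeff_C_mul, sliceValue, if_neg (by omega),
        ← coeff_det_torus ε θ (j := (j : ℕ) - 1 - 1) (by omega)]
      congr 2
      omega
  refine ⟨evalR ((fromBlocks K4 0 0 (torus ε θ)).submatrix e e)
      ((fromRows W4 0).submatrix e id) 0, ?_, ?_⟩
  · rw [hval, hi₁]
    simp
  · let r : {j : Fin (n / 2 + 1) // j ≠ i₁} → Fin (m + 2) := fun j =>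
      ⟨(j : Fin (n / 2 + 1)) - 1, by omega⟩
    have hr : Function.Injective r := by
      rintro ⟨j, hj⟩ ⟨k, hk⟩ h
      have hj' : (j : ℕ) ≠ 1 := fun h => hj (Fin.ext (h.trans hi₁.symm))
      have hk' : (k : ℕ) ≠ 1 := fun h => hk (Fin.ext (h.trans hi₁.symm))
      have h' : (j : ℕ) - 1 = (k : ℕ) - 1 := congrArg Fin.val h
      ext
      simp only
      omega
    have h := (algebraicIndependent_complexify (algebraicIndependent_genericValue (m := m)
      rfl)).comp r hr
    convert! h using 1
    funext ⟨j, hj⟩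
    have hj' : (j : ℕ) ≠ 1 := fun h => hj (Fin.ext (h.trans hi₁.symm))
    simp only [hval, Function.comp_apply, complexify_genericValue, r, if_neg hj']
    split_ifs with h0
    · simp [h0, sliceValue, a]
    · rfl

/-- On the slice (Q₁Q₂)^k f agrees with a polynomial in the generators; both sides are invariant, so
they are equal. -/
theorem adjoin_gen (hn : n = 4 + (2 * m + ε)) (hε : ε ≤ 1) :
    Algebra.adjoin ℝ (Set.range (gen n)) = invariantsS n := by
  apply le_antisymm
  · rw [Algebra.adjoin_le_iff]
    rintro _ ⟨i, rfl⟩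
    exact gen_mem_invariantsS i
  intro f hf
  have hn' : n = 2 + (2 * (m + 1) + ε) := by omega
  let e : Fin n ≃ Fin 2 ⊕ ((Fin 2 × Fin (m + 1)) ⊕ Fin ε) :=
    Fintype.equivOfCardEq (by simp [hn'])
  let i₁ : Fin (n / 2 + 1) := ⟨1, by omega⟩
  have hind := algebraicIndependent_gen hn' hε
  obtain ⟨φ₁, h₁, h₁'⟩ := exists_point_Q1 hn' hε
  obtain ⟨φ₂, h₂, h₂'⟩ := exists_point_Q2 hn hε i₁ rfl
  obtain ⟨k, hk⟩ := exists_mul_pow_mem (N := n / 2 + 1) (by omega) (genericEval_mem hf e)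
  have h3 : (gen n 0 * gen n i₁) ^ k * f ∈ Algebra.adjoin ℝ (Set.range (gen n)) := by
    have h4 : (Set.range fun i : Fin (n / 2 + 1) => genericValue (m + 1) i) =
        genericEval e '' Set.range (gen n) := by
      rw [← Set.range_comp]
      congr 1
      funext i
      exact (genericEval_gen hn' hε e i).symm
    rw [h4, ← AlgHom.map_adjoin, Subalgebra.mem_map] at hk
    obtain ⟨P, hP, hPk⟩ := hk
    have hPinv : P ∈ invariantsS n := by
      refine Algebra.adjoin_le (S := invariantsS n) ?_ hP
      rintro _ ⟨i, rfl⟩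
      exact gen_mem_invariantsS i
    have h5 : (gen n 0 * gen n i₁) ^ k * f - P = 0 := by
      refine eq_zero_of_slice (fun g => Or.inl (mem_invariantsS.1 (sub_mem (mul_mem (pow_mem
        (mul_mem (gen_mem_invariantsS _) (gen_mem_invariantsS _)) k) hf) hPinv) g)) hε hn' e
        fun α β θ => ?_
      have h6 : genericEval e ((gen n 0 * gen n i₁) ^ k * f - P) = 0 := by
        have e0 := genericEval_gen hn' hε e 0
        have e1 := genericEval_gen hn' hε e i₁
        rw [map_sub, map_mul, map_pow, map_mul, e0, e1, sub_eq_zero]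
        exact hPk.symm
      have h7 := eval_genericEval e ((gen n 0 * gen n i₁) ^ k * f - P) (Sum.elim θ ![α, β])
      rw [h6, map_zero] at h7
      exact h7.symm
    rw [sub_eq_zero.1 h5]
    exact hP
  clear hk
  -- Each step down in k divides by Q₁ and by Q₂ through the two complex points.
  induction k with
  | zero => simpa using h3
  | succ k ih =>
    apply ih
    refine mem_adjoin_of_mul_mem φ₂ (hind.ne_zero i₁) h₂ h₂' ?_
    refine mem_adjoin_of_mul_mem φ₁ (hind.ne_zero 0) h₁ h₁' ?_
    convert h3 using 1
    ring

end Generation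

/-! ### The order filtration of U and the symmetrization map. -/

section Symmetrization

theorem exists_equiv_of_perm {α : Type*} {l₁ l₂ : List α} (h : l₁.Perm l₂) :
    ∃ σ : Fin l₁.length ≃ Fin l₂.length, ∀ i, l₂.get (σ i) = l₁.get i := by
  induction h with
  | nil => exact ⟨Equiv.refl _, fun _ => rfl⟩
  | cons a _ ih =>
    obtain ⟨σ, hσ⟩ := ih
    refine ⟨(finSuccEquiv _).trans (σ.optionCongr.trans (finSuccEquiv _).symm), fun i => ?_⟩
    refine Fin.cases ?_ (fun i => ?_) i
    · simp
    · simpa using hσ i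
  | swap a b l =>
    refine ⟨Equiv.swap 0 1, fun i => ?_⟩
    refine Fin.cases ?_ (fun i => Fin.cases ?_ (fun i => ?_) i) i
    · simp
    · simp
    · rw [Equiv.swap_apply_of_ne_of_ne (by simp [Fin.ext_iff]) (by simp [Fin.ext_iff])]
      simp
  | trans _ _ ih₁ ih₂ =>
    obtain ⟨σ, hσ⟩ := ih₁
    obtain ⟨τ, hτ⟩ := ih₂
    exact ⟨σ.trans τ, fun i => by rw [Equiv.trans_apply, hτ, hσ]⟩

variable {L : Type*} [LieRing L] [LieAlgebra ℝ L]

/-- The product in the enveloping algebra of a list of elements of the Lie algebra. -/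
def listU (l : List L) : UniversalEnvelopingAlgebra ℝ L :=
  (l.map (UniversalEnvelopingAlgebra.ι ℝ)).prod

/-- The product in the symmetric algebra of a list of elements of the Lie algebra. -/
def listS (l : List L) : SymmetricAlgebra ℝ L := (l.map (SymmetricAlgebra.ι ℝ L)).prod

theorem listU_cons (a : L) (l : List L) :
    listU (a :: l) = UniversalEnvelopingAlgebra.ι ℝ a * listU l := by simp [listU]

theorem listU_append (l l' : List L) : listU (l ++ l') = listU l * listU l' := by simp [listU]

theorem listS_append (l l' : List L) : listS (l ++ l') = listS l * listS l' := by simp [listS]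

theorem listS_ofFn {m : ℕ} (a : Fin m → L) :
    listS (List.ofFn a) = ∏ i, SymmetricAlgebra.ι ℝ L (a i) := by
  rw [listS, List.map_ofFn, List.prod_ofFn]
  rfl

/-- The span in the enveloping algebra of the products of fewer than `k` elements of the Lie
algebra. -/
def filtU (L : Type*) [LieRing L] [LieAlgebra ℝ L] (k : ℕ) :
    Submodule ℝ (UniversalEnvelopingAlgebra ℝ L) :=
  Submodule.span ℝ (listU '' {l : List L | l.length < k})

/-- The homogeneous elements of degree `k` in the symmetric algebra. -/
def homS (L : Type*) [LieRing L] [LieAlgebra ℝ L] (k : ℕ) :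
    Submodule ℝ (SymmetricAlgebra ℝ L) :=
  Submodule.span ℝ (listS '' {l : List L | l.length = k})

theorem listU_mem_filtU {l : List L} {k : ℕ} (h : l.length < k) : listU l ∈ filtU L k :=
  Submodule.subset_span ⟨l, h, rfl⟩

theorem listS_mem_homS (l : List L) : listS l ∈ homS L l.length :=
  Submodule.subset_span ⟨l, rfl, rfl⟩

theorem filtU_mono {k k' : ℕ} (h : k ≤ k') : filtU L k ≤ filtU L k' :=
  Submodule.span_mono (Set.image_mono fun _ hl => lt_of_lt_of_le hl h)

/-- The bound is strict in `filtU`, so lengths at most p - 1 and q - 1 add to less than p + q - 1.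
-/
theorem mul_mem_filtU {p q : ℕ} {u v : UniversalEnvelopingAlgebra ℝ L} (hu : u ∈ filtU L p)
    (hv : v ∈ filtU L q) : u * v ∈ filtU L (p + q - 1) := by
  have h := Submodule.mul_mem_mul hu hv
  rw [filtU, filtU, Submodule.span_mul_span] at h
  refine Submodule.span_le.2 ?_ h
  rintro _ ⟨_, ⟨l, hl, rfl⟩, _, ⟨l', hl', rfl⟩, rfl⟩
  dsimp only
  rw [← listU_append]
  refine listU_mem_filtU ?_
  rw [List.length_append]
  simp only [Set.mem_ofPred_eq] at hl hl'
  omega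

theorem mul_mem_homS {p q : ℕ} {f g : SymmetricAlgebra ℝ L} (hf : f ∈ homS L p)
    (hg : g ∈ homS L q) : f * g ∈ homS L (p + q) := by
  have h := Submodule.mul_mem_mul hf hg
  rw [homS, homS, Submodule.span_mul_span] at h
  refine Submodule.span_le.2 ?_ h
  rintro _ ⟨_, ⟨l, hl, rfl⟩, _, ⟨l', hl', rfl⟩, rfl⟩
  dsimp only
  rw [← listS_append, ← show l.length = p from hl, ← show l'.length = q from hl',
    ← List.length_append]
  exact listS_mem_homS _

theorem one_mem_homS : (1 : SymmetricAlgebra ℝ L) ∈ homS L 0 := listS_mem_homS []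

theorem pow_mem_homS {p : ℕ} {f : SymmetricAlgebra ℝ L} (hf : f ∈ homS L p) (k : ℕ) :
    f ^ k ∈ homS L (k * p) := by
  induction k with
  | zero => simpa using one_mem_homS
  | succ k ih =>
    rw [pow_succ, Nat.succ_mul]
    exact mul_mem_homS ih hf

theorem ι_mem_homS (a : L) : SymmetricAlgebra.ι ℝ L a ∈ homS L 1 := by
  simpa [listS] using listS_mem_homS [a]

theorem span_listS : Submodule.span ℝ (Set.range (listS : List L → _)) = ⊤ := by
  rw [eq_top_iff]
  rintro f -
  induction f using SymmetricAlgebra.induction with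
  | algebraMap r =>
    rw [Algebra.algebraMap_eq_smul_one]
    exact Submodule.smul_mem _ _ (Submodule.subset_span ⟨[], rfl⟩)
  | ι x => exact Submodule.subset_span ⟨[x], by simp [listS]⟩
  | add f g hf hg => exact add_mem hf hg
  | mul f g hf hg =>
    have h := Submodule.mul_mem_mul hf hg
    rw [Submodule.span_mul_span] at h
    refine Submodule.span_mono ?_ h
    rintro _ ⟨_, ⟨l, rfl⟩, _, ⟨l', rfl⟩, rfl⟩
    exact ⟨l ++ l', listS_append l l'⟩

theorem adjoin_range_ι : Algebra.adjoin ℝ (Set.range (UniversalEnvelopingAlgebra.ι ℝ (L := L))) =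
    ⊤ := by
  let A := Algebra.adjoin ℝ (Set.range (UniversalEnvelopingAlgebra.ι ℝ (L := L)))
  let j : L →ₗ⁅ℝ⁆ A :=
    { toFun := fun a => ⟨UniversalEnvelopingAlgebra.ι ℝ a, Algebra.subset_adjoin ⟨a, rfl⟩⟩
      map_add' := fun a b => Subtype.ext (by simp)
      map_smul' := fun c a => Subtype.ext (by simp)
      map_lie' := fun {a b} => Subtype.ext (by simp [LieRing.of_associative_ring_bracket]) }
  have h : A.val.comp (UniversalEnvelopingAlgebra.lift ℝ j) = AlgHom.id ℝ _ := by
    refine UniversalEnvelopingAlgebra.hom_ext ℝ (LieHom.ext fun a => ?_)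
    change A.val (UniversalEnvelopingAlgebra.lift ℝ j (UniversalEnvelopingAlgebra.ι ℝ a)) = _
    rw [UniversalEnvelopingAlgebra.lift_ι_apply]
    rfl
  rw [eq_top_iff]
  rintro u -
  have := AlgHom.congr_fun h u
  rw [← show _ = u from this]
  exact (UniversalEnvelopingAlgebra.lift ℝ j u).2

theorem span_listU : Submodule.span ℝ (Set.range (listU : List L → _)) = ⊤ := by
  have h := congrArg Subalgebra.toSubmodule (adjoin_range_ι (L := L))
  rw [Algebra.adjoin_eq_span, Algebra.top_toSubmodule] at h
  rw [eq_top_iff, ← h]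
  refine Submodule.span_mono fun u hu => ?_
  obtain ⟨l, hl, rfl⟩ := Submonoid.exists_list_of_mem_closure hu
  choose f hf using hl
  refine ⟨l.pmap f fun _ h => h, ?_⟩
  rw [listU, List.map_pmap]
  congr 1
  simp [hf]

theorem exists_mem_filtU (u : UniversalEnvelopingAlgebra ℝ L) : ∃ k, u ∈ filtU L k := by
  have h : u ∈ Submodule.span ℝ (Set.range (listU : List L → _)) := by
    rw [span_listU]
    trivial
  induction h using Submodule.span_induction with
  | mem u hu =>
    obtain ⟨l, rfl⟩ := hu
    exact ⟨l.length + 1, listU_mem_filtU (Nat.lt_succ_self _)⟩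
  | zero => exact ⟨0, zero_mem _⟩
  | add u v _ _ hu hv =>
    obtain ⟨k, hk⟩ := hu
    obtain ⟨k', hk'⟩ := hv
    exact ⟨max k k', add_mem (filtU_mono (le_max_left _ _) hk) (filtU_mono (le_max_right _ _) hk')⟩
  | smul c u _ hu =>
    obtain ⟨k, hk⟩ := hu
    exact ⟨k, Submodule.smul_mem _ _ hk⟩

/-- Swapping two neighbours produces their bracket, which shortens the word by one letter. -/
theorem listU_sub_mem_of_perm {l l' : List L} (h : l.Perm l') :
    listU l - listU l' ∈ filtU L l.length := by
  induction h with
  | nil => simp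
  | @cons a l l' _ ih =>
    rw [listU_cons, listU_cons, ← mul_sub]
    have h1 : UniversalEnvelopingAlgebra.ι ℝ a ∈ filtU L 2 := by
      simpa [listU] using listU_mem_filtU (l := [a]) (k := 2) (by simp)
    refine filtU_mono ?_ (mul_mem_filtU h1 ih)
    simp only [List.length_cons]
    omega
  | swap a b l =>
    have h1 : listU (b :: a :: l) - listU (a :: b :: l) = listU (⁅b, a⁆ :: l) := by
      simp only [listU_cons, LieHom.map_lie, LieRing.of_associative_ring_bracket]
      noncomm_ring
    rw [h1]
    exact listU_mem_filtU (by simp)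
  | trans h₁ _ ih₁ ih₂ =>
    rw [← sub_add_sub_cancel]
    rw [← h₁.length_eq] at ih₂
    exact add_mem ih₁ ih₂

theorem symProd_eq {m : ℕ} (a : Fin m → L) : symProd a = ((m.factorial : ℝ)⁻¹) •
    ∑ σ : Equiv.Perm (Fin m), listU (List.ofFn (a ∘ σ)) := by
  simp only [symProd, listU, List.map_ofFn]
  rfl

theorem symProd_comp_perm {m : ℕ} (a : Fin m → L) (σ : Equiv.Perm (Fin m)) :
    symProd (a ∘ σ) = symProd a := by
  rw [symProd_eq, symProd_eq]
  congr 1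
  exact Equiv.sum_comp (Equiv.mulLeft σ) fun τ : Equiv.Perm (Fin m) => listU (List.ofFn (a ∘ τ))

theorem symProd_comp_equiv {m m' : ℕ} (a : Fin m → L) (σ : Fin m' ≃ Fin m) :
    symProd (a ∘ σ) = symProd a := by
  obtain rfl : m' = m := Fin.equiv_iff_eq.1 ⟨σ⟩
  exact symProd_comp_perm a σ

theorem symProd_sub_mem {m : ℕ} (a : Fin m → L) :
    symProd a - listU (List.ofFn a) ∈ filtU L m := by
  have hm : (m.factorial : ℝ) ≠ 0 := Nat.cast_ne_zero.2 m.factorial_ne_zero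
  have h : symProd a - listU (List.ofFn a) = ((m.factorial : ℝ)⁻¹) •
      ∑ σ : Equiv.Perm (Fin m), (listU (List.ofFn (a ∘ σ)) - listU (List.ofFn a)) := by
    rw [symProd_eq, Finset.sum_sub_distrib, smul_sub, Finset.sum_const, Finset.card_univ,
      Fintype.card_perm, Fintype.card_fin, ← Nat.cast_smul_eq_nsmul ℝ, smul_smul,
      inv_mul_cancel₀ hm, one_smul]
  rw [h]
  refine Submodule.smul_mem _ _ (Submodule.sum_mem _ fun σ _ => ?_)
  have := listU_sub_mem_of_perm (σ.ofFn_comp_perm a)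
  rwa [List.length_ofFn] at this

/-- `symProd` as a multilinear map. -/
def symProdMultilinear (L : Type*) [LieRing L] [LieAlgebra ℝ L] (m : ℕ) :
    MultilinearMap ℝ (fun _ : Fin m => L) (UniversalEnvelopingAlgebra ℝ L) :=
  ((m.factorial : ℝ)⁻¹) • ∑ σ : Equiv.Perm (Fin m),
    ((MultilinearMap.mkPiAlgebraFin ℝ m (UniversalEnvelopingAlgebra ℝ L)).compLinearMap fun _ =>
      (UniversalEnvelopingAlgebra.ι ℝ : L →ₗ⁅ℝ⁆ _).toLinearMap).domDomCongr σ

theorem symProdMultilinear_apply {m : ℕ} (a : Fin m → L) :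
    symProdMultilinear L m a = symProd a := by
  simp [symProdMultilinear, symProd]

/-- Both sides are multilinear, so basis vectors suffice. There the chosen ordering of the multiset
is a permutation of the given one, and `symProd` does not see it. -/
theorem symmetrization_prod {m : ℕ} (a : Fin m → L) :
    symmetrization L (∏ i, SymmetricAlgebra.ι ℝ L (a i)) = symProd a := by
  let b := Module.Free.chooseBasis ℝ L
  suffices h : (symmetrization L).compMultilinearMap
      ((MultilinearMap.mkPiAlgebra ℝ (Fin m) (SymmetricAlgebra ℝ L)).compLinearMap fun _ =>
        SymmetricAlgebra.ι ℝ L) = symProdMultilinear L m by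
    have := congrArg (fun F => F a) h
    simpa [symProdMultilinear_apply] using this
  refine Module.Basis.ext_multilinear (fun _ => b) fun v => ?_
  rw [symProdMultilinear_apply]
  simp only [LinearMap.compMultilinearMap_apply, MultilinearMap.compLinearMap_apply,
    MultilinearMap.mkPiAlgebra_apply]
  let s : _ →₀ ℕ := ∑ i, Finsupp.single (v i) 1
  have hs : ∏ i, SymmetricAlgebra.ι ℝ L (b (v i)) = b.symmetricAlgebra s := by
    rw [Module.Basis.symmetricAlgebra, Module.Basis.map_apply, MvPolynomial.coe_basisMonomials]
    apply (SymmetricAlgebra.equivMvPolynomial b).injective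
    simp only [map_prod, SymmetricAlgebra.equivMvPolynomial_ι_apply]
    refine Eq.trans ?_ ((SymmetricAlgebra.equivMvPolynomial b).apply_symm_apply _).symm
    rw [MvPolynomial.monomial_sum_one]
    rfl
  rw [hs, symmetrization, Module.Basis.constr_basis]
  have hperm : ((Finsupp.toMultiset s).toList).Perm (List.ofFn v) := by
    rw [← Multiset.coe_eq_coe, Multiset.coe_toList]
    simp only [s, map_sum, Finsupp.toMultiset_single, one_smul]
    rw [List.ofFn_eq_map, ← Multiset.map_coe, Finset.sum_eq_multiset_sum,
      ← Multiset.sum_map_singleton (Multiset.map v _), Multiset.map_map]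
    rfl
  obtain ⟨σ, hσ⟩ := exists_equiv_of_perm hperm
  have h2 : (fun i => b ((Finsupp.toMultiset s).toList.get i)) =
      (fun i => b (v i)) ∘ (σ.trans (finCongr (List.length_ofFn))) := by
    funext i
    rw [← hσ i]
    simp
    rfl
  rw [h2]
  exact symProd_comp_equiv _ _

theorem symmetrization_listS (l : List L) : symmetrization L (listS l) = symProd l.get := by
  rw [← symmetrization_prod, ← listS_ofFn, List.ofFn_get]

theorem symmetrization_listS_sub_mem (l : List L) :
    symmetrization L (listS l) - listU l ∈ filtU L l.length := by
  have := symProd_sub_mem l.get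
  rwa [List.ofFn_get, ← symmetrization_listS] at this

theorem symmetrization_one : symmetrization L 1 = 1 := by
  have := symmetrization_listS_sub_mem ([] : List L)
  simpa [filtU, listS, listU, sub_eq_zero] using this

theorem symmetrization_mem_filtU {k : ℕ} {f : SymmetricAlgebra ℝ L} (hf : f ∈ homS L k) :
    symmetrization L f ∈ filtU L (k + 1) := by
  have h : homS L k ≤ (filtU L (k + 1)).comap (symmetrization L) := by
    refine Submodule.span_le.2 ?_
    rintro _ ⟨l, rfl, rfl⟩
    have h1 := filtU_mono (Nat.le_succ _) (symmetrization_listS_sub_mem l)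
    have h2 := add_mem h1 (listU_mem_filtU (Nat.lt_succ_self l.length))
    rwa [sub_add_cancel] at h2
  exact h hf

/-- The symmetrization map is multiplicative up to terms of lower order. -/
theorem symmetrization_mul_sub_mem {p q : ℕ} {f g : SymmetricAlgebra ℝ L} (hf : f ∈ homS L p)
    (hg : g ∈ homS L q) : symmetrization L f * symmetrization L g - symmetrization L (f * g) ∈
      filtU L (p + q) := by
  have h0 : ∀ l l' : List L, symmetrization L (listS l) * symmetrization L (listS l') -
      symmetrization L (listS l * listS l') ∈ filtU L (l.length + l'.length) := by
    intro l l'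
    have h1 := symmetrization_listS_sub_mem l
    have h2 := symmetrization_listS_sub_mem l'
    have h3 := symmetrization_listS_sub_mem (l ++ l')
    have h4 : symmetrization L (listS l') ∈ filtU L (l'.length + 1) :=
      symmetrization_mem_filtU (listS_mem_homS l')
    have h5 := mul_mem_filtU h1 h4
    have h6 := mul_mem_filtU (listU_mem_filtU (Nat.lt_succ_self l.length)) h2
    rw [List.length_append, listS_append, listU_append] at h3
    have e : symmetrization L (listS l) * symmetrization L (listS l') -
        symmetrization L (listS l * listS l') =
        (symmetrization L (listS l) - listU l) * symmetrization L (listS l') +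
        listU l * (symmetrization L (listS l') - listU l') -
        (symmetrization L (listS l * listS l') - listU l * listU l') := by noncomm_ring
    rw [e]
    refine sub_mem (add_mem (filtU_mono (by omega) h5) (filtU_mono (by omega) h6)) h3
  induction hf using Submodule.span_induction with
  | zero => simp
  | add f f' _ _ hf hf' =>
    rw [map_add, add_mul, add_mul, map_add, add_sub_add_comm]
    exact add_mem hf hf'
  | smul c f _ hf =>
    rw [map_smul, smul_mul_assoc, smul_mul_assoc, map_smul, ← smul_sub]
    exact Submodule.smul_mem _ _ hf
  | mem f hf =>
    obtain ⟨l, rfl, rfl⟩ := hf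
    induction hg using Submodule.span_induction with
    | zero => simp
    | add f f' _ _ hf hf' =>
      rw [map_add, mul_add, mul_add, map_add, add_sub_add_comm]
      exact add_mem hf hf'
    | smul c f _ hf =>
      rw [map_smul, mul_smul_comm, mul_smul_comm, map_smul, ← smul_sub]
      exact Submodule.smul_mem _ _ hf
    | mem g hg =>
      obtain ⟨l', rfl, rfl⟩ := hg
      exact h0 l l'

/-- A word differs from the symmetrization of its commutative image by shorter words, so induction
on length applies. -/
theorem symmetrization_surjective : Function.Surjective (symmetrization L) := by
  have h : ∀ k, filtU L k ≤ LinearMap.range (symmetrization L) := by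
    intro k
    induction k with
    | zero => simp [filtU]
    | succ k ih =>
      refine Submodule.span_le.2 ?_
      rintro _ ⟨l, hl, rfl⟩
      have h1 := filtU_mono (Nat.lt_succ_iff.1 hl) (symmetrization_listS_sub_mem l)
      have h2 := sub_mem (LinearMap.mem_range_self (symmetrization L) (listS l)) (ih h1)
      rwa [sub_sub_cancel] at h2
  intro u
  obtain ⟨k, hk⟩ := exists_mem_filtU u
  exact h k hk

/-- The symmetrization map commutes with homomorphisms of Lie algebras. -/
theorem symmetrization_lift {L' : Type*} [LieRing L'] [LieAlgebra ℝ L'] (φ : L →ₗ⁅ℝ⁆ L')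
    (f : SymmetricAlgebra ℝ L) :
    UniversalEnvelopingAlgebra.lift ℝ ((UniversalEnvelopingAlgebra.ι ℝ).comp φ)
      (symmetrization L f) = symmetrization L'
        (SymmetricAlgebra.lift (SymmetricAlgebra.ι ℝ L' ∘ₗ (φ : L →ₗ[ℝ] L')) f) := by
  have hf : f ∈ Submodule.span ℝ (Set.range (listS : List L → _)) := by
    rw [span_listS]
    trivial
  induction hf using Submodule.span_induction with
  | zero => simp
  | add f g _ _ hf hg => simp only [map_add, hf, hg]
  | smul c f _ hf => simp only [map_smul, hf]
  | mem f hf =>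
    obtain ⟨l, rfl⟩ := hf
    rw [symmetrization_listS]
    have h : SymmetricAlgebra.lift (SymmetricAlgebra.ι ℝ L' ∘ₗ (φ : L →ₗ[ℝ] L')) (listS l) =
        ∏ i, SymmetricAlgebra.ι ℝ L' (φ (l.get i)) := by
      conv_lhs => rw [← List.ofFn_get l, listS_ofFn, map_prod]
      simp
    rw [h, symmetrization_prod]
    simp only [symProd, map_smul, map_sum, map_list_prod, List.map_ofFn, Function.comp_def,
      UniversalEnvelopingAlgebra.lift_ι_apply]
    rfl

end Symmetrization

/-! ### Injectivity of symmetrization through left-invariant vector fields. -/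

section PBW

open MvPolynomial (aeval)

variable {n : ℕ}

/-- The polynomial functions on square matrices of size `n + 2`. -/
abbrev PolyMat (n : ℕ) : Type := MvPolynomial ((Fin n ⊕ Fin 2) × (Fin n ⊕ Fin 2)) ℝ

/-- The left-invariant vector field `Z ↦ Z B` as a derivation. -/
def vectorField (B : Mat n) : Derivation ℝ (PolyMat n) (PolyMat n) :=
  MvPolynomial.mkDerivation ℝ fun p => ∑ k, MvPolynomial.C (B k p.2) * MvPolynomial.X (p.1, k)

theorem vectorField_X (B : Mat n) (i j : Fin n ⊕ Fin 2) :
    vectorField B (MvPolynomial.X (i, j)) =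
      ∑ k, MvPolynomial.C (B k j) * MvPolynomial.X (i, k) :=
  MvPolynomial.mkDerivation_X _ _ _

theorem vectorField_vectorField_X (B B' : Mat n) (i j : Fin n ⊕ Fin 2) :
    vectorField B (vectorField B' (MvPolynomial.X (i, j))) =
      ∑ k, MvPolynomial.C ((B * B') k j) * MvPolynomial.X (i, k) := by
  rw [vectorField_X, map_sum]
  have h : ∀ k, vectorField B (MvPolynomial.C (B' k j) * MvPolynomial.X (i, k)) =
      ∑ l, MvPolynomial.C (B l k * B' k j) * MvPolynomial.X (i, l) := by
    intro k
    rw [← MvPolynomial.smul_eq_C_mul, Derivation.map_smul, vectorField_X, Finset.smul_sum]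
    refine Finset.sum_congr rfl fun l _ => ?_
    rw [MvPolynomial.smul_eq_C_mul, map_mul]
    ring
  simp_rw [h]
  rw [Finset.sum_comm]
  refine Finset.sum_congr rfl fun l _ => ?_
  rw [mul_apply, map_sum, Finset.sum_mul]

/-- The action of the Lie algebra on polynomial functions by left-invariant vector fields. -/
def vectorFieldHom (n : ℕ) : gal n →ₗ⁅ℝ⁆ Module.End ℝ (PolyMat n) where
  toFun B := (vectorField (B : Mat n) : PolyMat n →ₗ[ℝ] PolyMat n)
  map_add' B B' := by
    have h : vectorField ((B + B' : gal n) : Mat n) = vectorField (B : Mat n) +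
        vectorField (B' : Mat n) := by
      refine MvPolynomial.derivation_ext fun ⟨i, j⟩ => ?_
      rw [Derivation.add_apply, vectorField_X, vectorField_X, vectorField_X,
        ← Finset.sum_add_distrib]
      refine Finset.sum_congr rfl fun k _ => ?_
      have : ((B + B' : gal n) : Mat n) k j = (B : Mat n) k j + (B' : Mat n) k j := rfl
      rw [this, map_add, add_mul]
    rw [h]
    rfl
  map_smul' c B := by
    have h : vectorField ((c • B : gal n) : Mat n) = c • vectorField (B : Mat n) := by
      refine MvPolynomial.derivation_ext fun ⟨i, j⟩ => ?_
      rw [Derivation.smul_apply, vectorField_X, vectorField_X, Finset.smul_sum]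
      refine Finset.sum_congr rfl fun k _ => ?_
      have : ((c • B : gal n) : Mat n) k j = c * (B : Mat n) k j := rfl
      rw [this, map_mul, MvPolynomial.smul_eq_C_mul, mul_assoc]
    rw [h]
    rfl
  map_lie' {B B'} := by
    have h : vectorField ((⁅B, B'⁆ : gal n) : Mat n) =
        ⁅vectorField (B : Mat n), vectorField (B' : Mat n)⁆ := by
      refine MvPolynomial.derivation_ext fun ⟨i, j⟩ => ?_
      rw [Derivation.commutator_apply, vectorField_vectorField_X, vectorField_vectorField_X,
        vectorField_X, ← Finset.sum_sub_distrib]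
      refine Finset.sum_congr rfl fun k _ => ?_
      rw [← sub_mul, ← map_sub, LieSubalgebra.coe_bracket, Ring.lie_def, Matrix.sub_apply]
    rw [h]
    rfl

/-- Evaluation of polynomial functions at the identity matrix. -/
def evalOne (n : ℕ) : PolyMat n →ₐ[ℝ] ℝ := aeval fun p => (1 : Mat n) p.1 p.2

/-- The ideal of polynomial functions that vanish at the identity matrix. -/
def idealOne (n : ℕ) : Ideal (PolyMat n) := RingHom.ker (evalOne n)

theorem mem_idealOne {p : PolyMat n} : p ∈ idealOne n ↔ evalOne n p = 0 := RingHom.mem_ker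

theorem derivation_mem_pow {A : Type*} [CommRing A] [Algebra ℝ A] (D : Derivation ℝ A A)
    (I : Ideal A) (k : ℕ) {p : A} (hp : p ∈ I ^ (k + 1)) : D p ∈ I ^ k := by
  induction k generalizing p with
  | zero => simp
  | succ k ih =>
    rw [pow_succ'] at hp
    induction hp using Submodule.mul_induction_on' with
    | mem_mul_mem a ha b hb =>
      rw [D.leibniz, smul_eq_mul, smul_eq_mul]
      refine add_mem ?_ (Ideal.mul_mem_right _ _ hb)
      rw [pow_succ']
      exact Ideal.mul_mem_mul ha (ih hb)
    | add a _ b _ ha hb =>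
      rw [map_add]
      exact add_mem ha hb

/-- The affine function `Z ↦ tr(Aᵀ (Z - 1))`. -/
def affineOf (A : Mat n) : PolyMat n :=
  ∑ i, ∑ j, MvPolynomial.C (A i j) * (MvPolynomial.X (i, j) - MvPolynomial.C ((1 : Mat n) i j))

theorem affineOf_mem (A : Mat n) : affineOf A ∈ idealOne n := by
  rw [mem_idealOne]
  simp [affineOf, evalOne]

theorem vectorField_affineOf (A : Mat n) (B : gal n) :
    vectorField (B : Mat n) (affineOf A) - MvPolynomial.C (dualOf A B) ∈ idealOne n := by
  rw [mem_idealOne, map_sub, sub_eq_zero]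
  have h : vectorField (B : Mat n) (affineOf A) = ∑ i, ∑ j, MvPolynomial.C (A i j) *
      ∑ k, MvPolynomial.C ((B : Mat n) k j) * MvPolynomial.X (i, k) := by
    simp only [affineOf, map_sum]
    refine Finset.sum_congr rfl fun i _ => Finset.sum_congr rfl fun j _ => ?_
    rw [← MvPolynomial.smul_eq_C_mul, Derivation.map_smul, map_sub, vectorField_X,
      MvPolynomial.derivation_C, sub_zero, MvPolynomial.smul_eq_C_mul]
  rw [h]
  simp only [evalOne, map_sum, map_mul, MvPolynomial.aeval_X, MvPolynomial.algHom_C, dualOf,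
    LinearMap.coe_mk, AddHom.coe_mk, trace, diag_apply, mul_apply, transpose_apply,
    one_apply, mul_ite, mul_one, mul_zero, Finset.sum_ite_eq, Finset.mem_univ, if_true,
    Algebra.algebraMap_self, RingHom.id_apply]
  rw [Finset.sum_comm]

/-- The action of the enveloping algebra on polynomial functions. -/
def actU (n : ℕ) : U n →ₐ[ℝ] Module.End ℝ (PolyMat n) :=
  UniversalEnvelopingAlgebra.lift ℝ (vectorFieldHom n)

/-- Modulo higher vanishing order at the identity, each vector field removes one factor of `affineOf
A ^ m`, contributing the value of A* and the current exponent. At the identity, words shorter than m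
therefore give 0, and words of length m give m! times the value of their symbol at A*. -/
theorem actU_listU_sub_mem (A : Mat n) (m : ℕ) (l : List (gal n)) (hl : l.length ≤ m) :
    actU n (listU l) (affineOf A ^ m) - MvPolynomial.C ((m.descFactorial l.length : ℝ) *
      (l.map (dualOf A)).prod) * affineOf A ^ (m - l.length) ∈
      idealOne n ^ (m - l.length + 1) := by
  induction l with
  | nil => simp [listU]
  | cons B l ih =>
    rw [List.length_cons] at hl
    obtain ⟨j, hj⟩ : ∃ j, m - l.length = j + 1 := ⟨m - l.length - 1, by omega⟩
    have hj' : m - (B :: l).length = j := by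
      rw [List.length_cons]
      omega
    have h1 := ih (by omega)
    rw [hj] at h1
    have h2 := derivation_mem_pow (vectorField (B : Mat n)) _ _ h1
    have e1 : actU n (listU (B :: l)) (affineOf A ^ m) =
        vectorField (B : Mat n) (actU n (listU l) (affineOf A ^ m)) := by
      rw [listU_cons, map_mul]
      change actU n (UniversalEnvelopingAlgebra.ι ℝ B) (actU n (listU l) (affineOf A ^ m)) = _
      rw [actU, UniversalEnvelopingAlgebra.lift_ι_apply]
      rfl
    have h3 : MvPolynomial.C ((m.descFactorial (l.length + 1) : ℝ) * (l.map (dualOf A)).prod) *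
        affineOf A ^ j * (vectorField (B : Mat n) (affineOf A) - MvPolynomial.C (dualOf A B)) ∈
          idealOne n ^ (j + 1) := by
      rw [pow_succ]
      exact Ideal.mul_mem_mul (Ideal.mul_mem_left _ _ (Ideal.pow_mem_pow (affineOf_mem A) j))
        (vectorField_affineOf A B)
    have h4 := add_mem h2 h3
    rw [e1, hj']
    convert h4 using 1
    have hC : ∀ (c : ℝ) (p : PolyMat n), vectorField (B : Mat n) (MvPolynomial.C c * p) =
        MvPolynomial.C c * vectorField (B : Mat n) p := fun c p => by
      rw [← MvPolynomial.smul_eq_C_mul, Derivation.map_smul, MvPolynomial.smul_eq_C_mul]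
    rw [map_sub, hC, Derivation.leibniz_pow, List.length_cons, Nat.descFactorial_succ, hj]
    simp only [Nat.add_sub_cancel, List.map_cons, List.prod_cons, map_mul,
      Nat.cast_mul, smul_eq_mul, nsmul_eq_mul, map_natCast]
    ring

theorem evalOne_actU_of_mem_filtU (A : Mat n) {m : ℕ} {u : U n} (hu : u ∈ filtU (gal n) m) :
    evalOne n (actU n u (affineOf A ^ m)) = 0 := by
  induction hu using Submodule.span_induction with
  | zero => simp
  | add u v _ _ hu hv => rw [map_add, LinearMap.add_apply, map_add, hu, hv, add_zero]
  | smul c u _ hu => rw [map_smul, LinearMap.smul_apply, map_smul, hu, smul_zero]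
  | mem u hu =>
    obtain ⟨l, hl, rfl⟩ := hu
    have hl' : l.length < m := hl
    have h1 := actU_listU_sub_mem A m l hl'.le
    have h2 : affineOf A ^ (m - l.length) ∈ idealOne n :=
      Ideal.pow_mem_of_mem _ (affineOf_mem A) _ (by omega)
    have h3 := Ideal.pow_le_self (by omega) h1
    have h4 := add_mem h3 (Ideal.mul_mem_left _ (MvPolynomial.C
      ((m.descFactorial l.length : ℝ) * (l.map (dualOf A)).prod)) h2)
    rw [sub_add_cancel] at h4
    exact mem_idealOne.1 h4

theorem evalOne_actU_symmetrization (A : Mat n) {m : ℕ} {f : S n} (hf : f ∈ homS (gal n) m) :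
    evalOne n (actU n (symmetrization (gal n) f) (affineOf A ^ m)) =
      m.factorial * evalAt A f := by
  induction hf using Submodule.span_induction with
  | zero => simp
  | add u v _ _ hu hv =>
    rw [map_add, map_add, LinearMap.add_apply, map_add, hu, hv, map_add, mul_add]
  | smul c u _ hu =>
    rw [map_smul, map_smul, LinearMap.smul_apply, map_smul, hu, map_smul, mul_smul_comm]
  | mem u hu =>
    obtain ⟨l, rfl, rfl⟩ := hu
    have h1 := evalOne_actU_of_mem_filtU A (symmetrization_listS_sub_mem l)
    rw [map_sub, LinearMap.sub_apply, map_sub, sub_eq_zero] at h1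
    have h2 := actU_listU_sub_mem A l.length l le_rfl
    have h3 := mem_idealOne.1 (Ideal.pow_le_self (by omega) h2)
    rw [Nat.sub_self, pow_zero, mul_one, map_sub, sub_eq_zero] at h3
    rw [h1, h3, Nat.descFactorial_self, evalAt, listS, map_list_prod, List.map_map]
    simp only [evalOne, MvPolynomial.algHom_C, Algebra.algebraMap_self, RingHom.id_apply]
    congr 3
    funext B
    exact (SymmetricAlgebra.lift_ι_apply _ _).symm

/-- The symmetrization map is injective on symbols. -/
theorem eq_zero_of_symmetrization_mem_filtU {m : ℕ} {f : S n} (hf : f ∈ homS (gal n) m)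
    (h : symmetrization (gal n) f ∈ filtU (gal n) m) : f = 0 := by
  refine eq_zero_of_evalR_eq_zero fun K' W t hK => ?_
  have h1 := evalOne_actU_symmetrization (algMat K' W t) hf
  rw [evalOne_actU_of_mem_filtU _ h, evalAt_algMat hK] at h1
  exact (mul_eq_zero.1 h1.symm).resolve_left (Nat.cast_ne_zero.2 m.factorial_ne_zero)

/-- The top homogeneous part of a kernel element has symmetrization of lower order, hence is zero;
descend in degree. -/
theorem symmetrization_injective : Function.Injective (symmetrization (gal n)) := by
  rw [← LinearMap.ker_eq_bot, LinearMap.ker_eq_bot']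
  have key : ∀ m (f : S n), f ∈ Submodule.span ℝ (listS '' {l : List (gal n) | l.length < m}) →
      symmetrization (gal n) f = 0 → f = 0 := by
    intro m
    induction m with
    | zero => simp
    | succ m ih =>
      intro f hf h0
      have hset : {l : List (gal n) | l.length < m + 1} =
          {l : List (gal n) | l.length < m} ∪ {l : List (gal n) | l.length = m} := by
        ext l
        simp only [Set.mem_union, Set.mem_ofPred_eq]
        omega
      rw [hset, Set.image_union, Submodule.span_union, Submodule.mem_sup] at hf
      obtain ⟨g, hg, g', hg', rfl⟩ := hf
      have hlow : symmetrization (gal n) g ∈ filtU (gal n) m := by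
        clear h0
        induction hg using Submodule.span_induction with
        | zero => simp
        | add u v _ _ hu hv => rw [map_add]; exact add_mem hu hv
        | smul c u _ hu => rw [map_smul]; exact Submodule.smul_mem _ _ hu
        | mem u hu =>
          obtain ⟨l, hl, rfl⟩ := hu
          exact filtU_mono hl (symmetrization_mem_filtU (listS_mem_homS l))
      have hg'0 : g' = 0 := by
        refine eq_zero_of_symmetrization_mem_filtU hg' ?_
        rw [map_add, add_eq_zero_iff_neg_eq] at h0
        rw [← h0]
        exact neg_mem hlow
      rw [hg'0, add_zero] at h0 ⊢
      exact ih g hg h0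
  intro f hf
  have h : f ∈ Submodule.span ℝ (Set.range (listS : List (gal n) → _)) := by
    rw [span_listS]
    trivial
  have h2 : ∃ m, f ∈ Submodule.span ℝ (listS '' {l : List (gal n) | l.length < m}) := by
    clear hf
    induction h using Submodule.span_induction with
    | mem u hu =>
      obtain ⟨l, rfl⟩ := hu
      exact ⟨l.length + 1, Submodule.subset_span ⟨l, Nat.lt_succ_self _, rfl⟩⟩
    | zero => exact ⟨0, zero_mem _⟩
    | add u v _ _ hu hv =>
      obtain ⟨k, hk⟩ := hu
      obtain ⟨k', hk'⟩ := hv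
      refine ⟨max k k', add_mem (Submodule.span_mono (Set.image_mono fun l hl => ?_) hk)
        (Submodule.span_mono (Set.image_mono fun l hl => ?_) hk')⟩
      · exact lt_of_lt_of_le (show l.length < k from hl) (le_max_left _ _)
      · exact lt_of_lt_of_le (show l.length < k' from hl) (le_max_right _ _)
    | smul c u _ hu =>
      obtain ⟨k, hk⟩ := hu
      exact ⟨k, Submodule.smul_mem _ _ hk⟩
  obtain ⟨m, hm⟩ := h2
  exact key m f hm hf

theorem AdU_symmetrization (g : Gal n) (f : S n) :
    AdU n g (symmetrization (gal n) f) = symmetrization (gal n) (AdS n g f) :=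
  symmetrization_lift (Ad n g) f

theorem symmetrization_mem_invariantsU {f : S n} :
    symmetrization (gal n) f ∈ invariantsU n ↔ f ∈ invariantsS n := by
  rw [mem_invariantsU, mem_invariantsS]
  refine forall_congr' fun g => ?_
  rw [AdU_symmetrization, symmetrization_injective.eq_iff]

end PBW

/-! ### Lifting generators and relations from S to U. -/

section Symbols

open MvPolynomial (aeval)

variable {n N : ℕ}

theorem mul_sub_mem_filtU {L : Type*} [LieRing L] [LieAlgebra ℝ L] {p q : ℕ}
    {f g : SymmetricAlgebra ℝ L} {u v : UniversalEnvelopingAlgebra ℝ L}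
    (hf : f ∈ homS L p) (hg : g ∈ homS L q) (hu : u - symmetrization L f ∈ filtU L p)
    (hv : v - symmetrization L g ∈ filtU L q) :
    u * v - symmetrization L (f * g) ∈ filtU L (p + q) := by
  have hv' : v ∈ filtU L (q + 1) := by
    have := add_mem (filtU_mono (Nat.le_succ q) hv) (symmetrization_mem_filtU hg)
    rwa [sub_add_cancel] at this
  have e : u * v - symmetrization L (f * g) = (u - symmetrization L f) * v +
      symmetrization L f * (v - symmetrization L g) +
      (symmetrization L f * symmetrization L g - symmetrization L (f * g)) := by noncomm_ring
  rw [e]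
  exact add_mem (add_mem (filtU_mono (by omega) (mul_mem_filtU hu hv'))
    (filtU_mono (by omega) (mul_mem_filtU (symmetrization_mem_filtU hf) hv)))
    (symmetrization_mul_sub_mem hf hg)

variable {q : Fin N → S n} {w : Fin N → ℕ} {z : Fin N → Subalgebra.center ℝ (U n)}

theorem symbol_prod_pow (hq : ∀ i, q i ∈ homS (gal n) (w i))
    (hz : ∀ i, (z i : U n) = symmetrization (gal n) (q i)) (s : Fin N → ℕ) (T : Finset (Fin N)) :
    ∏ i ∈ T, q i ^ s i ∈ homS (gal n) (∑ i ∈ T, s i * w i) ∧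
      ((∏ i ∈ T, z i ^ s i : Subalgebra.center ℝ (U n)) : U n) -
        symmetrization (gal n) (∏ i ∈ T, q i ^ s i) ∈ filtU (gal n) (∑ i ∈ T, s i * w i) := by
  have hpow : ∀ i k, ((z i ^ k : Subalgebra.center ℝ (U n)) : U n) -
      symmetrization (gal n) (q i ^ k) ∈ filtU (gal n) (k * w i) := by
    intro i k
    induction k with
    | zero => simp [symmetrization_one]
    | succ k ih =>
      rw [pow_succ, pow_succ, Nat.succ_mul, Subalgebra.coe_mul]
      exact mul_sub_mem_filtU (pow_mem_homS (hq i) k) (hq i) ih (by simp [hz])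
  induction T using Finset.induction_on with
  | empty => simpa [symmetrization_one] using one_mem_homS
  | insert i T hi ih =>
    rw [Finset.prod_insert hi, Finset.prod_insert hi, Finset.sum_insert hi, Subalgebra.coe_mul]
    exact ⟨mul_mem_homS (pow_mem_homS (hq i) _) ih.1,
      mul_sub_mem_filtU (pow_mem_homS (hq i) _) ih.1 (hpow i _) ih.2⟩

/-- The weight of a monomial. -/
def weight (w : Fin N → ℕ) (s : Fin N →₀ ℕ) : ℕ := ∑ i, s i * w i

theorem aeval_monomial_eq {A : Type*} [CommRing A] [Algebra ℝ A] (x : Fin N → A)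
    (s : Fin N →₀ ℕ) (c : ℝ) : aeval x (MvPolynomial.monomial s c) = c • ∏ i, x i ^ s i := by
  rw [MvPolynomial.aeval_monomial, Algebra.smul_def, Finsupp.prod_fintype _ _ (by simp)]

theorem aeval_monomial_mem_homS (hq : ∀ i, q i ∈ homS (gal n) (w i))
    (hz : ∀ i, (z i : U n) = symmetrization (gal n) (q i)) (s : Fin N →₀ ℕ) (c : ℝ) :
    aeval q (MvPolynomial.monomial s c) ∈ homS (gal n) (weight w s) := by
  rw [aeval_monomial_eq]
  exact Submodule.smul_mem _ _ (symbol_prod_pow hq hz s Finset.univ).1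

theorem aeval_sub_symmetrization_mem (hq : ∀ i, q i ∈ homS (gal n) (w i))
    (hz : ∀ i, (z i : U n) = symmetrization (gal n) (q i)) {P : MvPolynomial (Fin N) ℝ} {k : ℕ}
    (hP : ∀ s ∈ P.support, weight w s ≤ k) :
    ((aeval z P : Subalgebra.center ℝ (U n)) : U n) - symmetrization (gal n) (aeval q P) ∈
      filtU (gal n) k := by
  rw [P.as_sum, map_sum, map_sum, map_sum, AddSubmonoidClass.coe_finsetSum,
    ← Finset.sum_sub_distrib]
  refine Submodule.sum_mem _ fun s hs => filtU_mono (hP s hs) ?_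
  rw [aeval_monomial_eq, aeval_monomial_eq, map_smul]
  have h := Submodule.smul_mem _ (P.coeff s) (symbol_prod_pow hq hz s Finset.univ).2
  rw [smul_sub] at h
  exact h

/-- No cancellation of leading terms is possible: the part of P of largest weight gives a
homogeneous symbol, whose vanishing would be a relation among the independent `q i`. -/
theorem weight_lt_of_mem_filtU (hq : ∀ i, q i ∈ homS (gal n) (w i))
    (hz : ∀ i, (z i : U n) = symmetrization (gal n) (q i)) (hind : AlgebraicIndependent ℝ q)
    {P : MvPolynomial (Fin N) ℝ} {k : ℕ}
    (hP : symmetrization (gal n) (aeval q P) ∈ filtU (gal n) k) :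
    ∀ s ∈ P.support, weight w s < k := by
  intro s hs
  by_contra! hk
  obtain ⟨s₀, hs₀, hmax⟩ := P.support.exists_max_image (weight w) ⟨s, hs⟩
  have hk₀ : k ≤ weight w s₀ := hk.trans (hmax s hs)
  set T : MvPolynomial (Fin N) ℝ := ∑ s ∈ P.support with weight w s = weight w s₀,
    MvPolynomial.monomial s (P.coeff s) with hT
  have hsplit : P = T + ∑ s ∈ P.support with ¬weight w s = weight w s₀,
      MvPolynomial.monomial s (P.coeff s) := by
    rw [hT, Finset.sum_filter_add_sum_filter_not]
    exact P.as_sum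
  have hT1 : aeval q T ∈ homS (gal n) (weight w s₀) := by
    rw [hT, map_sum]
    refine Submodule.sum_mem _ fun s hs => ?_
    rw [← (Finset.mem_filter.1 hs).2]
    exact aeval_monomial_mem_homS hq hz _ _
  have hT2 : symmetrization (gal n) (aeval q T) ∈ filtU (gal n) (weight w s₀) := by
    have h1 := filtU_mono hk₀ hP
    have h2 : symmetrization (gal n) (aeval q (∑ s ∈ P.support with
        ¬weight w s = weight w s₀, MvPolynomial.monomial s (P.coeff s))) ∈
        filtU (gal n) (weight w s₀) := by
      rw [map_sum, map_sum]
      refine Submodule.sum_mem _ fun s hs => ?_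
      obtain ⟨hs1, hs2⟩ := Finset.mem_filter.1 hs
      exact filtU_mono (Nat.succ_le_of_lt (lt_of_le_of_ne (hmax s hs1) hs2))
        (symmetrization_mem_filtU (aeval_monomial_mem_homS hq hz _ _))
    have h3 := sub_mem h1 h2
    rw [← map_sub, ← map_sub] at h3
    rw [eq_sub_of_add_eq hsplit.symm]
    exact h3
  have hT3 : T = 0 := hind.eq_zero_of_aeval_eq_zero T
    (eq_zero_of_symmetrization_mem_filtU hT1 hT2)
  have hc : T.coeff s₀ = P.coeff s₀ := by
    rw [hT, MvPolynomial.coeff_sum]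
    simp only [MvPolynomial.coeff_monomial]
    rw [Finset.sum_ite_eq', if_pos (by exact Finset.mem_filter.2 ⟨hs₀, rfl⟩)]
  rw [hT3, MvPolynomial.coeff_zero] at hc
  exact MvPolynomial.mem_support_iff.1 hs₀ hc.symm

/-- If P(z) = 0, then P(q) has symmetrization of order below the weight of P, against
`weight_lt_of_mem_filtU`. -/
theorem algebraicIndependent_of_symbols (hq : ∀ i, q i ∈ homS (gal n) (w i))
    (hz : ∀ i, (z i : U n) = symmetrization (gal n) (q i)) (hind : AlgebraicIndependent ℝ q) :
    AlgebraicIndependent ℝ z := by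
  rw [algebraicIndependent_iff]
  intro P hP
  by_contra h0
  obtain ⟨s₀, hs₀, hmax⟩ := P.support.exists_max_image (weight w)
    (MvPolynomial.support_nonempty.2 h0)
  have h1 := aeval_sub_symmetrization_mem hq hz (k := weight w s₀) hmax
  rw [hP, ZeroMemClass.coe_zero, zero_sub, Submodule.neg_mem_iff] at h1
  exact lt_irrefl _ (weight_lt_of_mem_filtU hq hz hind h1 s₀ hs₀)

theorem adjoin_map_eq_invariantsU (hq : ∀ i, q i ∈ homS (gal n) (w i))
    (hz : ∀ i, (z i : U n) = symmetrization (gal n) (q i)) (hind : AlgebraicIndependent ℝ q)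
    (hgen : Algebra.adjoin ℝ (Set.range q) = invariantsS n) :
    (Algebra.adjoin ℝ (Set.range z)).map (Subalgebra.center ℝ (U n)).val = invariantsU n := by
  rw [Algebra.adjoin_range_eq_range_aeval] at hgen ⊢
  have hqinv : ∀ P, aeval q P ∈ invariantsS n := fun P => by rw [← hgen]; exact ⟨P, rfl⟩
  have hzinv : ∀ P : MvPolynomial (Fin N) ℝ, ((aeval z P : Subalgebra.center ℝ (U n)) : U n) ∈ invariantsU n := by
    intro P
    have hr : ∀ i, (z i : U n) ∈ invariantsU n := by
      intro i
      rw [hz, symmetrization_mem_invariantsU, ← hgen]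
      exact ⟨MvPolynomial.X i, MvPolynomial.aeval_X _ _⟩
    induction P using MvPolynomial.induction_on with
    | C r =>
      rw [MvPolynomial.algHom_C]
      exact Subalgebra.algebraMap_mem _ _
    | add P Q hP hQ =>
      rw [map_add]
      exact add_mem hP hQ
    | mul_X P i hP =>
      rw [map_mul, MvPolynomial.aeval_X]
      exact mul_mem hP (hr i)
  apply le_antisymm
  · rintro _ ⟨_, ⟨P, rfl⟩, rfl⟩
    exact hzinv P
  have key : ∀ (k : ℕ) (P : MvPolynomial (Fin N) ℝ), (∀ s ∈ P.support, weight w s < k) → symmetrization (gal n) (aeval q P) ∈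
      (aeval z : MvPolynomial (Fin N) ℝ →ₐ[ℝ] _).range.map (Subalgebra.center ℝ (U n)).val := by
    intro k
    induction k with
    | zero =>
      intro P hP
      have : P = 0 := by
        rw [← MvPolynomial.support_eq_empty, Finset.eq_empty_iff_forall_notMem]
        exact fun s hs => absurd (hP s hs) (Nat.not_lt_zero _)
      rw [this, map_zero, map_zero]
      exact zero_mem _
    | succ k ih =>
      intro P hP
      have h1 := aeval_sub_symmetrization_mem hq hz (P := P) (k := k)
        fun s hs => Nat.lt_succ_iff.1 (hP s hs)
      -- The error P(z) - λ(P(q)) is again invariant and of lower order, so it is λ(P'(q)) with P'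
      -- of smaller weight, to which the induction applies.
      obtain ⟨f, hf⟩ := symmetrization_surjective
        (((aeval z P : Subalgebra.center ℝ (U n)) : U n) - symmetrization (gal n) (aeval q P))
      have hfinv : f ∈ invariantsS n := by
        rw [← symmetrization_mem_invariantsU, hf]
        exact sub_mem (hzinv P) (symmetrization_mem_invariantsU.2 (hqinv P))
      rw [← hgen] at hfinv
      obtain ⟨P', rfl⟩ := hfinv
      rw [← hf] at h1
      have h2 := ih P' (weight_lt_of_mem_filtU hq hz hind h1)
      have h3 : ((aeval z P : Subalgebra.center ℝ (U n)) : U n) ∈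
          (aeval z : MvPolynomial (Fin N) ℝ →ₐ[ℝ] _).range.map
            (Subalgebra.center ℝ (U n)).val := ⟨_, ⟨P, rfl⟩, rfl⟩
      have h4 := sub_mem h3 h2
      have h5 : symmetrization (gal n) (aeval q P') = _ := hf
      rwa [h5, sub_sub_cancel] at h4
  intro u hu
  obtain ⟨f, rfl⟩ := symmetrization_surjective u
  have hf := symmetrization_mem_invariantsU.1 hu
  rw [← hgen] at hf
  obtain ⟨P, rfl⟩ := hf
  exact key (P.support.sup (weight w) + 1) P
    fun s hs => Nat.lt_succ_iff.2 (Finset.le_sup (f := weight w) hs)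

theorem X_sq_mem_homS (j : Fin n) : (X j ^ 2 : S n) ∈ homS (gal n) 2 := by
  have h := pow_mem_homS (ι_mem_homS (eltC j 1)) 2
  rw [mul_one] at h
  exact h

theorem V_sq_mem_homS (j : Fin n) : (V j ^ 2 : S n) ∈ homS (gal n) 2 := by
  have h := pow_mem_homS (ι_mem_homS (eltC j 0)) 2
  rw [mul_one] at h
  exact h

theorem X_mul_V_mem_homS (j : Fin n) : (X j * V j : S n) ∈ homS (gal n) 2 := by
  have h := mul_mem_homS (ι_mem_homS (eltC j 1)) (ι_mem_homS (eltC j 0))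
  rw [one_add_one_eq_two] at h
  exact h

theorem Q1_mem_homS : Q1 n ∈ homS (gal n) 2 :=
  Submodule.sum_mem _ fun j _ => X_sq_mem_homS j

theorem Q2_mem_homS : Q2 n ∈ homS (gal n) 4 := by
  have h1 : (∑ i, X i ^ 2 : S n) ∈ homS (gal n) 2 := Q1_mem_homS
  have h2 : (∑ i, V i ^ 2 : S n) ∈ homS (gal n) 2 := Submodule.sum_mem _ fun j _ => V_sq_mem_homS j
  have h3 : (∑ i, X i * V i : S n) ∈ homS (gal n) 2 :=
    Submodule.sum_mem _ fun j _ => X_mul_V_mem_homS j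
  have h4 := sub_mem (mul_mem_homS h1 h2) (mul_mem_homS h3 h3)
  rw [← sq] at h4
  exact h4

theorem skewMat_mem_homS (a b : Fin n ⊕ Fin 2) : skewMat n a b ∈ homS (gal n) 1 := by
  rcases a with a | a <;> rcases b with b | b
  · exact ι_mem_homS (eltK a b)
  · fin_cases b
    exacts [ι_mem_homS (eltC a 0), ι_mem_homS (eltC a 1)]
  · fin_cases a
    exacts [neg_mem (ι_mem_homS (eltC b 0)), neg_mem (ι_mem_homS (eltC b 1))]
  · exact zero_mem _

theorem prod_mem_homS {ι : Type*} (T : Finset ι) {f : ι → S n} (hf : ∀ j, f j ∈ homS (gal n) 1) :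
    ∏ j ∈ T, f j ∈ homS (gal n) T.card := by
  classical
  induction T using Finset.induction_on with
  | empty => simpa using one_mem_homS
  | insert j T hj ih =>
    rw [Finset.prod_insert hj, Finset.card_insert_of_notMem hj, add_comm]
    exact mul_mem_homS (hf j) ih

theorem minorSum_mem_homS (m : ℕ) : minorSum n m ∈ homS (gal n) m := by
  refine Submodule.sum_mem _ fun s hs => ?_
  have hs' : s.card = m := (Finset.mem_powersetCard.1 (Finset.mem_filter.1 hs).1).2
  rw [det_apply']
  refine Submodule.sum_mem _ fun σ _ => ?_
  have h := prod_mem_homS Finset.univ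
    (f := fun j : s => (skewMat n).submatrix ((↑) : s → Fin n ⊕ Fin 2) (↑) (σ j) j)
    fun j => skewMat_mem_homS _ _
  rw [Finset.card_univ, Fintype.card_coe, hs'] at h
  rcases Int.units_eq_one_or (Equiv.Perm.sign σ) with hσ | hσ <;> rw [hσ]
  · rw [Units.val_one, Int.cast_one, one_mul]
    exact h
  · rw [Units.val_neg, Units.val_one, Int.cast_neg, Int.cast_one, neg_one_mul]
    exact neg_mem h

theorem gen_mem_homS (i : Fin (n / 2 + 1)) : gen n i ∈ homS (gal n) (2 * (i + 1)) := by
  rw [gen]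
  split_ifs with h0 h1
  · rw [h0]
    exact Q1_mem_homS
  · rw [h1]
    exact Q2_mem_homS
  · exact minorSum_mem_homS _

end Symbols

/-! ### The adjoint derivations and their compatibility with symmetrization. -/

section AdjointAction

variable {L : Type*} [LieRing L] [LieAlgebra ℝ L]

/-- The algebra homomorphism `f ↦ f + ε ad(B) f` on the symmetric algebra. -/
def adDual (B : L) : SymmetricAlgebra ℝ L →ₐ[ℝ] DualNumber (SymmetricAlgebra ℝ L) :=
  SymmetricAlgebra.lift
    { toFun := fun C => TrivSqZeroExt.inl (SymmetricAlgebra.ι ℝ L C) +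
        TrivSqZeroExt.inr (SymmetricAlgebra.ι ℝ L ⁅B, C⁆)
      map_add' := fun C C' => by ext <;> simp
      map_smul' := fun c C => by ext <;> simp }

theorem adDual_ι (B C : L) : adDual B (SymmetricAlgebra.ι ℝ L C) =
    TrivSqZeroExt.inl (SymmetricAlgebra.ι ℝ L C) +
      TrivSqZeroExt.inr (SymmetricAlgebra.ι ℝ L ⁅B, C⁆) :=
  SymmetricAlgebra.lift_ι_apply _ _

theorem fst_adDual (B : L) (f : SymmetricAlgebra ℝ L) : (adDual B f).fst = f := by
  have h : (TrivSqZeroExt.fstHom ℝ _ _).comp (adDual B) = AlgHom.id ℝ (SymmetricAlgebra ℝ L) := by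
    refine SymmetricAlgebra.algHom_ext (LinearMap.ext fun C => ?_)
    change (adDual B (SymmetricAlgebra.ι ℝ L C)).fst = SymmetricAlgebra.ι ℝ L C
    rw [adDual_ι]
    simp
  exact AlgHom.congr_fun h f

/-- The derivation of the symmetric algebra that extends `C ↦ ⁅B, C⁆`. -/
def adS (B : L) : SymmetricAlgebra ℝ L →ₗ[ℝ] SymmetricAlgebra ℝ L :=
  TrivSqZeroExt.sndHom _ _ |>.restrictScalars ℝ |>.comp (adDual B).toLinearMap

theorem adS_apply (B : L) (f : SymmetricAlgebra ℝ L) : adS B f = (adDual B f).snd := rfl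

theorem adS_ι (B C : L) :
    adS B (SymmetricAlgebra.ι ℝ L C) = SymmetricAlgebra.ι ℝ L ⁅B, C⁆ := by
  rw [adS_apply, adDual_ι]
  simp

theorem adS_mul (B : L) (f g : SymmetricAlgebra ℝ L) :
    adS B (f * g) = adS B f * g + f * adS B g := by
  rw [adS_apply, map_mul, TrivSqZeroExt.snd_mul, fst_adDual, fst_adDual, ← adS_apply, ← adS_apply]
  simp only [smul_eq_mul, MulOpposite.smul_eq_mul_unop, MulOpposite.unop_op]
  ring

theorem adS_algebraMap (B : L) (r : ℝ) : adS B (algebraMap ℝ (SymmetricAlgebra ℝ L) r) = 0 := by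
  rw [adS_apply, AlgHom.commutes]
  rfl

theorem map_prod_ofFn {A : Type*} [Ring A] (D : A →+ A) (h1 : D 1 = 0)
    (hD : ∀ a b, D (a * b) = D a * b + a * D b) {m : ℕ} (x : Fin m → A) :
    D (List.ofFn x).prod = ∑ j, (List.ofFn (Function.update x j (D (x j)))).prod := by
  induction m with
  | zero => simpa using h1
  | succ m ih =>
    rw [List.ofFn_succ, List.prod_cons, hD, ih, Fin.sum_univ_succ, Finset.mul_sum]
    congr 1
    · simp [List.ofFn_succ]
    · refine Finset.sum_congr rfl fun j _ => ?_
      rw [List.ofFn_succ, List.prod_cons, Function.update_of_ne (Fin.succ_ne_zero j).symm]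
      congr 3
      funext i
      by_cases hi : i = j
      · subst hi
        simp
      · rw [Function.update_of_ne hi, Function.update_of_ne (by simpa using hi)]

theorem adS_prod (B : L) {m : ℕ} (a : Fin m → L) : adS B (∏ i, SymmetricAlgebra.ι ℝ L (a i)) =
    ∑ j, ∏ i, SymmetricAlgebra.ι ℝ L (Function.update a j ⁅B, a j⁆ i) := by
  have h := map_prod_ofFn (adS B).toAddMonoidHom
    (by simpa using adS_algebraMap B 1) (adS_mul B) fun i => SymmetricAlgebra.ι ℝ L (a i)
  simp only [List.prod_ofFn, LinearMap.toAddMonoidHom_coe, adS_ι] at h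
  rw [h]
  refine Finset.sum_congr rfl fun j _ => Finset.prod_congr rfl fun i _ => ?_
  rw [Function.apply_update fun _ => SymmetricAlgebra.ι ℝ L]

theorem commutator_symProd (B : L) {m : ℕ} (a : Fin m → L) :
    UniversalEnvelopingAlgebra.ι ℝ B * symProd a - symProd a * UniversalEnvelopingAlgebra.ι ℝ B =
      ∑ j, symProd (Function.update a j ⁅B, a j⁆) := by
  set b := UniversalEnvelopingAlgebra.ι ℝ B with hb
  have h : ∀ c : Fin m → L,
      b * (List.ofFn fun i => UniversalEnvelopingAlgebra.ι ℝ (c i)).prod -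
        (List.ofFn fun i => UniversalEnvelopingAlgebra.ι ℝ (c i)).prod * b =
      ∑ j, (List.ofFn fun i =>
        UniversalEnvelopingAlgebra.ι ℝ (Function.update c j ⁅B, c j⁆ i)).prod := by
    intro c
    have h := map_prod_ofFn (AddMonoidHom.mulLeft b - AddMonoidHom.mulRight b) (by simp)
      (fun u v => by simp only [AddMonoidHom.sub_apply, AddMonoidHom.coe_mulLeft,
        AddMonoidHom.coe_mulRight]; noncomm_ring) fun i => UniversalEnvelopingAlgebra.ι ℝ (c i)
    simp only [AddMonoidHom.sub_apply, AddMonoidHom.coe_mulLeft, AddMonoidHom.coe_mulRight] at h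
    rw [h]
    refine Finset.sum_congr rfl fun j _ => ?_
    congr 2
    funext i
    by_cases hi : i = j
    · subst hi
      simp [hb, LieRing.of_associative_ring_bracket]
    · rw [Function.update_of_ne hi, Function.update_of_ne hi]
  simp only [symProd]
  rw [mul_smul_comm, smul_mul_assoc, ← smul_sub, Finset.mul_sum, Finset.sum_mul,
    ← Finset.sum_sub_distrib, ← Finset.smul_sum, Finset.sum_comm]
  congr 1
  refine Finset.sum_congr rfl fun σ _ => ?_
  -- Bracketing the j-th letter of the permuted word is bracketing the letter `σ j` of the original
  -- one.
  rw [h fun i => a (σ i), ← Equiv.sum_comp σ fun j => (List.ofFn fun i =>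
    UniversalEnvelopingAlgebra.ι ℝ (Function.update a j ⁅B, a j⁆ (σ i))).prod]
  refine Finset.sum_congr rfl fun j _ => ?_
  congr 2
  funext i
  by_cases hi : i = j
  · subst hi
    simp
  · rw [Function.update_of_ne hi, Function.update_of_ne (σ.injective.ne hi)]

/-- This turns centrality in U into vanishing of all derivations ad(B) in S. -/
theorem symmetrization_adS (B : L) (f : SymmetricAlgebra ℝ L) : symmetrization L (adS B f) =
    UniversalEnvelopingAlgebra.ι ℝ B * symmetrization L f -
      symmetrization L f * UniversalEnvelopingAlgebra.ι ℝ B := by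
  have h : f ∈ Submodule.span ℝ (Set.range (listS : List L → _)) := by
    rw [span_listS]
    trivial
  induction h using Submodule.span_induction with
  | mem f hf =>
    obtain ⟨l, rfl⟩ := hf
    rw [← List.ofFn_get l, listS_ofFn, adS_prod, map_sum, symmetrization_prod, commutator_symProd]
    exact Finset.sum_congr rfl fun j _ => symmetrization_prod _
  | zero => simp
  | add f g _ _ hf hg =>
    rw [map_add, map_add, map_add, hf, hg]
    noncomm_ring
  | smul c f _ hf =>
    rw [map_smul, map_smul, map_smul, hf, smul_sub, mul_smul_comm, smul_mul_assoc]

theorem mem_center_iff_commute_ι {u : UniversalEnvelopingAlgebra ℝ L} :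
    u ∈ Subalgebra.center ℝ (UniversalEnvelopingAlgebra ℝ L) ↔
      ∀ B : L, UniversalEnvelopingAlgebra.ι ℝ B * u = u * UniversalEnvelopingAlgebra.ι ℝ B := by
  rw [Subalgebra.mem_center_iff]
  refine ⟨fun h B => h _, fun h v => ?_⟩
  have hv : v ∈ Algebra.adjoin ℝ (Set.range (UniversalEnvelopingAlgebra.ι ℝ (L := L))) := by
    rw [adjoin_range_ι]
    trivial
  induction hv using Algebra.adjoin_induction with
  | mem v hv =>
    obtain ⟨B, rfl⟩ := hv
    exact h B
  | algebraMap r => exact Algebra.commutes r u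
  | add v w _ _ hv hw => rw [add_mul, mul_add, hv, hw]
  | mul v w _ _ hv hw => rw [mul_assoc, hw, ← mul_assoc, hv, mul_assoc]

end AdjointAction

/-! ### One-parameter subgroups: group invariance against ad-invariance. -/

section OneParameter

variable {n : ℕ}

theorem symmetrization_mem_center {f : S n} :
    symmetrization (gal n) f ∈ Subalgebra.center ℝ (U n) ↔ ∀ B : gal n, adS B f = 0 := by
  rw [mem_center_iff_commute_ι]
  refine forall_congr' fun B => ?_
  rw [← sub_eq_zero, ← symmetrization_adS, ← map_zero (symmetrization (gal n)),
    symmetrization_injective.eq_iff]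

theorem hasDerivAt_mul_apply {ι : Type*} [Fintype ι] {M N : ℝ → Matrix ι ι ℝ}
    {M' N' : Matrix ι ι ℝ} {s : ℝ} (hM : ∀ i j, HasDerivAt (fun s => M s i j) (M' i j) s)
    (hN : ∀ i j, HasDerivAt (fun s => N s i j) (N' i j) s) (i j : ι) :
    HasDerivAt (fun s => (M s * N s) i j) ((M' * N s + M s * N') i j) s := by
  simp only [Matrix.add_apply, mul_apply, ← Finset.sum_add_distrib]
  exact HasDerivAt.fun_sum fun k _ => (hM i k).mul (hN k j)

/-- The curve `g` in the Galilean group satisfies `g 0 = 1` and `g' = g B`. -/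
def IsOneParameter (g : ℝ → Gal n) (B : gal n) : Prop :=
  g 0 = 1 ∧ ∀ s i j,
    HasDerivAt (fun s => ((g s : (Mat n)ˣ) : Mat n) i j)
      ((((g s : (Mat n)ˣ) : Mat n) * (B : Mat n)) i j) s ∧
    HasDerivAt (fun s => (((g s : (Mat n)ˣ)⁻¹ : (Mat n)ˣ) : Mat n) i j)
      ((-((B : Mat n) * (((g s : (Mat n)ˣ)⁻¹ : (Mat n)ˣ) : Mat n))) i j) s

theorem IsOneParameter.hasDerivAt_Ad {g : ℝ → Gal n} {B : gal n} (h : IsOneParameter g B) (s : ℝ)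
    (C : gal n) (i j : Fin n ⊕ Fin 2) :
    HasDerivAt (fun s => (Ad n (g s) C : Mat n) i j) ((Ad n (g s) ⁅B, C⁆ : Mat n) i j) s := by
  have h1 := hasDerivAt_mul_apply (N := fun _ => (C : Mat n)) (N' := 0)
    (fun i j => (h.2 s i j).1) fun i j => hasDerivAt_const s _
  have h2 := hasDerivAt_mul_apply h1 (fun i j => (h.2 s i j).2) i j
  have e : (Ad n (g s) ⁅B, C⁆ : Mat n) = ((g s : (Mat n)ˣ) : Mat n) * ((⁅B, C⁆ : gal n) : Mat n) *
      (((g s : (Mat n)ˣ)⁻¹ : (Mat n)ˣ) : Mat n) := rfl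
  rw [e, LieSubalgebra.coe_bracket, Ring.lie_def]
  convert h2 using 1
  congr 1
  noncomm_ring

theorem IsOneParameter.hasDerivAt_evalR {g : ℝ → Gal n} {B : gal n} (h : IsOneParameter g B)
    (s : ℝ) (K' : Matrix (Fin n) (Fin n) ℝ) (W : Matrix (Fin n) (Fin 2) ℝ) (t : ℝ) (f : S n) :
    HasDerivAt (fun s => evalR K' W t (AdS n (g s) f)) (evalR K' W t (AdS n (g s) (adS B f))) s := by
  induction f using SymmetricAlgebra.induction with
  | algebraMap r =>
    rw [adS_algebraMap, map_zero, map_zero]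
    simp only [AlgHom.commutes]
    exact hasDerivAt_const _ _
  | ι C =>
    simp only [adS_ι, AdS_ι, evalR_ι]
    refine ((HasDerivAt.fun_sum fun i _ => HasDerivAt.fun_sum fun j _ => ?_).add
      (HasDerivAt.fun_sum fun i _ => HasDerivAt.fun_sum fun a _ => ?_)).add ?_
    · exact (h.hasDerivAt_Ad s C _ _).smul_const _
    · exact (h.hasDerivAt_Ad s C _ _).smul_const _
    · exact (h.hasDerivAt_Ad s C _ _).smul_const _
  | mul f f' hf hf' =>
    simp only [adS_mul, map_mul, map_add]
    exact hf.mul hf'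
  | add f f' hf hf' =>
    simp only [map_add]
    exact hf.add hf'

theorem AdS_one (f : S n) : AdS n 1 f = f := by
  have h : AdS n 1 = AlgHom.id ℝ (S n) := by
    refine SymmetricAlgebra.algHom_ext (LinearMap.ext fun B => ?_)
    change AdS n 1 (SymmetricAlgebra.ι ℝ (gal n) B) = SymmetricAlgebra.ι ℝ (gal n) B
    rw [AdS_ι]
    congr 1
    ext1
    simp [Ad]
  rw [h]
  rfl

theorem IsOneParameter.adS_eq_zero {g : ℝ → Gal n} {B : gal n} (h : IsOneParameter g B) {f : S n}
    (hf : ∀ s, AdS n (g s) f = f) : adS B f = 0 := by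
  refine eq_zero_of_evalR_eq_zero fun K' W t _ => ?_
  have h1 := h.hasDerivAt_evalR 0 K' W t f
  rw [h.1, AdS_one] at h1
  simp only [hf] at h1
  exact h1.unique (hasDerivAt_const _ _)

/-- At each real point s ↦ Ad(g s) f has zero derivative, hence is constant with value f. -/
theorem IsOneParameter.AdS_eq {g : ℝ → Gal n} {B : gal n} (h : IsOneParameter g B) {f : S n}
    (hf : adS B f = 0) (s : ℝ) : AdS n (g s) f = f := by
  rw [← sub_eq_zero]
  refine eq_zero_of_evalR_eq_zero fun K' W t _ => ?_
  have h1 := fun s => h.hasDerivAt_evalR s K' W t f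
  simp only [hf, map_zero] at h1
  have h2 := is_const_of_deriv_eq_zero (fun s => (h1 s).differentiableAt)
    (fun s => (h1 s).deriv) s 0
  rw [map_sub, h2, h.1, AdS_one, sub_self]

/-- An element of the Galilean Lie algebra from its blocks. -/
def algElt {J : Matrix (Fin n) (Fin n) ℝ} (hJ : Jᵀ = -J) (D : Matrix (Fin n) (Fin 2) ℝ) (t : ℝ) :
    gal n := ⟨algMat J D t, J, D, t, hJ, rfl⟩

theorem fin_two_zero : (!![0, 0; 0, 0] : Matrix (Fin 2) (Fin 2) ℝ) = 0 := by
  ext i j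
  fin_cases i <;> fin_cases j <;> rfl

theorem isOneParameter_boost (D : Matrix (Fin n) (Fin 2) ℝ) :
    IsOneParameter (fun s => boost (s • D)) (algElt (J := 0) (by simp) D 0) := by
  refine ⟨?_, fun s i j => ?_⟩
  · ext1
    ext1
    simp [boost, grpMat, ← one_fin_two]
  have e1 : grpMat 1 (s • D) 0 * algMat 0 D 0 = algMat 0 D 0 := by
    simp [grpMat, algMat, fromBlocks_multiply, ← one_fin_two, fin_two_zero]
  have e2 : algMat 0 D 0 * grpMat 1 (-(s • D)) 0 = algMat 0 D 0 := by
    simp [grpMat, algMat, fromBlocks_multiply, ← one_fin_two, fin_two_zero]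
  change HasDerivAt (fun s => grpMat 1 (s • D) 0 i j) ((grpMat 1 (s • D) 0 * algMat 0 D 0) i j) s ∧
    HasDerivAt (fun s => grpMat 1 (-(s • D)) 0 i j)
      ((-(algMat 0 D 0 * grpMat 1 (-(s • D)) 0)) i j) s
  rw [e1, e2]
  rcases i with i | i <;> rcases j with j | j <;> simp [grpMat, algMat, hasDerivAt_const]
  · exact ⟨by simpa using (hasDerivAt_id s).mul_const (D i j),
      by simpa using ((hasDerivAt_id s).mul_const (D i j)).fun_neg⟩
  · fin_cases i <;> fin_cases j <;> simp [hasDerivAt_const]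

theorem isOneParameter_timeShift :
    IsOneParameter (fun s => timeShift n s) (algElt (J := 0) (by simp) 0 1) := by
  refine ⟨?_, fun s i j => ?_⟩
  · ext1
    ext1
    simp [timeShift, grpMat, ← one_fin_two]
  have e1 : grpMat (n := n) 1 0 s * algMat 0 0 1 = algMat 0 0 1 := by
    simp [grpMat, algMat, fromBlocks_multiply]
  have e2 : algMat (n := n) 0 0 1 * grpMat 1 0 (-s) = algMat 0 0 1 := by
    simp [grpMat, algMat, fromBlocks_multiply]
    ext i
    fin_cases i <;> rfl
  change HasDerivAt (fun s => grpMat (n := n) 1 0 s i j) ((grpMat 1 0 s * algMat 0 0 1 : Mat n) i j) s ∧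
    HasDerivAt (fun s => grpMat (n := n) 1 0 (-s) i j) ((-(algMat 0 0 1 * grpMat 1 0 (-s)) : Mat n) i j) s
  rw [e1, e2]
  rcases i with i | i <;> rcases j with j | j <;> simp [grpMat, algMat, hasDerivAt_const]
  fin_cases i <;> fin_cases j <;> simp [hasDerivAt_const]
  exact ⟨hasDerivAt_id s, (hasDerivAt_id s).neg⟩

/-- For a skew-symmetric `J` with `J³ = -J`, the orthogonal matrix `exp (s J)`. -/
def planeRotation (J : Matrix (Fin n) (Fin n) ℝ) (s : ℝ) : Matrix (Fin n) (Fin n) ℝ :=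
  1 + (1 - Real.cos s) • (J * J) + Real.sin s • J

theorem transpose_planeRotation {J : Matrix (Fin n) (Fin n) ℝ} (hJ : Jᵀ = -J) (s : ℝ) :
    (planeRotation J s)ᵀ = 1 + (1 - Real.cos s) • (J * J) - Real.sin s • J := by
  simp [planeRotation, hJ, sub_eq_add_neg]

theorem planeRotation_mul {J : Matrix (Fin n) (Fin n) ℝ} (hJ3 : J * J * J = -J) (s : ℝ) :
    planeRotation J s * J = Real.sin s • (J * J) + Real.cos s • J := by
  rw [planeRotation, add_mul, add_mul, one_mul, smul_mul_assoc, smul_mul_assoc, hJ3]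
  module

theorem transpose_planeRotation_mul_self {J : Matrix (Fin n) (Fin n) ℝ} (hJ : Jᵀ = -J)
    (hJ3 : J * J * J = -J) (s : ℝ) : (planeRotation J s)ᵀ * planeRotation J s = 1 := by
  have h1 : J * (J * J) = -J := by rw [← mul_assoc, hJ3]
  have h2 : J * J * (J * J) = -(J * J) := by rw [← mul_assoc, hJ3, neg_mul]
  rw [transpose_planeRotation hJ, planeRotation]
  simp only [add_mul, mul_add, sub_mul, one_mul, mul_one, smul_mul_assoc, mul_smul_comm, hJ3, h1,
    h2]
  have hs := Real.sin_sq_add_cos_sq s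
  match_scalars <;> first | ring1 | linear_combination (-1 : ℝ) * hs

theorem isOneParameter_rotation {J : Matrix (Fin n) (Fin n) ℝ} (hJ : Jᵀ = -J)
    (hJ3 : J * J * J = -J) :
    IsOneParameter (fun s => rotation (planeRotation J s) (transpose_planeRotation_mul_self hJ hJ3 s))
      (algElt hJ 0 0) := by
  refine ⟨?_, fun s i j => ?_⟩
  · ext1
    ext1
    simp [rotation, planeRotation, grpMat, ← one_fin_two]
  have e1 : grpMat (planeRotation J s) 0 0 * algMat J 0 0 =
      algMat (Real.sin s • (J * J) + Real.cos s • J) 0 0 := by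
    simp [grpMat, algMat, fromBlocks_multiply, planeRotation_mul hJ3, ← one_fin_two]
  have e2 : -(algMat J 0 0 * grpMat (planeRotation J s)ᵀ 0 0) =
      algMat (Real.sin s • (J * J) - Real.cos s • J) 0 0 := by
    have h : J * (J * J) = -J := by rw [← mul_assoc, hJ3]
    have h2 : -(J * (planeRotation J s)ᵀ) = Real.sin s • (J * J) - Real.cos s • J := by
      rw [transpose_planeRotation hJ, mul_sub, mul_add, mul_one, mul_smul_comm, mul_smul_comm, h]
      module
    ext i j
    have h2' := fun i j => congrFun (congrFun h2 i) j
    rcases i with i | i <;> rcases j with j | j <;>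
      simp [grpMat, algMat, fromBlocks_multiply, ← one_fin_two, fin_two_zero]
    · simpa using h2' i j
  change HasDerivAt (fun s => grpMat (planeRotation J s) 0 0 i j)
      ((grpMat (planeRotation J s) 0 0 * algMat J 0 0) i j) s ∧
    HasDerivAt (fun s => grpMat (planeRotation J s)ᵀ 0 0 i j)
      ((-(algMat J 0 0 * grpMat (planeRotation J s)ᵀ 0 0)) i j) s
  rw [e1, e2]
  have hc : HasDerivAt (fun s => 1 - Real.cos s) (Real.sin s) s := by
    simpa using (Real.hasDerivAt_cos s).const_sub 1
  rcases i with i | i <;> rcases j with j | j <;> simp [grpMat, algMat, hasDerivAt_const]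
  · constructor
    · simp only [planeRotation, Matrix.add_apply, Matrix.smul_apply, smul_eq_mul]
      exact ((hc.mul_const _).const_add _).add ((Real.hasDerivAt_sin s).mul_const _)
    · have h : ∀ s, planeRotation J s j i = (planeRotation J s)ᵀ i j := fun _ => rfl
      simp only [h, transpose_planeRotation hJ, Matrix.add_apply, Matrix.sub_apply,
        Matrix.smul_apply, smul_eq_mul]
      exact ((hc.mul_const _).const_add _).sub ((Real.hasDerivAt_sin s).mul_const _)
  · fin_cases i <;> fin_cases j <;> simp [hasDerivAt_const]

/-- The generator of the rotations in the plane spanned by orthonormal vectors `p` and `q`. -/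
def planeGenerator (p q : Fin n → ℝ) : Matrix (Fin n) (Fin n) ℝ := vecMulVec p q - vecMulVec q p

theorem transpose_planeGenerator (p q : Fin n → ℝ) :
    (planeGenerator p q)ᵀ = -planeGenerator p q := by
  simp [planeGenerator, transpose_vecMulVec]

theorem planeGenerator_mul_self {p q : Fin n → ℝ} (hp : p ⬝ᵥ p = 1) (hq : q ⬝ᵥ q = 1)
    (hpq : p ⬝ᵥ q = 0) :
    planeGenerator p q * planeGenerator p q = -(vecMulVec p p + vecMulVec q q) := by
  have hqp : q ⬝ᵥ p = 0 := by rw [dotProduct_comm, hpq]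
  simp only [planeGenerator, sub_mul, mul_sub, vecMulVec_mul_vecMulVec, hp, hq, hpq, hqp]
  simp
  abel

theorem planeGenerator_cube {p q : Fin n → ℝ} (hp : p ⬝ᵥ p = 1) (hq : q ⬝ᵥ q = 1)
    (hpq : p ⬝ᵥ q = 0) : planeGenerator p q * planeGenerator p q * planeGenerator p q =
      -planeGenerator p q := by
  have hqp : q ⬝ᵥ p = 0 := by rw [dotProduct_comm, hpq]
  rw [planeGenerator_mul_self hp hq hpq]
  simp only [planeGenerator, neg_mul, add_mul, mul_sub, vecMulVec_mul_vecMulVec, hp, hq, hpq, hqp]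
  simp
  abel

theorem adS_eq_zero_of_mem_invariantsS {f : S n} (hf : f ∈ invariantsS n) (B : gal n) :
    adS B f = 0 := by
  have hinv := mem_invariantsS.1 hf
  rw [← symmetrization_injective.eq_iff, map_zero, symmetrization_adS, sub_eq_zero]
  -- Linearity in B is immediate for commutators in U, so the spanning argument is carried out
  -- there.
  let N : Submodule ℝ (gal n) :=
    { carrier := {B | UniversalEnvelopingAlgebra.ι ℝ B * symmetrization (gal n) f =
        symmetrization (gal n) f * UniversalEnvelopingAlgebra.ι ℝ B}
      zero_mem' := by simp
      add_mem' := fun {B C} hB hC => by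
        simp only [Set.mem_ofPred_eq, map_add, add_mul, mul_add] at hB hC ⊢
        rw [hB, hC]
      smul_mem' := fun c B hB => by
        simp only [Set.mem_ofPred_eq, map_smul, smul_mul_assoc, mul_smul_comm] at hB ⊢
        rw [hB] }
  have hN : ∀ {g : ℝ → Gal n} {B : gal n}, IsOneParameter g B → B ∈ N := by
    intro g B h
    have := h.adS_eq_zero (f := f) fun s => hinv _
    rw [← symmetrization_injective.eq_iff, map_zero, symmetrization_adS, sub_eq_zero] at this
    exact this
  obtain ⟨_, K', D, t, hK, rfl⟩ := B
  have hgen : ∀ i j : Fin n, algElt (transpose_planeGenerator (Pi.single i 1) (Pi.single j 1)) 0 0 ∈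
      N := by
    intro i j
    by_cases hij : i = j
    · subst hij
      have : algElt (transpose_planeGenerator (Pi.single i (1 : ℝ)) (Pi.single i 1)) 0 0 = 0 := by
        ext1
        simp [algElt, planeGenerator, algMat, fin_two_zero]
      rw [this]
      exact zero_mem _
    · exact hN (isOneParameter_rotation _
        (planeGenerator_cube (by simp) (by simp) (by simp [hij])))
  -- The factor 1/2 compensates for the sum over ordered pairs, in which each coordinate plane
  -- occurs twice.
  have hsum : (⟨algMat K' D t, K', D, t, hK, rfl⟩ : gal n) =
      ∑ i, ∑ j, ((1 / 2 : ℝ) * K' i j) •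
        algElt (transpose_planeGenerator (Pi.single i 1) (Pi.single j 1)) 0 0 +
      algElt (J := 0) (by simp) D 0 + t • algElt (J := 0) (by simp) 0 1 := by
    ext1
    have h1 : ((∑ i, ∑ j, ((1 / 2 : ℝ) * K' i j) •
        algElt (transpose_planeGenerator (Pi.single i 1) (Pi.single j 1)) 0 0 : gal n) : Mat n) =
        algMat (∑ i, ∑ j, ((1 / 2 : ℝ) * K' i j) •
          planeGenerator (Pi.single i 1) (Pi.single j 1)) 0 0 := by
      ext i j
      simp only [AddSubmonoidClass.coe_finsetSum, Matrix.sum_apply]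
      rcases i with i | i <;> rcases j with j | j <;>
        simp [algElt, algMat, fin_two_zero, Matrix.sum_apply]
    have h2 : ∑ i, ∑ j, ((1 / 2 : ℝ) * K' i j) •
        planeGenerator (Pi.single i 1) (Pi.single j 1) = K' := by
      ext a b
      have hab : K' b a = -K' a b := congrFun (congrFun hK a) b
      simp [Matrix.sum_apply, planeGenerator, vecMulVec_apply, Pi.single_apply, mul_sub,
        Finset.sum_sub_distrib]
      linarith
    have h3 : ∀ A B C : gal n, ((A + B + t • C : gal n) : Mat n) =
        (A : Mat n) + B + t • (C : Mat n) := fun _ _ _ => rfl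
    rw [h3, h1, h2]
    simp [algElt, algMat, fromBlocks_add, fromBlocks_smul]
  change _ ∈ N
  rw [hsum]
  exact add_mem (add_mem (sum_mem fun i _ => sum_mem fun j _ => N.smul_mem _ (hgen i j))
    (hN (isOneParameter_boost D))) (N.smul_mem _ (hN isOneParameter_timeShift))

end OneParameter

/-! ### Reflections and their products. -/

section Reflections

variable {n : ℕ}

/-- The matrix of the reflection in the hyperplane orthogonal to a unit vector. -/
def householder (u : Fin n → ℝ) : Matrix (Fin n) (Fin n) ℝ := 1 - (2 : ℝ) • vecMulVec u u

theorem householder_transpose (u : Fin n → ℝ) : (householder u)ᵀ = householder u := by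
  simp [householder, transpose_vecMulVec]

theorem householder_mul_self {u : Fin n → ℝ} (hu : u ⬝ᵥ u = 1) :
    householder u * householder u = 1 := by
  simp only [householder, sub_mul, mul_sub, one_mul, mul_one, smul_mul_assoc, mul_smul_comm,
    vecMulVec_mul_vecMulVec, hu, one_smul]
  module

theorem householder_orthogonal {u : Fin n → ℝ} (hu : u ⬝ᵥ u = 1) :
    (householder u)ᵀ * householder u = 1 := by
  rw [householder_transpose, householder_mul_self hu]

theorem householder_mul_householder {u q : Fin n → ℝ} (hu : u ⬝ᵥ u = 1) (hq : q ⬝ᵥ q = 1)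
    (huq : u ⬝ᵥ q = 0) (φ : ℝ) :
    householder u * householder (Real.cos φ • u + Real.sin φ • q) =
      planeRotation (planeGenerator u q) (2 * φ) := by
  rw [planeRotation, planeGenerator_mul_self hu hq huq, planeGenerator, householder, householder,
    Real.cos_two_mul, Real.sin_two_mul]
  simp only [sub_mul, mul_sub, one_mul, mul_one, smul_mul_assoc, mul_smul_comm,
    add_vecMulVec, vecMulVec_add, smul_vecMulVec, vecMulVec_smul, mul_add,
    vecMulVec_mul_vecMulVec, hu, huq, one_smul, zero_smul, vecMulVec_zero]
  have hs := Real.sin_sq_add_cos_sq φ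
  match_scalars <;> first | ring1 | linear_combination (-2 : ℝ) * hs

theorem householder_mul_eq_one_or {u w : Fin n → ℝ} (hu : u ⬝ᵥ u = 1) (hw : w ⬝ᵥ w = 1) :
    householder u * householder w = 1 ∨ ∃ q, q ⬝ᵥ q = 1 ∧ u ⬝ᵥ q = 0 ∧
      ∃ φ, householder u * householder w = planeRotation (planeGenerator u q) φ := by
  set c := u ⬝ᵥ w with hc
  have hwu : w ⬝ᵥ u = c := dotProduct_comm _ _
  have hr : (w - c • u) ⬝ᵥ (w - c • u) = 1 - c ^ 2 := by
    simp only [sub_dotProduct, dotProduct_sub, smul_dotProduct, dotProduct_smul, hu, hw, hwu, ← hc,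
      smul_eq_mul]
    ring
  have hr0 : 0 ≤ 1 - c ^ 2 := by
    rw [← hr]
    exact Finset.sum_nonneg fun i _ => mul_self_nonneg _
  rcases hr0.eq_or_lt with h0 | h0
  · left
    rw [← h0, dotProduct_self_eq_zero, sub_eq_zero] at hr
    have : householder w = householder u := by
      rw [householder, householder, hr, smul_vecMulVec, vecMulVec_smul, smul_smul c c, ← sq,
        ← sub_eq_zero.1 h0.symm, one_smul]
    rw [this, householder_mul_self hu]
  · right
    have hd : √(1 - c ^ 2) ≠ 0 := (Real.sqrt_pos.2 h0).ne'
    have hd2 : √(1 - c ^ 2) * √(1 - c ^ 2) = 1 - c ^ 2 := Real.mul_self_sqrt hr0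
    have hq : ((√(1 - c ^ 2))⁻¹ • (w - c • u)) ⬝ᵥ ((√(1 - c ^ 2))⁻¹ • (w - c • u)) = 1 := by
      rw [smul_dotProduct, dotProduct_smul, hr, smul_eq_mul, smul_eq_mul]
      generalize √(1 - c ^ 2) = d at *
      rw [← hd2]
      field_simp
    have huq : u ⬝ᵥ ((√(1 - c ^ 2))⁻¹ • (w - c • u)) = 0 := by
      rw [dotProduct_smul, dotProduct_sub, dotProduct_smul, hu, ← hc]
      simp
    -- Two reflections compose to a rotation by twice the angle between their normals, and c is the
    -- cosine of that angle.
    refine ⟨_, hq, huq, 2 * Real.arccos c, ?_⟩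
    rw [← householder_mul_householder hu hq huq, Real.cos_arccos, Real.sin_arccos, smul_smul,
      mul_inv_cancel₀ hd, one_smul, add_sub_cancel] <;> nlinarith

theorem toEuclideanLin_householder {v : EuclideanSpace ℝ (Fin n)} (hv : v ≠ 0)
    (x : EuclideanSpace ℝ (Fin n)) :
    toEuclideanLin (householder (‖v‖⁻¹ • (v : Fin n → ℝ))) x = (ℝ ∙ v)ᗮ.reflection x := by
  rw [Submodule.reflection_orthogonal_apply, Submodule.reflection_singleton_apply]
  have hv' : ‖v‖ ≠ 0 := norm_ne_zero_iff.2 hv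
  ext i
  have h : inner ℝ v x = (v : Fin n → ℝ) ⬝ᵥ x := by
    simp [PiLp.inner_apply, dotProduct, mul_comm]
  rw [h]
  simp [householder, toLpLin_apply, vecMulVec_mulVec]
  field_simp

/-- This is the Cartan–Dieudonné theorem in the form of an induction principle. -/
theorem orthogonal_induction {P : Matrix (Fin n) (Fin n) ℝ → Prop} (one : P 1)
    (mul : ∀ u ρ, u ⬝ᵥ u = 1 → ρᵀ * ρ = 1 → P ρ → P (householder u * ρ))
    {ρ : Matrix (Fin n) (Fin n) ℝ} (hρ : ρᵀ * ρ = 1) : P ρ := by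
  have key : ∀ (l : List (EuclideanSpace ℝ (Fin n))) (ρ : Matrix (Fin n) (Fin n) ℝ),
      ρᵀ * ρ = 1 → (∀ x, toEuclideanLin ρ x = (l.map fun v => (ℝ ∙ v)ᗮ.reflection).prod x) →
      P ρ := by
    intro l
    induction l with
    | nil =>
      intro ρ _ h
      have : ρ = 1 := by
        apply toEuclideanLin.injective
        ext1 x
        rw [h]
        simp
      rwa [this]
    | cons v l ih =>
      intro ρ hρ h'
      have h : ∀ x, toEuclideanLin ρ x =
          (ℝ ∙ v)ᗮ.reflection ((l.map fun v => (ℝ ∙ v)ᗮ.reflection).prod x) := fun x => by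
        rw [h', List.map_cons, List.prod_cons]
        rfl
      by_cases hv : v = 0
      · refine ih ρ hρ fun x => ?_
        rw [h, hv]
        refine Submodule.reflection_mem_subspace_eq_self ?_
        rw [Submodule.span_zero_singleton, Submodule.bot_orthogonal_eq_top]
        trivial
      set w : Fin n → ℝ := ‖v‖⁻¹ • (v : Fin n → ℝ) with hw
      have hww : w ⬝ᵥ w = 1 := by
        have hv' : ‖v‖ ≠ 0 := norm_ne_zero_iff.2 hv
        have h1 : (v : Fin n → ℝ) ⬝ᵥ v = ‖v‖ ^ 2 := by
          rw [← real_inner_self_eq_norm_sq, PiLp.inner_apply]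
          simp [dotProduct, sq]
        rw [hw, smul_dotProduct, dotProduct_smul, h1, smul_eq_mul, smul_eq_mul]
        field_simp
      have h2 : ρ = householder w * (householder w * ρ) := by
        rw [← Matrix.mul_assoc, householder_mul_self hww, Matrix.one_mul]
      have h3 : (householder w * ρ)ᵀ * (householder w * ρ) = 1 := by
        rw [transpose_mul, Matrix.mul_assoc, ← Matrix.mul_assoc _ _ ρ, householder_orthogonal hww,
          Matrix.one_mul, hρ]
      rw [h2]
      refine mul w _ hww h3 (ih _ h3 fun x => ?_)
      have h4 : toEuclideanLin (householder w * ρ) x =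
          toEuclideanLin (householder w) (toEuclideanLin ρ x) := by
        simp [toLpLin_apply, mulVec_mulVec]
      rw [h4, toEuclideanLin_householder hv, h, Submodule.reflection_reflection]
  let φ : EuclideanSpace ℝ (Fin n) →ₗᵢ[ℝ] EuclideanSpace ℝ (Fin n) :=
    (toEuclideanLin ρ).isometryOfInner fun x y => by
      have h1 : ∀ a b : EuclideanSpace ℝ (Fin n), inner ℝ a b = (b : Fin n → ℝ) ⬝ᵥ a := fun a b => by
        simp [PiLp.inner_apply, dotProduct]
      rw [h1, h1]
      change (ρ *ᵥ y) ⬝ᵥ (ρ *ᵥ x) = _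
      rw [dotProduct_mulVec, vecMul_mulVec, hρ, vecMul_one]
  obtain ⟨l, -, hl⟩ := (φ.toLinearIsometryEquiv rfl).reflections_generate_dim
  refine key l ρ hρ fun x => ?_
  rw [← hl]
  rfl

end Reflections

/-! ### The whole center for odd n. -/

section OddCenter

variable {n m : ℕ}

theorem rotation_mul_rotation {ρ ρ' : Matrix (Fin n) (Fin n) ℝ} (hρ : ρᵀ * ρ = 1)
    (hρ' : ρ'ᵀ * ρ' = 1) (h : (ρ * ρ')ᵀ * (ρ * ρ') = 1) :
    rotation (ρ * ρ') h = rotation ρ hρ * rotation ρ' hρ' := by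
  ext1
  ext1
  simp [rotation, grpMat, fromBlocks_multiply, ← one_fin_two]

theorem boost_mul_rotation (D : Matrix (Fin n) (Fin 2) ℝ) {ρ : Matrix (Fin n) (Fin n) ℝ}
    (hρ : ρᵀ * ρ = 1) : boost D * rotation ρ hρ = rotation ρ hρ * boost (ρᵀ * D) := by
  ext1
  ext1
  simp [rotation, boost, grpMat, fromBlocks_multiply, ← one_fin_two, ← Matrix.mul_assoc,
    mul_eq_one_comm.1 hρ]

theorem timeShift_mul_rotation (s : ℝ) {ρ : Matrix (Fin n) (Fin n) ℝ}
    (hρ : ρᵀ * ρ = 1) : timeShift n s * rotation ρ hρ = rotation ρ hρ * timeShift n s := by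
  ext1
  ext1
  simp [rotation, timeShift, grpMat, fromBlocks_multiply, ← one_fin_two]

variable {f : S n}

theorem AdS_boost_of_adS_eq_zero (hf : ∀ B : gal n, adS B f = 0) (D : Matrix (Fin n) (Fin 2) ℝ) :
    AdS n (boost D) f = f := by
  have h := (isOneParameter_boost D).AdS_eq (hf _) 1
  rwa [one_smul] at h

theorem AdS_timeShift_of_adS_eq_zero (hf : ∀ B : gal n, adS B f = 0) (s : ℝ) :
    AdS n (timeShift n s) f = f :=
  isOneParameter_timeShift.AdS_eq (hf _) s

/-- The product of two reflections is a plane rotation or the identity, and ad-invariance makes both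
act trivially on f. -/
theorem AdS_householder_eq (hf : ∀ B : gal n, adS B f = 0) {u w : Fin n → ℝ} (hu : u ⬝ᵥ u = 1)
    (hw : w ⬝ᵥ w = 1) : AdS n (rotation (householder w) (householder_orthogonal hw)) f =
      AdS n (rotation (householder u) (householder_orthogonal hu)) f := by
  have h1 : ∀ ρ hρ, householder u * householder w = ρ → AdS n (rotation ρ hρ) f = f →
      AdS n (rotation (householder w) (householder_orthogonal hw)) f =
      AdS n (rotation (householder u) (householder_orthogonal hu)) f := by
    rintro _ hρ rfl h
    have h2 : AdS n (rotation (householder u) (householder_orthogonal hu))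
        (AdS n (rotation _ hρ) f) =
        AdS n (rotation (householder w) (householder_orthogonal hw)) f := by
      rw [rotation_mul_rotation (householder_orthogonal hu) (householder_orthogonal hw),
        ← AlgHom.comp_apply, ← AdS_mul, ← mul_assoc]
      congr 2
      ext1
      ext1
      simp [rotation, grpMat, fromBlocks_multiply, ← one_fin_two, householder_mul_self hu]
    rw [← h2, h]
  rcases householder_mul_eq_one_or hu hw with h | ⟨q, hq, huq, φ, h⟩
  · refine h1 1 (by simp) h ?_
    have : rotation (1 : Matrix (Fin n) (Fin n) ℝ) (by simp) = 1 := by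
      ext1
      ext1
      simp [rotation, grpMat, ← one_fin_two]
    rw [this, AdS_one]
  · exact h1 _ _ h ((isOneParameter_rotation (transpose_planeGenerator u q)
      (planeGenerator_cube hu hq huq)).AdS_eq (hf _) φ)

/-- Every group element fixes or negates f - r f for one reflection r; choosing r to fix the slice
pointwise makes this difference vanish. -/
theorem mem_invariantsS_of_adS_eq_zero (hn : n = 2 + (2 * m + 1))
    (hf : ∀ B : gal n, adS B f = 0) : f ∈ invariantsS n := by
  have hcard : Fintype.card (Fin n) = Fintype.card (Fin 2 ⊕ ((Fin 2 × Fin m) ⊕ Fin 1)) := by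
    simp [hn]
  let e : Fin n ≃ Fin 2 ⊕ ((Fin 2 × Fin m) ⊕ Fin 1) := Fintype.equivOfCardEq hcard
  -- This is the leftover coordinate, which exists because n is odd; K, v and x vanish on it along
  -- the slice.
  set u : Fin n → ℝ := Pi.single (e.symm (Sum.inr (Sum.inr 0))) 1 with hu'
  have hu : u ⬝ᵥ u = 1 := by simp [u]
  set r := rotation (householder u) (householder_orthogonal hu) with hr
  set h := f - AdS n r f with hh
  -- Each reflection exchanges f and r f, so every orthogonal matrix either fixes both or exchanges
  -- them, according to parity.
  have hrot : ∀ {ρ : Matrix (Fin n) (Fin n) ℝ} (hρ : ρᵀ * ρ = 1),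
      (AdS n (rotation ρ hρ) f = f ∧ AdS n (rotation ρ hρ) (AdS n r f) = AdS n r f) ∨
      (AdS n (rotation ρ hρ) f = AdS n r f ∧ AdS n (rotation ρ hρ) (AdS n r f) = f) := by
    intro ρ hρ
    refine orthogonal_induction (P := fun ρ => ∀ hρ : ρᵀ * ρ = 1, (AdS n (rotation ρ hρ) f = f ∧
        AdS n (rotation ρ hρ) (AdS n r f) = AdS n r f) ∨
      (AdS n (rotation ρ hρ) f = AdS n r f ∧ AdS n (rotation ρ hρ) (AdS n r f) = f))
      (fun h1 => ?_) (fun w ρ hw hρ ih h1 => ?_) hρ hρ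
    · have : rotation (1 : Matrix (Fin n) (Fin n) ℝ) h1 = 1 := by
        ext1
        ext1
        simp [rotation, grpMat, ← one_fin_two]
      rw [this, AdS_one, AdS_one]
      exact Or.inl ⟨rfl, rfl⟩
    · have e1 : AdS n (rotation (householder w) (householder_orthogonal hw)) f = AdS n r f :=
        AdS_householder_eq hf hu hw
      have e2 : AdS n (rotation (householder w) (householder_orthogonal hw)) (AdS n r f) = f := by
        rw [← e1, ← AlgHom.comp_apply, ← AdS_mul]
        have : rotation (householder w) (householder_orthogonal hw) *
            rotation (householder w) (householder_orthogonal hw) = 1 := by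
          ext1
          ext1
          simp [rotation, grpMat, fromBlocks_multiply, ← one_fin_two, householder_mul_self hw]
        rw [this, AdS_one]
      rw [rotation_mul_rotation (householder_orthogonal hw) hρ, AdS_mul, AlgHom.comp_apply,
        AlgHom.comp_apply]
      rcases ih hρ with ⟨h2, h3⟩ | ⟨h2, h3⟩ <;> rw [h2, h3, e1, e2]
      · exact Or.inr ⟨rfl, rfl⟩
      · exact Or.inl ⟨rfl, rfl⟩
  have hh0 : h = 0 := by
    refine eq_zero_of_slice (ε := 1) (fun g => ?_) le_rfl hn e fun α β θ => ?_
    · obtain ⟨D, s, ρ, hρ, rfl⟩ := exists_eq_mul g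
      have e1 : ∀ D, AdS n (boost D) (AdS n r f) = AdS n r f := fun D => by
        rw [← AlgHom.comp_apply, ← AdS_mul, hr, boost_mul_rotation, AdS_mul, AlgHom.comp_apply,
          AdS_boost_of_adS_eq_zero hf]
      have e2 : AdS n (timeShift n s) (AdS n r f) = AdS n r f := by
        rw [← AlgHom.comp_apply, ← AdS_mul, hr, timeShift_mul_rotation, AdS_mul,
          AlgHom.comp_apply, AdS_timeShift_of_adS_eq_zero hf]
      have e3 := AdS_boost_of_adS_eq_zero hf
      have e4 := AdS_timeShift_of_adS_eq_zero hf
      simp only [AdS_mul, AlgHom.comp_apply, hh, map_sub]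
      rcases hrot hρ with ⟨h2, h3⟩ | ⟨h2, h3⟩ <;> rw [h2, h3, e2, e1, e4, e3]
      · exact Or.inl rfl
      · exact Or.inr (neg_sub _ _).symm
    · have hK := submatrix_transpose_eq_neg e (sliceK_transpose 1 θ)
      rw [hh, map_sub, hr, evalR_rotation hK, householder_transpose, sub_eq_zero]
      have h1 : householder u = (diagonal fun j => if j = Sum.inr (Sum.inr 0) then -1 else 1 :
          Matrix (Fin 2 ⊕ ((Fin 2 × Fin m) ⊕ Fin 1)) _ ℝ).submatrix e e := by
        ext i j
        simp only [householder, u, submatrix_apply, diagonal_apply, e.injective.eq_iff,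
          Matrix.sub_apply, Matrix.smul_apply, one_apply, vecMulVec_apply, Pi.single_apply,
          Equiv.eq_symm_apply, smul_eq_mul]
        by_cases hij : i = j
        · subst hij
          by_cases hi : e i = Sum.inr (Sum.inr 0)
          · simp [hi]
            norm_num
          · simp [hi]
        · by_cases hi : e i = Sum.inr (Sum.inr 0)
          · have hj : e j ≠ Sum.inr (Sum.inr 0) := fun hj => hij (e.injective (hi.trans hj.symm))
            simp [hi, hj, hij]
          · simp [hi, hij]
      have h2 : (diagonal fun j => if j = Sum.inr (Sum.inr 0) then -1 else 1 :
          Matrix (Fin 2 ⊕ ((Fin 2 × Fin m) ⊕ Fin 1)) _ ℝ) * sliceK 1 θ *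
          (diagonal fun j => if j = Sum.inr (Sum.inr 0) then -1 else 1) = sliceK 1 θ := by
        ext i j
        rw [mul_diagonal, diagonal_mul]
        rcases i with i | i | i <;> rcases j with j | j | j <;> simp [sliceK, torus]
      have h3 : (diagonal fun j => if j = Sum.inr (Sum.inr 0) then -1 else 1 :
          Matrix (Fin 2 ⊕ ((Fin 2 × Fin m) ⊕ Fin 1)) _ ℝ) *
          (fromRows !![0, α; β, 0] 0 : Matrix (Fin 2 ⊕ ((Fin 2 × Fin m) ⊕ Fin 1)) (Fin 2) ℝ) =
          fromRows !![0, α; β, 0] 0 := by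
        ext i a
        rw [diagonal_mul]
        rcases i with i | i <;> simp
      rw [h1, submatrix_mul_equiv, submatrix_mul_equiv, submatrix_mul_equiv, h2, h3]
  have hfr : AdS n r f = f := (sub_eq_zero.1 hh0).symm
  refine mem_invariantsS_iff.2 ⟨AdS_boost_of_adS_eq_zero hf, AdS_timeShift_of_adS_eq_zero hf,
    fun ρ hρ => ?_⟩
  rcases hrot hρ with ⟨h2, -⟩ | ⟨h2, -⟩
  · exact h2
  · rw [h2, hfr]

end OddCenter

end Galilei
end

/-! ### Assembly of the theorem. -/

theorem mainTheorem2 (n : ℕ) (hn : 3 < n) :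
    Algebra.adjoin ℝ (Set.range (Galilei.gen n)) = Galilei.invariantsS n ∧
    AlgebraicIndependent ℝ (Galilei.gen n) ∧
    (∀ (K : Matrix (Fin n) (Fin n) ℝ) (v x : EuclideanSpace ℝ (Fin n)) (t : ℝ),
      K.transpose = -K → ∀ k : ℕ, 2 ≤ k → 2 * k ≤ n + 2 →
        Galilei.evalAt (Galilei.algMat K (Matrix.of fun i => ![v i, x i]) t)
            (Galilei.minorSum n (2 * k)) =
          Galilei.evalAt (Galilei.algMat K (Matrix.of fun i => ![v i, x i]) t) (Galilei.Q2 n) *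
            (Galilei.compress K v x).charpoly.coeff (n + 4 - 2 * k)) ∧
    ∃ z : Fin (n / 2 + 1) → Subalgebra.center ℝ (Galilei.U n),
      (∀ i, (z i : Galilei.U n) =
        Galilei.symmetrization (Galilei.gal n) (Galilei.gen n i)) ∧
      AlgebraicIndependent ℝ z ∧
      (Algebra.adjoin ℝ (Set.range z)).map (Subalgebra.center ℝ (Galilei.U n)).val =
        Galilei.invariantsU n ∧
      (Odd n → Algebra.adjoin ℝ (Set.range z) = ⊤) := by
  obtain ⟨m, ε, hε, hn2⟩ : ∃ m ε, ε ≤ 1 ∧ n = 4 + (2 * m + ε) :=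
    ⟨(n - 4) / 2, (n - 4) % 2, by omega, by omega⟩
  have hn2' : n = 2 + (2 * (m + 1) + ε) := by omega
  have hgen := Galilei.adjoin_gen hn2 hε
  have hind := Galilei.algebraicIndependent_gen hn2' hε
  have hcenter : ∀ i, Galilei.symmetrization (Galilei.gal n) (Galilei.gen n i) ∈
      Subalgebra.center ℝ (Galilei.U n) := fun i =>
    Galilei.symmetrization_mem_center.2
      (Galilei.adS_eq_zero_of_mem_invariantsS (Galilei.gen_mem_invariantsS i))
  let z : Fin (n / 2 + 1) → Subalgebra.center ℝ (Galilei.U n) := fun i => ⟨_, hcenter i⟩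
  have hmap := Galilei.adjoin_map_eq_invariantsU (z := z) Galilei.gen_mem_homS (fun _ => rfl) hind
    hgen
  refine ⟨hgen, hind, fun K v x t hK k _ hk => Galilei.evalAt_minorSum hε hn2' hK v x t hk, z,
    fun _ => rfl, Galilei.algebraicIndependent_of_symbols Galilei.gen_mem_homS (fun _ => rfl) hind,
    hmap, fun hodd => ?_⟩
  have hε1 : ε = 1 := by
    obtain ⟨j, hj⟩ := hodd
    omega
  subst hε1
  rw [eq_top_iff]
  rintro ⟨u, hu⟩ -
  obtain ⟨f, rfl⟩ := Galilei.symmetrization_surjective u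
  -- A central element is the symmetrization of an ad-invariant f, which for odd n is invariant
  -- under the whole group.
  have hf := Galilei.mem_invariantsS_of_adS_eq_zero hn2' (Galilei.symmetrization_mem_center.1 hu)
  have h := Galilei.symmetrization_mem_invariantsU.2 hf
  rw [← hmap] at h
  obtain ⟨c, hc, hcu⟩ := h
  have : c = ⟨_, hu⟩ := Subtype.ext hcu
  rwa [← this]
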